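/- Let $n\ge 3$, let $M^n$ be a closed (compact, without boundary) smooth manifold, not necessarily connected or orientable, and let $x:M^n\to\mathbb S^{n+1}\subset\mathbb R^{n+2}$ be a smooth immersion. Give $M$ the induced metric $\mathbf g$, with Ricci tensor ${\rm Ric}$, scalar curvature $R$, normalized scalar curvature $\rho=\frac{R}{n(n-1)}$ and Riemannian volume measure (all integrals below are with respect to it). Let $\nu$ be a unit normal of $M$ in $\mathbb S^{n+1}$ (if $M$ has no global smooth unit normal field, choose the sign of $\nu$ arbitrarily at each point; nothing below depends on the choice), let $A$ be the shape operator with respect to $\nu$, and set $$H=\tfrac1n{\rm Tr}(A),\qquad S=\|A\|^2,\qquad f_3={\rm Tr}(A^3),$$ and let $H_3$ be the third mean curvature, i.e. the third elementary symmetric polynomial of the principal curvatures divided by $\binom n3$. For a unit vector $a\in\mathbb S^{n+1}$ put $\varphi_a=\langle x,a\rangle$, $\psi_a=\langle \nu,a\rangle$, and let $a^{\rm T}$ be the component of $a$ tangent to $M$. The hypersurface is called Integral-Einstein (IE) if $$\int_M\Big({\rm Ric}-\frac Rn\mathbf g\Big)(a^{\rm T},a^{\rm T})=0\qquad\text{for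 all } a\in\mathbb S^{n+1},$$ and minimal if $H\equiv0$. Then $\rho-1=\frac{n^2H^2-S}{n(n-1)}$ on $M$, and $M$ is IE if and only if for all $a\in\mathbb S^{n+1}$ $$\int_M\big(1-(n+1)\varphi_a^2-\psi_a^2\big)=\int_M(\rho-1)\big(1-\varphi_a^2-(n+1)\psi_a^2\big).$$ In particular: (A) If $M$ is minimal, then $M$ is IE if and only if $\int_M S\,\big(1-\varphi_a^2-(n+1)\psi_a^2\big)=0$ for all $a\in\mathbb S^{n+1}$. Moreover, if $M$ is minimal, then $f_3=3\binom n3H_3$ on $M$. (B) If $M$ is minimal and $S$ is a positive constant, then for all $a\in\mathbb S^{n+1}$ $$\int_M\Big({\rm Ric}-\frac Rn\mathbf g\Big)(a^{\rm T},a^{\rm T})=S\Big((n+2)\int_M\varphi_a^2-{\rm Vol}(M)\Big),$$ and $M$ being IE is equivalent to each one of the following conditions: (i) $\int_M\varphi_a^2=\frac1{n+2}{\rm Vol}(M)$ for all $a\in\mathbb S^{n+1}$; (ii) $\int_M\psi_a^2=\frac1{n+2}{\rm Vol}(M)$ for all $a\in\mathbb S^{n+1}$; (iii) $\int_M\varphi_a^2=\int_M\psi_a^2$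 for all $a\in\mathbb S^{n+1}$; (iv) $\int_M\varphi_a\psi_a f_3=0$ for all $a\in\mathbb S^{n+1}$. -/

import Mathlib

open MeasureTheory
open scoped Manifold ContDiff Matrix RealInnerProductSpace

noncomputable section

namespace SubmanifoldGeometry

/-! ### Local Riemannian geometry of a parametrized submanifold -/

section Parametrized

variable {n : ℕ}

/-- The `i`-th partial derivative of a map defined on (an open subset of) `ℝⁿ`. -/
def partialDeriv {F : Type*} [NormedAddCommGroup F] [NormedSpace ℝ F] (i : Fin n)
    (f : EuclideanSpace ℝ (Fin n) → F) (y : EuclideanSpace ℝ (Fin n)) : F :=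
  fderiv ℝ f y (EuclideanSpace.single i 1)

variable {N : ℕ} (X : EuclideanSpace ℝ (Fin n) → EuclideanSpace ℝ (Fin N))
  (y : EuclideanSpace ℝ (Fin n))

/-- The first fundamental form (induced metric) `g_ij = ⟨∂_i X, ∂_j X⟩`. -/
def gram : Matrix (Fin n) (Fin n) ℝ :=
  Matrix.of fun i j => ⟪partialDeriv i X y, partialDeriv j X y⟫

/-- The Christoffel symbols of the Levi-Civita connection of the induced metric,
`Γ^k_ij = ½ ∑_l g^{kl} (∂_i g_jl + ∂_j g_il - ∂_l g_ij)`. -/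
def christoffel (k i j : Fin n) : ℝ :=
  (1 / 2) * ∑ l, (gram X y)⁻¹ k l *
    (partialDeriv i (fun z => gram X z j l) y + partialDeriv j (fun z => gram X z i l) y
      - partialDeriv l (fun z => gram X z i j) y)

/-- The components of the Riemann curvature tensor of the induced metric:
`R(∂_i, ∂_j) ∂_k = ∑_l (riemann l k i j) ∂_l`, with
`R(U, V) W = ∇_U ∇_V W - ∇_V ∇_U W - ∇_[U,V] W`. -/
def riemann (l k i j : Fin n) : ℝ :=
  partialDeriv i (fun z => christoffel X z l j k) y
    - partialDeriv j (fun z => christoffel X z l i k) y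
    + ∑ m, (christoffel X y l i m * christoffel X y m j k
        - christoffel X y l j m * christoffel X y m i k)

/-- The components of the Ricci tensor `Ric(V, W) = Tr (U ↦ R(U, V) W)`. -/
def ricci : Matrix (Fin n) (Fin n) ℝ :=
  Matrix.of fun j k => ∑ i, riemann X y i k i j

end Parametrized

/-! ### Submanifolds immersed in Euclidean space

`x : M → ℝᴺ` is a map from an `n`-dimensional manifold.  Tensors at `p : M` are given by their
components in the preferred chart at `p`. -/

section Immersed

variable (n : ℕ) {N : ℕ} {M : Type*} [TopologicalSpace M]
  [ChartedSpace (EuclideanSpace ℝ (Fin n)) M]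

/-- The map `x` read in the preferred chart around `p`. -/
def param (x : M → EuclideanSpace ℝ (Fin N)) (p : M) :
    EuclideanSpace ℝ (Fin n) → EuclideanSpace ℝ (Fin N) :=
  fun y => x ((extChartAt (𝓡 n) p).symm y)

/-- The induced metric `g` at `p`. -/
def metricAt (x : M → EuclideanSpace ℝ (Fin N)) (p : M) : Matrix (Fin n) (Fin n) ℝ :=
  gram (param n x p) (extChartAt (𝓡 n) p p)

/-- The Ricci tensor of the induced metric at `p`. -/
def ricciAt (x : M → EuclideanSpace ℝ (Fin N)) (p : M) : Matrix (Fin n) (Fin n) ℝ :=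
  ricci (param n x p) (extChartAt (𝓡 n) p p)

/-- The scalar curvature `R = ∑ g^{ij} Ric_ij` of the induced metric. -/
def scalarCurvature (x : M → EuclideanSpace ℝ (Fin N)) (p : M) : ℝ :=
  ((metricAt n x p)⁻¹ * ricciAt n x p).trace

/-- The normalized scalar curvature `ρ = R / (n (n - 1))`. -/
def normalizedScalarCurvature (x : M → EuclideanSpace ℝ (Fin N)) (p : M) : ℝ :=
  scalarCurvature n x p / ((n : ℝ) * ((n : ℝ) - 1))

/-- The tangent component `aᵀ ∈ T_p M` of a constant vector `a` of the ambient space, that is,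
the vector whose image under `dx` is the orthogonal projection of `a` to `dx(T_p M)`.
Its components are `∑_j g^{ij} ⟨a, ∂_j x⟩`. -/
def tangentComponent (x : M → EuclideanSpace ℝ (Fin N)) (a : EuclideanSpace ℝ (Fin N)) (p : M) :
    Fin n → ℝ :=
  (metricAt n x p)⁻¹ *ᵥ fun j => ⟪a, partialDeriv j (param n x p) (extChartAt (𝓡 n) p p)⟫

/-- The function `(Ric - (R / n) g)(aᵀ, aᵀ)`. -/
def einsteinDefect (x : M → EuclideanSpace ℝ (Fin N)) (a : EuclideanSpace ℝ (Fin N)) (p : M) : ℝ :=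
  tangentComponent n x a p ⬝ᵥ
    ((ricciAt n x p - (scalarCurvature n x p / (n : ℝ)) • metricAt n x p) *ᵥ
      tangentComponent n x a p)

variable [MeasurableSpace M]

/-- The Riemannian volume of the domain of the preferred chart around `p`, as a measure on `M`:
the measure `√(det g) dy` on the image of the chart, transported to `M`. -/
def chartVolume (x : M → EuclideanSpace ℝ (Fin N)) (p : M) : Measure M :=
  (((volume : Measure (EuclideanSpace ℝ (Fin n))).withDensity
      fun y => ENNReal.ofReal (√(gram (param n x p) y).det)).restrict
    (extChartAt (𝓡 n) p).target).map (extChartAt (𝓡 n) p).symm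

/-- The Riemannian volume measure of the induced metric: the least measure on `M` that dominates
`√(det g) dy` in every preferred chart.  Since these local measures agree on overlaps, it is the
measure on `M` that restricts to `√(det g) dy` in each chart. -/
def volumeMeasure (x : M → EuclideanSpace ℝ (Fin N)) : Measure M :=
  ⨆ p : M, chartVolume n x p

/-- The Integral-Einstein condition for `x : M → ℝᴺ`:
`∫_M (Ric - (R / n) g)(aᵀ, aᵀ) = 0` for every unit vector `a`. -/
def IsIntegralEinstein (x : M → EuclideanSpace ℝ (Fin N)) : Prop :=
  ∀ a : EuclideanSpace ℝ (Fin N), ‖a‖ = 1 →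
    ∫ p, einsteinDefect n x a p ∂(volumeMeasure n x) = 0

end Immersed

/-! ### Hypersurfaces of the unit sphere -/

section Hypersurface

variable (n : ℕ) {M : Type*} [TopologicalSpace M] [ChartedSpace (EuclideanSpace ℝ (Fin n)) M]

/-- `x` is a smooth immersion of the `n`-manifold `M` in the unit sphere `𝕊ⁿ⁺¹ ⊂ ℝⁿ⁺²`. -/
structure IsSphereHypersurface (x : M → EuclideanSpace ℝ (Fin (n + 2))) : Prop where
  contMDiff : ContMDiff (𝓡 n) 𝓘(ℝ, EuclideanSpace ℝ (Fin (n + 2))) ∞ x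
  norm_eq_one : ∀ p, ‖x p‖ = 1
  injective_mfderiv :
    ∀ p, Function.Injective (mfderiv (𝓡 n) 𝓘(ℝ, EuclideanSpace ℝ (Fin (n + 2))) x p)

/-- `ν p` is, for each `p`, one of the two unit vectors tangent to the sphere at `x p` and normal
to the hypersurface.  No coherent choice of sign is required, so that `M` may be non-orientable;
a smooth unit normal field is a special case. -/
structure IsUnitNormal (x ν : M → EuclideanSpace ℝ (Fin (n + 2))) : Prop where
  norm_eq_one : ∀ p, ‖ν p‖ = 1
  inner_position : ∀ p, ⟪ν p, x p⟫ = 0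
  inner_tangent : ∀ (p : M) (v : TangentSpace (𝓡 n) p),
    ⟪ν p, (mfderiv (𝓡 n) 𝓘(ℝ, EuclideanSpace ℝ (Fin (n + 2))) x p v :
      EuclideanSpace ℝ (Fin (n + 2)))⟫ = 0

variable (x ν : M → EuclideanSpace ℝ (Fin (n + 2)))

/-- The second fundamental form `h_ij = ⟨D_{∂_i} ∂_j x, ν⟩` at `p` with respect to `ν p`. -/
def secondFundamentalForm (p : M) : Matrix (Fin n) (Fin n) ℝ :=
  Matrix.of fun i j =>
    ⟪partialDeriv i (partialDeriv j (param n x p)) (extChartAt (𝓡 n) p p), ν p⟫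

/-- The shape operator `A : T_p M → T_p M`, given by `g(A U, V) = h(U, V)`. -/
def shapeOperator (p : M) : Matrix (Fin n) (Fin n) ℝ :=
  (metricAt n x p)⁻¹ * secondFundamentalForm n x ν p

/-- The mean curvature `H = Tr A / n`. -/
def meanCurvature (p : M) : ℝ :=
  (shapeOperator n x ν p).trace / (n : ℝ)

/-- The squared length `S = ‖A‖² = ∑ g^{ik} g^{jl} h_ij h_kl` of the second fundamental form;
as `A` is self-adjoint, this is `Tr (A²)`. -/
def sqNormShape (p : M) : ℝ :=
  (shapeOperator n x ν p ^ 2).trace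

/-- `f₃ = Tr (A³)`. -/
def traceShapeCube (p : M) : ℝ :=
  (shapeOperator n x ν p ^ 3).trace

/-- The third mean curvature: the third elementary symmetric polynomial of the principal
curvatures (the eigenvalues of `A` with multiplicity), divided by `n choose 3`. -/
def thirdMeanCurvature (p : M) : ℝ :=
  (shapeOperator n x ν p).charpoly.roots.esymm 3 / (n.choose 3 : ℝ)

/-- The hypersurface is minimal: `H = 0`. -/
def IsMinimal : Prop :=
  ∀ p, meanCurvature n x ν p = 0

end Hypersurface

/-- The height function `⟨x, a⟩` of a vector-valued map `x` in the direction `a`: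
`φ_a` is the height function of the position, `ψ_a` that of the unit normal. -/
def height {M : Type*} {N : ℕ} (x : M → EuclideanSpace ℝ (Fin N)) (a : EuclideanSpace ℝ (Fin N))
    (p : M) : ℝ :=
  ⟪x p, a⟫

end SubmanifoldGeometry

end

open SubmanifoldGeometry

/-! Extend the shape operator A by zero to an operator of the flat ambient space, and put T = Tr A,
S = Tr A², φ = ⟨a, x⟩, ψ = ⟨a, ν⟩ with |a| = 1, so that |aᵀ|² = 1 - φ² - ψ². The Gauss equation
gives Ric = (n-1)g + T⟨A·,·⟩ - ⟨A·,A·⟩, hence R = n(n-1) + T² - S, and the Einstein defect is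
T⟨Aa,a⟩ - |Aa|² - (T² - S)|aᵀ|²/n (`einsteinDefect_eq`).

Two divergences carry the argument: div(φ aᵀ) = |aᵀ|² - nφ² + Tφψ, and div(ψ(T aᵀ - Aa)) = -T⟨Aa,a⟩
+ |Aa|² - (n-1)Tφψ + (T² - S)ψ². In the second one the derivatives of T cancel, because Codazzi
makes div A equal to dT. Adding n-1 times the first to the second removes φψ; the defect is then n-1
times the difference of the two integrands of the criterion, minus a divergence
(`integral_einsteinDefect`).

If T = 0, the first formula reads ∫(1 - (n+1)φ² - ψ²) = 0, which gives (A) and, for constant S,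
expresses ∫ψ² through ∫φ²; conditions (i)-(iii) are then proportional linear relations. For (iv),
constancy of S gives div(φA²a) = |Aa|² - Sφ² + φψf₃; comparison with the second formula yields ∫φψf₃
= S(∫φ² - ∫ψ²) (`integral_heights_mul_traceShapeCube`). The formula for f₃ is Newton's identity with
vanishing first power sum.

No continuity of ν is available. Each normal vector extends to a smooth local unit normal, and the
pointwise data (ν, A) agree with the local data up to a common sign (`exists_frame`); every field
and function integrated here is even under (ν, A) ↦ (-ν, -A), hence smooth. The divergence theorem
(`integral_divergence_eq_zero`) follows from a partition of unity and the coordinate formula for the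
divergence. -/

noncomputable section

namespace SubmanifoldGeometry

set_option linter.unusedSectionVars false

/-! ### The pseudo-inverse of an injective linear map -/

section PseudoInverse

open ContinuousLinearMap

variable {E F : Type*} [NormedAddCommGroup E] [InnerProductSpace ℝ E] [FiniteDimensional ℝ E]
  [CompleteSpace E] [NormedAddCommGroup F] [InnerProductSpace ℝ F] [FiniteDimensional ℝ F]
  [CompleteSpace F]

/-- The adjoint as a continuous linear map. -/
def adjointCLM (F E : Type*) [NormedAddCommGroup E] [InnerProductSpace ℝ E]
    [FiniteDimensional ℝ E] [CompleteSpace E] [NormedAddCommGroup F] [InnerProductSpace ℝ F]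
    [FiniteDimensional ℝ F] [CompleteSpace F] : (F →L[ℝ] E) →L[ℝ] (E →L[ℝ] F) :=
  LinearMap.toContinuousLinearMap
    { toFun := fun L => adjoint L
      map_add' := fun L K => map_add _ L K
      map_smul' := fun c L => by simp }

@[simp] lemma adjointCLM_apply (L : F →L[ℝ] E) : adjointCLM F E L = adjoint L := rfl

/-- The trace as a continuous linear form. -/
def traceCLM (E : Type*) [NormedAddCommGroup E] [InnerProductSpace ℝ E]
    [FiniteDimensional ℝ E] [CompleteSpace E] : (E →L[ℝ] E) →L[ℝ] ℝ :=
  LinearMap.toContinuousLinearMap ((LinearMap.trace ℝ E) ∘ₗ (coeLM ℝ))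

lemma traceCLM_apply (T : E →L[ℝ] E) : traceCLM E T = LinearMap.trace ℝ E (T : E →ₗ[ℝ] E) := rfl

lemma traceCLM_comp_comm (S : F →L[ℝ] E) (T : E →L[ℝ] F) :
    traceCLM E (S ∘L T) = traceCLM F (T ∘L S) := by
  simp only [traceCLM_apply, toLinearMap_comp]
  exact LinearMap.trace_comp_comm' _ _

lemma traceCLM_smulRight (l : E →L[ℝ] ℝ) (v : E) : traceCLM E (l.smulRight v) = l v := by
  rw [traceCLM_apply]
  exact LinearMap.trace_smulRight (l : E →ₗ[ℝ] ℝ) v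

lemma traceCLM_id : traceCLM E (ContinuousLinearMap.id ℝ E) = Module.finrank ℝ E := by
  rw [traceCLM_apply]
  exact LinearMap.trace_id ℝ E

lemma traceCLM_eq_sum_inner {ι : Type*} [Fintype ι] (b : OrthonormalBasis ι ℝ E) (T : E →L[ℝ] E) :
    traceCLM E T = ∑ i, ⟪b i, T (b i)⟫ := by
  rw [traceCLM_apply]
  exact LinearMap.trace_eq_sum_inner (T : E →ₗ[ℝ] E) b

lemma traceCLM_adjoint (T : E →L[ℝ] E) : traceCLM E (adjoint T) = traceCLM E T := by
  rw [traceCLM_eq_sum_inner (stdOrthonormalBasis ℝ E), traceCLM_eq_sum_inner (stdOrthonormalBasis ℝ E)]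
  refine Finset.sum_congr rfl fun i _ => ?_
  rw [adjoint_inner_right, real_inner_comm]

/-- The Gram operator `L† L`. -/
def gramOp (L : F →L[ℝ] E) : F →L[ℝ] F := adjoint L ∘L L

/-- The left inverse `(L† L)⁻¹ L†` of an injective linear map `L` that vanishes on the orthogonal
complement of its range. -/
def pinv (L : F →L[ℝ] E) : E →L[ℝ] F := (gramOp L).inverse ∘L adjoint L

lemma inner_gramOp (L : F →L[ℝ] E) (u v : F) : ⟪u, gramOp L v⟫ = ⟪L u, L v⟫ := by
  simp [gramOp, adjoint_inner_right]

lemma gramOp_injective {L : F →L[ℝ] E} (hL : Function.Injective L) :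
    Function.Injective (gramOp L) := by
  rw [injective_iff_map_eq_zero] at hL ⊢
  intro u hu
  apply hL
  rw [← inner_self_eq_zero (𝕜 := ℝ), ← inner_gramOp, hu, inner_zero_right]

/-- The Gram operator of an injective map as an isomorphism. -/
def gramEquiv {L : F →L[ℝ] E} (hL : Function.Injective L) : F ≃L[ℝ] F :=
  (LinearEquiv.ofInjectiveEndo (gramOp L : F →ₗ[ℝ] F) (gramOp_injective hL)).toContinuousLinearEquiv

lemma gramEquiv_coe {L : F →L[ℝ] E} (hL : Function.Injective L) :
    (gramEquiv hL : F →L[ℝ] F) = gramOp L := by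
  ext; rfl

lemma gramOp_isInvertible {L : F →L[ℝ] E} (hL : Function.Injective L) :
    (gramOp L).IsInvertible := ⟨gramEquiv hL, gramEquiv_coe hL⟩

lemma inverse_gramOp_comp {L : F →L[ℝ] E} (hL : Function.Injective L) :
    (gramOp L).inverse ∘L gramOp L = ContinuousLinearMap.id ℝ F :=
  (gramOp_isInvertible hL).inverse_comp_self

lemma gramOp_comp_inverse {L : F →L[ℝ] E} (hL : Function.Injective L) :
    gramOp L ∘L (gramOp L).inverse = ContinuousLinearMap.id ℝ F :=
  (gramOp_isInvertible hL).self_comp_inverse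

lemma inverse_gramOp_apply {L : F →L[ℝ] E} (hL : Function.Injective L) (u : F) :
    (gramOp L).inverse (gramOp L u) = u :=
  DFunLike.congr_fun (inverse_gramOp_comp hL) u

lemma gramOp_apply_inverse {L : F →L[ℝ] E} (hL : Function.Injective L) (u : F) :
    gramOp L ((gramOp L).inverse u) = u :=
  DFunLike.congr_fun (gramOp_comp_inverse hL) u

lemma pinv_comp {L : F →L[ℝ] E} (hL : Function.Injective L) :
    pinv L ∘L L = ContinuousLinearMap.id ℝ F := by
  rw [pinv, comp_assoc]
  exact inverse_gramOp_comp hL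

lemma pinv_apply {L : F →L[ℝ] E} (hL : Function.Injective L) (u : F) : pinv L (L u) = u :=
  DFunLike.congr_fun (pinv_comp hL) u

lemma adjoint_apply_eq_zero {L : F →L[ℝ] E} {v : E} (h : ∀ u, ⟪v, L u⟫ = 0) : adjoint L v = 0 := by
  apply ext_inner_right ℝ
  intro u
  rw [adjoint_inner_left, h, inner_zero_left]

lemma pinv_apply_eq_zero {L : F →L[ℝ] E} {v : E} (h : ∀ u, ⟪v, L u⟫ = 0) : pinv L v = 0 := by
  simp [pinv, adjoint_apply_eq_zero h]

lemma gramOp_adjoint (L : F →L[ℝ] E) : adjoint (gramOp L) = gramOp L := by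
  simp [gramOp, adjoint_comp]

lemma inverse_gramOp_adjoint {L : F →L[ℝ] E} (hL : Function.Injective L) :
    adjoint (gramOp L).inverse = (gramOp L).inverse := by
  have h : adjoint (gramOp L).inverse ∘L gramOp L = ContinuousLinearMap.id ℝ F := by
    have := congrArg adjoint (gramOp_comp_inverse hL)
    rwa [adjoint_comp, gramOp_adjoint, adjoint_id] at this
  calc adjoint (gramOp L).inverse
      = adjoint (gramOp L).inverse ∘L (gramOp L ∘L (gramOp L).inverse) := by
        rw [gramOp_comp_inverse hL, comp_id]
    _ = (gramOp L).inverse := by rw [← comp_assoc, h, id_comp]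

lemma inner_map_pinv {L : F →L[ℝ] E} (hL : Function.Injective L) (u : F) (v : E) :
    ⟪L u, L (pinv L v)⟫ = ⟪L u, v⟫ := by
  rw [← inner_gramOp, pinv, comp_apply, gramOp_apply_inverse hL, adjoint_inner_right]

/-- The hypothesis says that `L ∘ P` is the orthogonal projection to the range of `L`; injectivity
of `L` then determines `P`. -/
lemma eq_pinv {L : F →L[ℝ] E} (hL : Function.Injective L) {P : E →L[ℝ] F}
    (h : ∀ u v, ⟪L u, L (P v)⟫ = ⟪L u, v⟫) : P = pinv L := by
  ext1 v
  apply hL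
  rw [← sub_eq_zero, ← inner_self_eq_zero (𝕜 := ℝ)]
  have : ∀ u, ⟪L u, L (P v) - L (pinv L v)⟫ = 0 := fun u => by
    rw [inner_sub_right, h, inner_map_pinv hL, sub_self]
  simpa using this (P v - pinv L v)

lemma comp_equiv_injective {L : F →L[ℝ] E} (hL : Function.Injective L) (J : F ≃L[ℝ] F) :
    Function.Injective (L ∘L (J : F →L[ℝ] F)) :=
  hL.comp J.injective

/-- Reparametrization keeps the range, hence the orthogonal projection, and only changes the
coordinates by the inverse of `J`. -/
lemma pinv_comp_equiv {L : F →L[ℝ] E} (hL : Function.Injective L) (J : F ≃L[ℝ] F) :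
    pinv (L ∘L (J : F →L[ℝ] F)) = (J.symm : F →L[ℝ] F) ∘L pinv L := by
  refine (eq_pinv (comp_equiv_injective hL J) fun u v => ?_).symm
  simp [inner_map_pinv hL]

/-- Injectivity makes the Gram operator invertible, and operator inversion is smooth at invertible
operators. The smoothness of tangential projections and shape operators rests on this. -/
lemma contDiffAt_pinv {L : F →L[ℝ] E} (hL : Function.Injective L) {k : WithTop ℕ∞} :
    ContDiffAt ℝ k (pinv : (F →L[ℝ] E) → (E →L[ℝ] F)) L := by
  have h1 : ContDiff ℝ k (fun L : F →L[ℝ] E => adjoint L) := (adjointCLM F E).contDiff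
  have h2 : ContDiff ℝ k (gramOp : (F →L[ℝ] E) → (F →L[ℝ] F)) := h1.clm_comp contDiff_id
  have h3 : ContDiffAt ℝ k (fun T : F →L[ℝ] F => T.inverse) (gramOp L) := by
    rw [← gramEquiv_coe hL]
    exact contDiffAt_map_inverse _
  exact (h3.comp L h2.contDiffAt).clm_comp h1.contDiffAt

/-- The orthogonal projection to the range of a hyperplane embedding of codimension two. -/
lemma map_pinv_eq {L : F →L[ℝ] E} (hL : Function.Injective L)
    (hd : Module.finrank ℝ E = Module.finrank ℝ F + 2) {X N : E} (hX : ‖X‖ = 1) (hN : ‖N‖ = 1)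
    (hNX : ⟪N, X⟫ = 0) (hXL : ∀ u, ⟪X, L u⟫ = 0) (hNL : ∀ u, ⟪N, L u⟫ = 0) (v : E) :
    L (pinv L v) = v - ⟪X, v⟫ • X - ⟪N, v⟫ • N := by
  have hXX : ⟪X, X⟫ = 1 := by rw [real_inner_self_eq_norm_sq, hX]; norm_num
  have hNN : ⟪N, N⟫ = 1 := by rw [real_inner_self_eq_norm_sq, hN]; norm_num
  have hXN : ⟪X, N⟫ = 0 := by rw [real_inner_comm, hNX]
  let K : Submodule ℝ E := LinearMap.range (L : F →ₗ[ℝ] E)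
  have hKrank : Module.finrank ℝ K = Module.finrank ℝ F :=
    LinearMap.finrank_range_of_inj hL
  let S : Submodule ℝ E := Submodule.span ℝ (Set.range ![X, N])
  have hon : Orthonormal ℝ ![X, N] := by
    rw [orthonormal_iff_ite]
    intro i j
    fin_cases i <;> fin_cases j <;> simp [hX, hN, hNX, hXN]
  have hSrank : Module.finrank ℝ S = 2 := by
    rw [finrank_span_eq_card hon.linearIndependent]; simp
  have hle : K ≤ Sᗮ := by
    rintro _ ⟨u, rfl⟩
    rw [Submodule.mem_orthogonal]
    intro w hw
    refine Submodule.span_induction ?_ ?_ ?_ ?_ hw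
    · rintro _ ⟨i, rfl⟩
      fin_cases i
      · exact hXL u
      · exact hNL u
    · simp
    · intro a b _ _ ha hb; rw [inner_add_left, ha, hb, add_zero]
    · intro c a _ ha; rw [inner_smul_left, ha, mul_zero]
  -- The range of `L` lies in the orthogonal complement of `X` and `N`, and both have codimension
  -- two.
  have hKS : K = Sᗮ := by
    apply Submodule.eq_of_le_of_finrank_eq hle
    have := S.finrank_add_finrank_orthogonal
    omega
  have hw : v - ⟪X, v⟫ • X - ⟪N, v⟫ • N ∈ K := by
    rw [hKS, Submodule.mem_orthogonal]
    intro w hw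
    refine Submodule.span_induction ?_ ?_ ?_ ?_ hw
    · rintro _ ⟨i, rfl⟩
      fin_cases i
      · simp [inner_sub_right, inner_smul_right, hX, hXN]
      · simp [inner_sub_right, inner_smul_right, hN, hNX]
    · simp
    · intro a b _ _ ha hb; rw [inner_add_left, ha, hb, add_zero]
    · intro c a _ ha; rw [inner_smul_left, ha, mul_zero]
  obtain ⟨u, hu⟩ := hw
  have hu' : L u = v - ⟪X, v⟫ • X - ⟪N, v⟫ • N := hu
  rw [← hu']
  have h1 : v = L u + ⟪X, v⟫ • X + ⟪N, v⟫ • N := by rw [hu']; abel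
  conv_lhs => rw [h1]
  simp only [map_add, map_smul, pinv_apply hL, pinv_apply_eq_zero hXL, pinv_apply_eq_zero hNL,
    smul_zero, add_zero]

/-- A unit vector in the normal space of a hypersurface of the sphere is unique up to sign. -/
lemma unit_normal_unique {L : F →L[ℝ] E} (hL : Function.Injective L)
    (hd : Module.finrank ℝ E = Module.finrank ℝ F + 2) {X N N' : E} (hX : ‖X‖ = 1) (hN : ‖N‖ = 1)
    (hNX : ⟪N, X⟫ = 0) (hXL : ∀ u, ⟪X, L u⟫ = 0) (hNL : ∀ u, ⟪N, L u⟫ = 0)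
    (hN' : ‖N'‖ = 1) (hNX' : ⟪N', X⟫ = 0) (hNL' : ∀ u, ⟪N', L u⟫ = 0) :
    ∃ c : ℝ, (c = 1 ∨ c = -1) ∧ N' = c • N := by
  -- The tangential part of `N'` and its component along `X` vanish, so only a multiple of `N`
  -- remains.
  have h := map_pinv_eq hL hd hX hN hNX hXL hNL N'
  rw [pinv_apply_eq_zero hNL', map_zero, real_inner_comm, hNX'] at h
  have h' : N' = ⟪N, N'⟫ • N := by
    rw [zero_smul, sub_zero] at h
    exact (sub_eq_zero.mp h.symm)
  refine ⟨⟪N, N'⟫, ?_, h'⟩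
  have h2 : ‖N'‖ = |⟪N, N'⟫| * ‖N‖ := by
    conv_lhs => rw [h', norm_smul, Real.norm_eq_abs]
  rw [hN, hN', mul_one] at h2
  exact (abs_eq zero_le_one).mp h2.symm

end PseudoInverse

/-! ### Parametrized hypersurfaces of the sphere -/

section Patch

open ContinuousLinearMap

variable {E F : Type*} [NormedAddCommGroup E] [InnerProductSpace ℝ E] [FiniteDimensional ℝ E]
  [CompleteSpace E] [NormedAddCommGroup F] [InnerProductSpace ℝ F] [FiniteDimensional ℝ F]
  [CompleteSpace F]

/-- `X` parametrizes, on the open set `U`, a hypersurface of the unit sphere with smooth unit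
normal field `ν`. -/
structure IsPatch (X ν : F → E) (U : Set F) : Prop where
  finrank_eq : Module.finrank ℝ E = Module.finrank ℝ F + 2
  isOpen : IsOpen U
  contDiffOn : ContDiffOn ℝ ∞ X U
  contDiffOn_normal : ContDiffOn ℝ ∞ ν U
  injective : ∀ y ∈ U, Function.Injective (fderiv ℝ X y)
  norm_eq_one : ∀ y ∈ U, ‖X y‖ = 1
  norm_normal : ∀ y ∈ U, ‖ν y‖ = 1
  inner_position : ∀ y ∈ U, ⟪ν y, X y⟫ = 0
  inner_tangent : ∀ y ∈ U, ∀ u, ⟪ν y, fderiv ℝ X y u⟫ = 0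

/-- The shape operator of a normal field, extended by zero to the normal space. -/
def fieldShape (X ν : F → E) (y : F) : E →L[ℝ] E :=
  -(fderiv ℝ ν y ∘L pinv (fderiv ℝ X y))

/-- The divergence along the parametrized submanifold `X` of a vector field `W`. -/
def surfaceDiv (X W : F → E) (y : F) : ℝ :=
  traceCLM E (fderiv ℝ W y ∘L pinv (fderiv ℝ X y))

lemma two_le_infty : (2 : WithTop ℕ∞) ≤ ∞ := WithTop.coe_le_coe.2 (le_top : (2 : ℕ∞) ≤ ⊤)

/-- The structure equations come from differentiating identities that hold on an open set; this is
the common form of that step. -/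
lemma hasFDerivAt_eq_zero {G : Type*} [NormedAddCommGroup G] [NormedSpace ℝ G] {U : Set F}
    (hU : IsOpen U) {y : F} (hy : y ∈ U) {g : F → G} {g' : F →L[ℝ] G} {c : G}
    (hg : ∀ z ∈ U, g z = c) (h : HasFDerivAt g g' y) : g' = 0 := by
  have h0 : HasFDerivAt g (0 : F →L[ℝ] G) y :=
    (hasFDerivAt_const c y).congr_of_eventuallyEq
      (Filter.eventually_of_mem (hU.mem_nhds hy) hg)
  exact h.unique h0

lemma surfaceDiv_of_hasFDerivAt {X W : F → E} {W' : F →L[ℝ] E} {y : F} (h : HasFDerivAt W W' y) :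
    surfaceDiv X W y = traceCLM E (W' ∘L pinv (fderiv ℝ X y)) := by
  rw [surfaceDiv, h.fderiv]

lemma surfaceDiv_smul {X W : F → E} {f : F → ℝ} {f' : F →L[ℝ] ℝ} {y : F} (hf : HasFDerivAt f f' y)
    (hW : DifferentiableAt ℝ W y) :
    surfaceDiv X (fun z => f z • W z) y =
      f y * surfaceDiv X W y + f' (pinv (fderiv ℝ X y) (W y)) := by
  rw [surfaceDiv_of_hasFDerivAt (hf.fun_smul hW.hasFDerivAt)]
  have : (f y • fderiv ℝ W y + f'.smulRight (W y)) ∘L pinv (fderiv ℝ X y) =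
      f y • (fderiv ℝ W y ∘L pinv (fderiv ℝ X y)) +
        (f' ∘L pinv (fderiv ℝ X y)).smulRight (W y) := by
    ext v; simp
  rw [this, map_add, map_smul, traceCLM_smulRight, surfaceDiv]
  simp

lemma surfaceDiv_sub {X V W : F → E} {y : F} (hV : DifferentiableAt ℝ V y)
    (hW : DifferentiableAt ℝ W y) :
    surfaceDiv X (fun z => V z - W z) y = surfaceDiv X V y - surfaceDiv X W y := by
  rw [surfaceDiv_of_hasFDerivAt (hV.hasFDerivAt.fun_sub hW.hasFDerivAt), sub_comp, map_sub]
  rfl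

/-! ### Structure equations and divergence formulas of a patch. -/

namespace IsPatch

variable {X ν : F → E} {U : Set F} (h : IsPatch X ν U) {y : F} (hy : y ∈ U)

include h hy

lemma contDiffAt : ContDiffAt ℝ ∞ X y := h.contDiffOn.contDiffAt (h.isOpen.mem_nhds hy)

lemma contDiffAt_normal : ContDiffAt ℝ ∞ ν y :=
  h.contDiffOn_normal.contDiffAt (h.isOpen.mem_nhds hy)

lemma contDiffAt_fderiv : ContDiffAt ℝ ∞ (fderiv ℝ X) y :=
  (h.contDiffAt hy).fderiv_right (by simp)

lemma contDiffAt_pinv : ContDiffAt ℝ ∞ (fun z => pinv (fderiv ℝ X z)) y :=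
  (SubmanifoldGeometry.contDiffAt_pinv (h.injective y hy)).comp y (h.contDiffAt_fderiv hy)

lemma contDiffAt_shape : ContDiffAt ℝ ∞ (fieldShape X ν) y :=
  (((h.contDiffAt_normal hy).fderiv_right (by simp)).clm_comp (h.contDiffAt_pinv hy)).neg

lemma hasFDerivAt : HasFDerivAt X (fderiv ℝ X y) y :=
  ((h.contDiffAt hy).differentiableAt (by simp)).hasFDerivAt

lemma hasFDerivAt_shape :
    HasFDerivAt (fieldShape X ν) (fderiv ℝ (fieldShape X ν) y) y :=
  ((h.contDiffAt_shape hy).differentiableAt (by simp)).hasFDerivAt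

lemma shape_map (u : F) : fieldShape X ν y (fderiv ℝ X y u) = -fderiv ℝ ν y u := by
  simp [fieldShape, pinv_apply (h.injective y hy)]

lemma fderiv_normal : fderiv ℝ ν y = -(fieldShape X ν y ∘L fderiv ℝ X y) := by
  ext1 u; simp [h.shape_map hy]

lemma hasFDerivAt_normal :
    HasFDerivAt ν (-(fieldShape X ν y ∘L fderiv ℝ X y)) y := by
  rw [← h.fderiv_normal hy]
  exact ((h.contDiffAt_normal hy).differentiableAt (by simp)).hasFDerivAt

lemma inner_self_eq_one : ⟪X y, X y⟫ = 1 := by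
  rw [real_inner_self_eq_norm_sq, h.norm_eq_one y hy]; norm_num

lemma inner_normal_self : ⟪ν y, ν y⟫ = 1 := by
  rw [real_inner_self_eq_norm_sq, h.norm_normal y hy]; norm_num

lemma inner_position_map (u : F) : ⟪X y, fderiv ℝ X y u⟫ = 0 := by
  have h1 := hasFDerivAt_eq_zero h.isOpen hy (fun z hz => h.inner_self_eq_one hz)
    ((h.hasFDerivAt hy).inner ℝ (h.hasFDerivAt hy))
  have h2 := DFunLike.congr_fun h1 u
  simp only [comp_apply, ContinuousLinearMap.prod_apply, fderivInnerCLM_apply, zero_apply] at h2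
  rw [real_inner_comm (X y) (fderiv ℝ X y u)] at h2
  linarith

lemma inner_fderiv_normal_normal (u : F) : ⟪fderiv ℝ ν y u, ν y⟫ = 0 := by
  have hν := ((h.contDiffAt_normal hy).differentiableAt (by simp)).hasFDerivAt
  have h1 := hasFDerivAt_eq_zero h.isOpen hy (fun z hz => h.inner_normal_self hz)
    (hν.inner ℝ hν)
  have h2 := DFunLike.congr_fun h1 u
  simp only [comp_apply, ContinuousLinearMap.prod_apply, fderivInnerCLM_apply, zero_apply] at h2
  rw [real_inner_comm] at h2
  linarith

lemma inner_fderiv_normal_position (u : F) : ⟪fderiv ℝ ν y u, X y⟫ = 0 := by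
  have hν := ((h.contDiffAt_normal hy).differentiableAt (by simp)).hasFDerivAt
  have h1 := hasFDerivAt_eq_zero h.isOpen hy (fun z hz => h.inner_position z hz)
    (hν.inner ℝ (h.hasFDerivAt hy))
  have h2 := DFunLike.congr_fun h1 u
  simp only [comp_apply, ContinuousLinearMap.prod_apply, fderivInnerCLM_apply, zero_apply] at h2
  rw [h.inner_tangent y hy] at h2
  linarith

lemma proj_eq (v : E) : fderiv ℝ X y (pinv (fderiv ℝ X y) v) =
    v - ⟪X y, v⟫ • X y - ⟪ν y, v⟫ • ν y :=
  map_pinv_eq (h.injective y hy) h.finrank_eq (h.norm_eq_one y hy) (h.norm_normal y hy)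
    (h.inner_position y hy) (h.inner_position_map hy) (h.inner_tangent y hy) v

lemma pinv_position : pinv (fderiv ℝ X y) (X y) = 0 :=
  pinv_apply_eq_zero (h.inner_position_map hy)

lemma pinv_normal : pinv (fderiv ℝ X y) (ν y) = 0 :=
  pinv_apply_eq_zero (h.inner_tangent y hy)

lemma shape_position : fieldShape X ν y (X y) = 0 := by
  simp [fieldShape, h.pinv_position hy]

lemma shape_normal : fieldShape X ν y (ν y) = 0 := by
  simp [fieldShape, h.pinv_normal hy]

lemma inner_shape_position (v : E) : ⟪fieldShape X ν y v, X y⟫ = 0 := by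
  simp [fieldShape, h.inner_fderiv_normal_position hy]

lemma inner_shape_normal (v : E) : ⟪fieldShape X ν y v, ν y⟫ = 0 := by
  simp [fieldShape, h.inner_fderiv_normal_normal hy]

lemma shape_proj (v : E) :
    fieldShape X ν y (fderiv ℝ X y (pinv (fderiv ℝ X y) v)) = fieldShape X ν y v := by
  rw [h.proj_eq hy]
  simp [h.shape_position hy, h.shape_normal hy]

/-- The derivative of `ν` is orthogonal to both `X` and `ν`, so the image of the shape operator is
tangent. -/
lemma proj_shape (v : E) :
    fderiv ℝ X y (pinv (fderiv ℝ X y) (fieldShape X ν y v)) = fieldShape X ν y v := by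
  rw [h.proj_eq hy, real_inner_comm, h.inner_shape_position hy, real_inner_comm,
    h.inner_shape_normal hy]
  simp

lemma sndFDeriv_symm (u w : F) :
    fderiv ℝ (fderiv ℝ X) y u w = fderiv ℝ (fderiv ℝ X) y w u :=
  ((h.contDiffAt hy).isSymmSndFDerivAt (by simp [two_le_infty])).eq u w

lemma sndFDeriv_normal_symm (u w : F) :
    fderiv ℝ (fderiv ℝ ν) y u w = fderiv ℝ (fderiv ℝ ν) y w u :=
  ((h.contDiffAt_normal hy).isSymmSndFDerivAt (by simp [two_le_infty])).eq u w

lemma hasFDerivAt_fderiv :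
    HasFDerivAt (fderiv ℝ X) (fderiv ℝ (fderiv ℝ X) y) y :=
  ((h.contDiffAt_fderiv hy).differentiableAt (by simp)).hasFDerivAt

/-- Differentiate the relation between `ν` and the tangent vector with fixed coordinates `w`, namely
that they are orthogonal. -/
lemma inner_fderiv_normal (u w : F) :
    ⟪fderiv ℝ ν y u, fderiv ℝ X y w⟫ = -⟪ν y, fderiv ℝ (fderiv ℝ X) y u w⟫ := by
  have hν := ((h.contDiffAt_normal hy).differentiableAt (by simp)).hasFDerivAt
  have hL : HasFDerivAt (fun z => fderiv ℝ X z w) ((fderiv ℝ (fderiv ℝ X) y).flip w) y := by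
    simpa using (h.hasFDerivAt_fderiv hy).clm_apply (hasFDerivAt_const w y)
  have h1 := hasFDerivAt_eq_zero h.isOpen hy (fun z hz => h.inner_tangent z hz w)
    (hν.inner ℝ hL)
  have h2 := DFunLike.congr_fun h1 u
  simp only [comp_apply, ContinuousLinearMap.prod_apply, fderivInnerCLM_apply, zero_apply,
    flip_apply] at h2
  linarith

lemma inner_shape_map (u w : F) :
    ⟪fieldShape X ν y (fderiv ℝ X y u), fderiv ℝ X y w⟫ =
      ⟪ν y, fderiv ℝ (fderiv ℝ X) y u w⟫ := by
  rw [h.shape_map hy, inner_neg_left, h.inner_fderiv_normal hy, neg_neg]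

lemma inner_shape_eq (v w : E) : ⟪fieldShape X ν y v, w⟫ =
    ⟪fieldShape X ν y v, fderiv ℝ X y (pinv (fderiv ℝ X y) w)⟫ := by
  rw [h.proj_eq hy, inner_sub_right, inner_sub_right, inner_smul_right, inner_smul_right,
    h.inner_shape_position hy, h.inner_shape_normal hy]
  simp

/-- On tangent vectors, self-adjointness is the symmetry of the second derivative of `X`; normal
components contribute nothing to either side. -/
lemma inner_shape_left (v w : E) : ⟪fieldShape X ν y v, w⟫ = ⟪v, fieldShape X ν y w⟫ := by
  rw [h.inner_shape_eq hy, ← h.shape_proj hy v, h.inner_shape_map hy, h.sndFDeriv_symm hy,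
    ← h.inner_shape_map hy, h.shape_proj hy, ← h.inner_shape_eq hy, real_inner_comm]

/-- Differentiate A X = 0. The ambient derivative of the extended operator does not vanish on normal
vectors; these normal terms, with those of `fderiv_shape_normal`, are the source of the height
functions in the divergence formulas. -/
lemma fderiv_shape_position (u : F) :
    fderiv ℝ (fieldShape X ν) y u (X y) = -fieldShape X ν y (fderiv ℝ X y u) := by
  have h1 := hasFDerivAt_eq_zero h.isOpen hy (fun z hz => h.shape_position hz)
    ((h.hasFDerivAt_shape hy).clm_apply (h.hasFDerivAt hy))
  have h2 := DFunLike.congr_fun h1 u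
  simp only [add_apply, comp_apply, flip_apply, zero_apply] at h2
  exact eq_neg_of_add_eq_zero_right h2

lemma fderiv_shape_normal (u : F) :
    fderiv ℝ (fieldShape X ν) y u (ν y) =
      fieldShape X ν y (fieldShape X ν y (fderiv ℝ X y u)) := by
  have h1 := hasFDerivAt_eq_zero h.isOpen hy (fun z hz => h.shape_normal hz)
    ((h.hasFDerivAt_shape hy).clm_apply (h.hasFDerivAt_normal hy))
  have h2 := DFunLike.congr_fun h1 u
  simp only [add_apply, comp_apply, flip_apply, zero_apply, neg_apply, map_neg] at h2
  rw [neg_add_eq_zero] at h2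
  exact h2.symm

/-- The Codazzi equation. -/
lemma codazzi (u w : F) :
    fderiv ℝ (fieldShape X ν) y u (fderiv ℝ X y w) =
      fderiv ℝ (fieldShape X ν) y w (fderiv ℝ X y u) := by
  have h1 : HasFDerivAt (fderiv ℝ ν) (fderiv ℝ (fderiv ℝ ν) y) y :=
    (((h.contDiffAt_normal hy).fderiv_right (m := ∞) (by simp)).differentiableAt
      (by simp)).hasFDerivAt
  have h2 := ((h.hasFDerivAt_shape hy).clm_comp (h.hasFDerivAt_fderiv hy)).neg
  -- Differentiate dν = -A ∘ dX. The second derivatives of `ν` and of `X` are symmetric, so the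
  -- remaining term, which contains the derivative of A, is symmetric as well.
  have h3 := h1.unique (h2.congr_of_eventuallyEq
    (Filter.eventually_of_mem (h.isOpen.mem_nhds hy) fun z hz => h.fderiv_normal hz))
  have h4 : ∀ u w, fderiv ℝ (fderiv ℝ ν) y u w =
      -(fieldShape X ν y (fderiv ℝ (fderiv ℝ X) y u w)
        + fderiv ℝ (fieldShape X ν) y u (fderiv ℝ X y w)) := by
    intro u w
    rw [h3]
    simp
  have h5 := h.sndFDeriv_normal_symm hy u w
  rw [h4, h4, h.sndFDeriv_symm hy u w] at h5
  simpa using h5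

lemma trace_proj : traceCLM E (fderiv ℝ X y ∘L pinv (fderiv ℝ X y)) = Module.finrank ℝ F := by
  rw [traceCLM_comp_comm, pinv_comp (h.injective y hy), traceCLM_id]

/-- The tangential projection is the identity minus the rank-one projections to `X` and `ν`. -/
lemma trace_comp_proj (B : E →L[ℝ] E) :
    traceCLM E (B ∘L fderiv ℝ X y ∘L pinv (fderiv ℝ X y)) =
      traceCLM E B - ⟪X y, B (X y)⟫ - ⟪ν y, B (ν y)⟫ := by
  have : B ∘L fderiv ℝ X y ∘L pinv (fderiv ℝ X y) =
      B - (innerSL ℝ (X y)).smulRight (B (X y)) - (innerSL ℝ (ν y)).smulRight (B (ν y)) := by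
    ext1 v
    simp [h.proj_eq hy]
  rw [this, map_sub, map_sub, traceCLM_smulRight, traceCLM_smulRight]
  simp

/-- Split `w` into its tangential and normal parts. Codazzi exchanges the direction of
differentiation with the tangential part, while the normal parts are handled by the derivatives of A
X = 0 and A ν = 0. With B the identity the result contains the derivative of Tr A; with B = A, half
the derivative of Tr A². -/
lemma trace_comp_fderiv_shape (B : E →L[ℝ] E) (w : E) :
    traceCLM E (B ∘L (fderiv ℝ (fieldShape X ν) y).flip w ∘L pinv (fderiv ℝ X y)) =
      traceCLM E (B ∘L fderiv ℝ (fieldShape X ν) y (pinv (fderiv ℝ X y) w))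
      + ⟪X y, B (fieldShape X ν y w)⟫
      - ⟪ν y, B (fieldShape X ν y (fieldShape X ν y w))⟫
      - ⟪X y, w⟫ * traceCLM E (B ∘L fieldShape X ν y)
      + ⟪ν y, w⟫ * traceCLM E (B ∘L fieldShape X ν y ∘L fieldShape X ν y) := by
  set L := fderiv ℝ X y with hLdef
  set A := fieldShape X ν y with hA
  set D := fderiv ℝ (fieldShape X ν) y with hD
  have key : B ∘L D.flip w ∘L pinv L =
      (B ∘L D (pinv L w)) ∘L L ∘L pinv L - ⟪X y, w⟫ • (B ∘L A) + ⟪ν y, w⟫ • (B ∘L A ∘L A) := by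
    ext1 v
    have e1 : w = L (pinv L w) + ⟪X y, w⟫ • X y + ⟪ν y, w⟫ • ν y := by
      rw [hLdef, h.proj_eq hy]; abel
    have e2 : D (pinv L v) w = D (pinv L w) (L (pinv L v)) - ⟪X y, w⟫ • A v
        + ⟪ν y, w⟫ • A (A v) := by
      conv_lhs => rw [e1]
      rw [map_add, map_add, map_smul, map_smul, h.codazzi hy, h.fderiv_shape_position hy,
        h.fderiv_shape_normal hy, h.shape_proj hy, smul_neg, ← sub_eq_add_neg]
    simp only [comp_apply, flip_apply, add_apply, sub_apply, smul_apply]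
    rw [e2]
    simp only [map_add, map_sub, map_smul]
  rw [key, map_add, map_sub, map_smul, map_smul, h.trace_comp_proj hy]
  simp only [comp_apply, smul_eq_mul]
  rw [h.fderiv_shape_position hy, h.fderiv_shape_normal hy, h.shape_proj hy, map_neg,
    inner_neg_right]
  ring

lemma hasFDerivAt_trace_shape :
    HasFDerivAt (fun z => traceCLM E (fieldShape X ν z))
      (traceCLM E ∘L fderiv ℝ (fieldShape X ν) y) y :=
  (traceCLM E).hasFDerivAt.comp y (h.hasFDerivAt_shape hy)

/-- Since aᵀ is the gradient of φ, this is the Laplacian of a height function: Δφ = -nφ + Tψ. -/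
lemma surfaceDiv_tangent (a : E) :
    surfaceDiv X (fun z => a - ⟪a, X z⟫ • X z - ⟪a, ν z⟫ • ν z) y =
      -(Module.finrank ℝ F) * ⟪a, X y⟫ + traceCLM E (fieldShape X ν y) * ⟪a, ν y⟫ := by
  have hX := h.hasFDerivAt hy
  have hν := h.hasFDerivAt_normal hy
  have h1 : HasFDerivAt (fun z => ⟪a, X z⟫) (innerSL ℝ a ∘L fderiv ℝ X y) y :=
    (innerSL ℝ a).hasFDerivAt.comp y hX
  have h2 : HasFDerivAt (fun z => ⟪a, ν z⟫)
      (innerSL ℝ a ∘L (-(fieldShape X ν y ∘L fderiv ℝ X y))) y :=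
    (innerSL ℝ a).hasFDerivAt.comp y hν
  have h3 := ((hasFDerivAt_const a y).fun_sub (h1.fun_smul hX)).fun_sub (h2.fun_smul hν)
  rw [surfaceDiv_of_hasFDerivAt h3]
  set L := fderiv ℝ X y with hLdef
  set A := fieldShape X ν y with hA
  have key : ((0 : F →L[ℝ] E) - (⟪a, X y⟫ • L + (innerSL ℝ a ∘L L).smulRight (X y)) -
      (⟪a, ν y⟫ • -(A ∘L L) + (innerSL ℝ a ∘L (-(A ∘L L))).smulRight (ν y))) ∘L pinv L =
      -(⟪a, X y⟫ • (L ∘L pinv L)) - (innerSL ℝ a ∘L L ∘L pinv L).smulRight (X y)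
        + ⟪a, ν y⟫ • A + (innerSL ℝ a ∘L A).smulRight (ν y) := by
    ext1 v
    simp only [comp_apply, add_apply, sub_apply, smul_apply, neg_apply, zero_apply,
      smulRight_apply, hLdef, hA, h.shape_proj hy, map_neg, smul_neg, neg_smul]
    abel
  rw [key]
  simp only [map_add, map_sub, map_neg, map_smul, traceCLM_smulRight, comp_apply]
  rw [h.trace_proj hy, h.pinv_position hy, h.shape_normal hy]
  simp only [map_zero, smul_eq_mul]
  ring

lemma differentiableAt_tangent (a : E) :
    DifferentiableAt ℝ (fun z => a - ⟪a, X z⟫ • X z - ⟪a, ν z⟫ • ν z) y := by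
  have hX := (h.hasFDerivAt hy).differentiableAt
  have hν := (h.hasFDerivAt_normal hy).differentiableAt
  exact ((differentiableAt_const a).fun_sub (((differentiableAt_const a).inner ℝ hX).fun_smul hX)
    ).fun_sub (((differentiableAt_const a).inner ℝ hν).fun_smul hν)

/-- Traced Codazzi equation: the divergence of A is the differential of its trace, and the two
remaining terms come from the normal part of `a`. -/
lemma surfaceDiv_shape (a : E) :
    surfaceDiv X (fun z => fieldShape X ν z a) y =
      traceCLM E (fderiv ℝ (fieldShape X ν) y (pinv (fderiv ℝ X y) a))
        - ⟪a, X y⟫ * traceCLM E (fieldShape X ν y)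
        + ⟪a, ν y⟫ * traceCLM E (fieldShape X ν y ∘L fieldShape X ν y) := by
  have h1 : HasFDerivAt (fun z => fieldShape X ν z a) ((fderiv ℝ (fieldShape X ν) y).flip a) y := by
    simpa using (h.hasFDerivAt_shape hy).clm_apply (hasFDerivAt_const a y)
  rw [surfaceDiv_of_hasFDerivAt h1]
  have h2 := h.trace_comp_fderiv_shape hy (ContinuousLinearMap.id ℝ E) a
  simp only [id_comp, id_apply] at h2
  rw [h2, real_inner_comm, h.inner_shape_position hy, real_inner_comm _ (ν y),
    h.inner_shape_normal hy, real_inner_comm a, real_inner_comm a]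
  ring

/-- The divergence of `φ_a aᵀ`. -/
lemma surfaceDiv_height_tangent (a : E) :
    surfaceDiv X (fun z => ⟪a, X z⟫ • (a - ⟪a, X z⟫ • X z - ⟪a, ν z⟫ • ν z)) y =
      ⟪a, a⟫ - ⟪a, X y⟫ ^ 2 - ⟪a, ν y⟫ ^ 2 - Module.finrank ℝ F * ⟪a, X y⟫ ^ 2
        + traceCLM E (fieldShape X ν y) * ⟪a, X y⟫ * ⟪a, ν y⟫ := by
  have h1 : HasFDerivAt (fun z => ⟪a, X z⟫) (innerSL ℝ a ∘L fderiv ℝ X y) y :=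
    (innerSL ℝ a).hasFDerivAt.comp y (h.hasFDerivAt hy)
  rw [surfaceDiv_smul h1 (h.differentiableAt_tangent hy a), h.surfaceDiv_tangent hy]
  simp only [comp_apply, map_sub, map_smul, h.pinv_position hy, h.pinv_normal hy, smul_zero,
    sub_zero, h.proj_eq hy]
  simp only [innerSL_apply_apply, smul_eq_mul, real_inner_comm]
  ring

/-- The divergence of `ψ_a (Tr(A) aᵀ - A aᵀ)`. -/
lemma surfaceDiv_newton (a : E) :
    surfaceDiv X (fun z => ⟪a, ν z⟫ • (traceCLM E (fieldShape X ν z) •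
        (a - ⟪a, X z⟫ • X z - ⟪a, ν z⟫ • ν z) - fieldShape X ν z a)) y =
      -(traceCLM E (fieldShape X ν y) * ⟪fieldShape X ν y a, a⟫)
      + ⟪fieldShape X ν y a, fieldShape X ν y a⟫
      - (Module.finrank ℝ F - 1) * (traceCLM E (fieldShape X ν y) * ⟪a, X y⟫ * ⟪a, ν y⟫)
      + (traceCLM E (fieldShape X ν y) ^ 2
          - traceCLM E (fieldShape X ν y ∘L fieldShape X ν y)) * ⟪a, ν y⟫ ^ 2 := by
  have h2 : HasFDerivAt (fun z => ⟪a, ν z⟫)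
      (innerSL ℝ a ∘L (-(fieldShape X ν y ∘L fderiv ℝ X y))) y :=
    (innerSL ℝ a).hasFDerivAt.comp y (h.hasFDerivAt_normal hy)
  have hd := h.differentiableAt_tangent hy a
  have hT := h.hasFDerivAt_trace_shape hy
  have hA : DifferentiableAt ℝ (fun z => fieldShape X ν z a) y :=
    (h.hasFDerivAt_shape hy).differentiableAt.clm_apply (differentiableAt_const a)
  rw [surfaceDiv_smul h2 ((hT.differentiableAt.fun_smul hd).fun_sub hA),
    surfaceDiv_sub (hT.differentiableAt.fun_smul hd) hA, surfaceDiv_smul hT hd,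
    h.surfaceDiv_tangent hy, h.surfaceDiv_shape hy]
  -- The derivative of Tr A in the direction aᵀ arises once from the product rule for Tr(A) aᵀ and
  -- once from the divergence of A a. Once both are written with the same vector, they cancel.
  have e : pinv (fderiv ℝ X y) (a - ⟪a, X y⟫ • X y - ⟪a, ν y⟫ • ν y) = pinv (fderiv ℝ X y) a := by
    simp [h.pinv_position hy, h.pinv_normal hy]
  simp only [e, comp_apply, neg_apply, h.shape_proj hy, map_neg, map_sub, map_smul]
  simp only [innerSL_apply_apply, smul_eq_mul]
  rw [← h.inner_shape_left hy a (fieldShape X ν y a), real_inner_comm a (fieldShape X ν y a)]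
  ring

/-- The divergence of `φ_a A² aᵀ` when `Tr A` and `Tr A²` are constant. -/
lemma surfaceDiv_sq {T S : ℝ} (hT : ∀ z ∈ U, traceCLM E (fieldShape X ν z) = T)
    (hS : ∀ z ∈ U, traceCLM E (fieldShape X ν z ∘L fieldShape X ν z) = S) (a : E) :
    surfaceDiv X (fun z => ⟪a, X z⟫ • fieldShape X ν z (fieldShape X ν z a)) y =
      ⟪fieldShape X ν y a, fieldShape X ν y a⟫ - S * ⟪a, X y⟫ ^ 2
      + ⟪a, X y⟫ * ⟪a, ν y⟫ *
        traceCLM E (fieldShape X ν y ∘L fieldShape X ν y ∘L fieldShape X ν y) := by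
  have h1 : HasFDerivAt (fun z => ⟪a, X z⟫) (innerSL ℝ a ∘L fderiv ℝ X y) y :=
    (innerSL ℝ a).hasFDerivAt.comp y (h.hasFDerivAt hy)
  have hA := h.hasFDerivAt_shape hy
  have hAa : HasFDerivAt (fun z => fieldShape X ν z a)
      ((fderiv ℝ (fieldShape X ν) y).flip a) y := by
    simpa using hA.clm_apply (hasFDerivAt_const a y)
  have hAA := hA.clm_apply hAa
  have hT0 := hasFDerivAt_eq_zero h.isOpen hy hT (h.hasFDerivAt_trace_shape hy)
  have hS0 := hasFDerivAt_eq_zero h.isOpen hy hS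
    ((traceCLM E).hasFDerivAt.comp y (hA.clm_comp hA))
  -- By cyclicity, the derivative of Tr A² is twice this trace.
  have hS1 : ∀ u, traceCLM E (fieldShape X ν y ∘L fderiv ℝ (fieldShape X ν) y u) = 0 := by
    intro u
    have := DFunLike.congr_fun hS0 u
    simp only [comp_apply, add_apply, compL_apply, flip_apply, map_add, zero_apply] at this
    rw [traceCLM_comp_comm (fderiv ℝ (fieldShape X ν) y u)] at this
    linarith
  have hT1 : ∀ u, traceCLM E (fderiv ℝ (fieldShape X ν) y u) = 0 := by
    intro u
    have := DFunLike.congr_fun hT0 u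
    simpa using this
  rw [surfaceDiv_smul h1 hAA.differentiableAt, surfaceDiv_of_hasFDerivAt hAA, add_comp, map_add]
  -- `e1` treats the derivative of the inner factor of A(A a), `e2` that of the outer factor; their
  -- derivative terms vanish by `hS1` and `hT1`.
  have e1 := h.trace_comp_fderiv_shape hy (fieldShape X ν y) a
  have e2 := h.trace_comp_fderiv_shape hy (ContinuousLinearMap.id ℝ E) (fieldShape X ν y a)
  simp only [id_comp, id_apply] at e2
  have e3 : ∀ v, ⟪X y, fieldShape X ν y v⟫ = 0 := fun v => by
    rw [real_inner_comm, h.inner_shape_position hy]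
  have e4 : ∀ v, ⟪ν y, fieldShape X ν y v⟫ = 0 := fun v => by
    rw [real_inner_comm, h.inner_shape_normal hy]
  rw [comp_assoc, e1, e2, hT1, hS1]
  simp only [e3, e4, comp_apply, h.proj_shape hy, hS y hy]
  simp only [innerSL_apply_apply]
  rw [← h.inner_shape_left hy a, real_inner_comm a (X y), real_inner_comm a (ν y)]
  ring

end IsPatch

end Patch

/-! ### Local unit normal fields -/

section LocalNormal

open ContinuousLinearMap

variable {E F : Type*} [NormedAddCommGroup E] [InnerProductSpace ℝ E] [FiniteDimensional ℝ E]
  [CompleteSpace E] [NormedAddCommGroup F] [InnerProductSpace ℝ F] [FiniteDimensional ℝ F]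
  [CompleteSpace F]

lemma inner_fderiv_of_norm_eq_one {X : F → E} {U : Set F} (hU : IsOpen U)
    (hX : ContDiffOn ℝ ∞ X U) (hn : ∀ y ∈ U, ‖X y‖ = 1) {y : F} (hy : y ∈ U) (u : F) :
    ⟪X y, fderiv ℝ X y u⟫ = 0 := by
  have hd : HasFDerivAt X (fderiv ℝ X y) y :=
    ((hX.contDiffAt (hU.mem_nhds hy)).differentiableAt (by simp)).hasFDerivAt
  have h1 := hasFDerivAt_eq_zero hU hy (c := 1)
    (fun z hz => by rw [real_inner_self_eq_norm_sq, hn z hz]; norm_num) (hd.inner ℝ hd)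
  have h2 := DFunLike.congr_fun h1 u
  simp only [comp_apply, ContinuousLinearMap.prod_apply, fderivInnerCLM_apply, zero_apply] at h2
  rw [real_inner_comm (X y) (fderiv ℝ X y u)] at h2
  linarith

/-- A unit normal vector at a point extends to a local smooth unit normal field. -/
lemma exists_isPatch (hd : Module.finrank ℝ E = Module.finrank ℝ F + 2) {X : F → E} {U : Set F}
    (hU : IsOpen U) (hX : ContDiffOn ℝ ∞ X U) (hn : ∀ y ∈ U, ‖X y‖ = 1)
    (hinj : ∀ y ∈ U, Function.Injective (fderiv ℝ X y)) {y₀ : F} (hy₀ : y₀ ∈ U) {N : E}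
    (hN : ‖N‖ = 1) (hNX : ⟪N, X y₀⟫ = 0) (hNL : ∀ u, ⟪N, fderiv ℝ X y₀ u⟫ = 0) :
    ∃ (V : Set F) (ν : F → E), V ⊆ U ∧ y₀ ∈ V ∧ IsPatch X ν V ∧ ν y₀ = N := by
  -- Project the fixed vector `N` to the normal space at nearby points. The projection equals `N` at
  -- `y₀`, so it can be normalized where it does not vanish.
  let w : F → E := fun y =>
    N - ⟪X y, N⟫ • X y - fderiv ℝ X y (pinv (fderiv ℝ X y) N)
  have hL : ContDiffOn ℝ ∞ (fderiv ℝ X) U := hX.fderiv_of_isOpen hU (by simp)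
  have hw : ContDiffOn ℝ ∞ w U := by
    intro y hy
    have h1 := (hX.contDiffAt (hU.mem_nhds hy))
    have h2 := (hL.contDiffAt (hU.mem_nhds hy))
    have h3 : ContDiffAt ℝ ∞ (fun z => pinv (fderiv ℝ X z)) y :=
      (contDiffAt_pinv (hinj y hy)).comp y h2
    exact (((contDiffAt_const.sub ((h1.inner ℝ contDiffAt_const).smul h1)).sub
      (h2.clm_apply (h3.clm_apply contDiffAt_const)))).contDiffWithinAt
  have hw0 : w y₀ = N := by
    simp only [w]
    rw [pinv_apply_eq_zero hNL, real_inner_comm, hNX]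
    simp
  have hwX : ∀ y ∈ U, ⟪w y, X y⟫ = 0 := by
    intro y hy
    simp only [w]
    rw [inner_sub_left, inner_sub_left, inner_smul_left, real_inner_comm (X y) (fderiv ℝ X y _),
      inner_fderiv_of_norm_eq_one hU hX hn hy, real_inner_self_eq_norm_sq, hn y hy,
      real_inner_comm N]
    simp
  have hwL : ∀ y ∈ U, ∀ u, ⟪w y, fderiv ℝ X y u⟫ = 0 := by
    intro y hy u
    simp only [w]
    rw [inner_sub_left, inner_sub_left, inner_smul_left,
      inner_fderiv_of_norm_eq_one hU hX hn hy, real_inner_comm _ (fderiv ℝ X y (pinv _ _)),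
      inner_map_pinv (hinj y hy), real_inner_comm N (fderiv ℝ X y u)]
    simp
  refine ⟨U ∩ w ⁻¹' {0}ᶜ, fun y => ‖w y‖⁻¹ • w y, Set.inter_subset_left, ⟨hy₀, ?_⟩, ?_, ?_⟩
  · simp only [Set.mem_preimage, hw0, Set.mem_compl_iff, Set.mem_singleton_iff]
    rintro rfl
    simp at hN
  · refine ⟨hd, hw.continuousOn.isOpen_inter_preimage hU isOpen_compl_singleton,
      hX.mono Set.inter_subset_left, ?_, fun y hy => hinj y hy.1, fun y hy => hn y hy.1, ?_, ?_, ?_⟩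
    · intro y hy
      have h1 : ContDiffAt ℝ ∞ w y := hw.contDiffAt (hU.mem_nhds hy.1)
      have hne : w y ≠ 0 := hy.2
      exact (((h1.norm ℝ hne).inv (norm_ne_zero_iff.mpr hne)).smul h1).contDiffWithinAt
    · intro y hy
      have hne : w y ≠ 0 := hy.2
      exact norm_smul_inv_norm hne
    · intro y hy
      rw [inner_smul_left, hwX y hy.1, mul_zero]
    · intro y hy u
      rw [inner_smul_left, hwL y hy.1, mul_zero]
  · simp only [hw0, hN]
    simp

/-! ### Dependence of the shape operator on the normal and on the parameters. -/

namespace IsPatch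

variable {X ν : F → E} {U : Set F}

lemma inner_shape (h : IsPatch X ν U) {y : F} (hy : y ∈ U) (v w : E) :
    ⟪fieldShape X ν y v, w⟫ = ⟪ν y, fderiv ℝ (fderiv ℝ X) y (pinv (fderiv ℝ X y) v)
      (pinv (fderiv ℝ X y) w)⟫ := by
  rw [h.inner_shape_eq hy, ← h.shape_proj hy v, h.inner_shape_map hy]

/-- The shape operator at a point depends only on the normal vector at this point. -/
lemma shape_congr {ν' : F → E} {U' : Set F} (h : IsPatch X ν U) (h' : IsPatch X ν' U') {y : F}
    (hy : y ∈ U) (hy' : y ∈ U') {c : ℝ} (hc : ν' y = c • ν y) :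
    fieldShape X ν' y = c • fieldShape X ν y := by
  ext1 v
  apply ext_inner_right ℝ
  intro w
  rw [h'.inner_shape hy', smul_apply, inner_smul_left, h.inner_shape hy, hc, inner_smul_left]

/-- Change of parameters. -/
lemma comp (h : IsPatch X ν U) {τ : F → F} {V : Set F} (hV : IsOpen V) (hτ : ContDiffOn ℝ ∞ τ V)
    (hVU : Set.MapsTo τ V U) (hJ : ∀ y ∈ V, Function.Injective (fderiv ℝ τ y)) :
    IsPatch (X ∘ τ) (ν ∘ τ) V := by
  have hd : ∀ y ∈ V, fderiv ℝ (X ∘ τ) y = fderiv ℝ X (τ y) ∘L fderiv ℝ τ y := fun y hy =>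
    fderiv_comp y (h.hasFDerivAt (hVU hy)).differentiableAt
      ((hτ.contDiffAt (hV.mem_nhds hy)).differentiableAt (by simp))
  refine ⟨h.finrank_eq, hV, h.contDiffOn.comp hτ hVU, h.contDiffOn_normal.comp hτ hVU, ?_,
    fun y hy => h.norm_eq_one _ (hVU hy), fun y hy => h.norm_normal _ (hVU hy),
    fun y hy => h.inner_position _ (hVU hy), ?_⟩
  · intro y hy
    rw [hd y hy]
    exact (h.injective _ (hVU hy)).comp (hJ y hy)
  · intro y hy u
    rw [hd y hy]
    exact h.inner_tangent _ (hVU hy) _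

lemma congr (h : IsPatch X ν U) {Y : F → E} (hY : Set.EqOn Y X U) : IsPatch Y ν U := by
  have hd : ∀ y ∈ U, fderiv ℝ Y y = fderiv ℝ X y := fun y hy =>
    (Filter.eventuallyEq_of_mem (h.isOpen.mem_nhds hy) hY).fderiv_eq
  refine ⟨h.finrank_eq, h.isOpen, h.contDiffOn.congr hY, h.contDiffOn_normal, ?_, ?_,
    h.norm_normal, ?_, ?_⟩
  · intro y hy; rw [hd y hy]; exact h.injective y hy
  · intro y hy; rw [hY hy]; exact h.norm_eq_one y hy
  · intro y hy; rw [hY hy]; exact h.inner_position y hy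
  · intro y hy u; rw [hd y hy]; exact h.inner_tangent y hy u

end IsPatch

/-- The Jacobian from the chain rule cancels the inverse Jacobian in the pseudo-inverse. Hence the
shape operator and the divergence are independent of the parametrization. -/
lemma comp_pinv_comp {X W : F → E} {τ : F → F} {y : F} {J : F ≃L[ℝ] F}
    (hτ : HasFDerivAt τ (J : F →L[ℝ] F) y) (hX : DifferentiableAt ℝ X (τ y))
    (hinj : Function.Injective (fderiv ℝ X (τ y))) (hW : DifferentiableAt ℝ W (τ y)) :
    fderiv ℝ (W ∘ τ) y ∘L pinv (fderiv ℝ (X ∘ τ) y) =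
      fderiv ℝ W (τ y) ∘L pinv (fderiv ℝ X (τ y)) := by
  rw [(hX.hasFDerivAt.comp y hτ).fderiv, (hW.hasFDerivAt.comp y hτ).fderiv,
    pinv_comp_equiv hinj, comp_assoc, ← comp_assoc _ _ (pinv (fderiv ℝ X (τ y)))]
  simp

end LocalNormal

/-! ### Matrices of operators -/

section OpMatrix

open ContinuousLinearMap

variable {n : ℕ}

/-- The matrix of an operator of `ℝⁿ` in the standard basis. -/
def opMatrix (T : EuclideanSpace ℝ (Fin n) →L[ℝ] EuclideanSpace ℝ (Fin n)) :
    Matrix (Fin n) (Fin n) ℝ :=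
  LinearMap.toMatrix (EuclideanSpace.basisFun (Fin n) ℝ).toBasis
    (EuclideanSpace.basisFun (Fin n) ℝ).toBasis T

/-- The operator of `ℝⁿ` with a given matrix in the standard basis. -/
def matrixOp (A : Matrix (Fin n) (Fin n) ℝ) :
    EuclideanSpace ℝ (Fin n) →L[ℝ] EuclideanSpace ℝ (Fin n) :=
  LinearMap.toContinuousLinearMap
    ((LinearMap.toMatrix (EuclideanSpace.basisFun (Fin n) ℝ).toBasis
      (EuclideanSpace.basisFun (Fin n) ℝ).toBasis).symm A)

lemma matrixOp_opMatrix (T : EuclideanSpace ℝ (Fin n) →L[ℝ] EuclideanSpace ℝ (Fin n)) :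
    matrixOp (opMatrix T) = T := by
  ext1 u
  simp [matrixOp, opMatrix]

lemma opMatrix_apply (T : EuclideanSpace ℝ (Fin n) →L[ℝ] EuclideanSpace ℝ (Fin n)) (i j : Fin n) :
    opMatrix T i j = T (EuclideanSpace.single j 1) i := by
  simp [opMatrix, LinearMap.toMatrix_apply]

lemma opMatrix_comp (S T : EuclideanSpace ℝ (Fin n) →L[ℝ] EuclideanSpace ℝ (Fin n)) :
    opMatrix (S ∘L T) = opMatrix S * opMatrix T := by
  simp only [opMatrix, toLinearMap_comp]
  exact LinearMap.toMatrix_comp _ _ _ _ _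

lemma opMatrix_id :
    opMatrix (ContinuousLinearMap.id ℝ (EuclideanSpace ℝ (Fin n))) = 1 :=
  LinearMap.toMatrix_id _

lemma trace_opMatrix (T : EuclideanSpace ℝ (Fin n) →L[ℝ] EuclideanSpace ℝ (Fin n)) :
    (opMatrix T).trace = traceCLM _ T := by
  rw [traceCLM_apply, LinearMap.trace_eq_matrix_trace ℝ (EuclideanSpace.basisFun (Fin n) ℝ).toBasis]
  rfl

lemma opMatrix_mulVec (T : EuclideanSpace ℝ (Fin n) →L[ℝ] EuclideanSpace ℝ (Fin n))
    (u : EuclideanSpace ℝ (Fin n)) : opMatrix T *ᵥ u.ofLp = (T u).ofLp := by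
  have := LinearMap.toMatrix_mulVec_repr (EuclideanSpace.basisFun (Fin n) ℝ).toBasis
    (EuclideanSpace.basisFun (Fin n) ℝ).toBasis (T : _ →ₗ[ℝ] _) u
  have e : ⇑((EuclideanSpace.basisFun (Fin n) ℝ).toBasis.repr u) = u.ofLp := by ext; simp
  have e' : ⇑((EuclideanSpace.basisFun (Fin n) ℝ).toBasis.repr (T u)) = (T u).ofLp := by
    ext; simp
  rw [e, coe_coe, e'] at this
  exact this

lemma apply_eq_inner_single (u : EuclideanSpace ℝ (Fin n)) (i : Fin n) :
    u i = ⟪EuclideanSpace.single i (1 : ℝ), u⟫ := by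
  simp [EuclideanSpace.inner_single_left]

lemma sum_smul_single (u : EuclideanSpace ℝ (Fin n)) :
    ∑ i, u i • EuclideanSpace.single i (1 : ℝ) = u := by
  simpa using (EuclideanSpace.basisFun (Fin n) ℝ).sum_repr u

end OpMatrix

/-! ### The Gauss equation -/

section Gauss

open ContinuousLinearMap

variable {n N : ℕ} {X ν : EuclideanSpace ℝ (Fin n) → EuclideanSpace ℝ (Fin N)}
  {U : Set (EuclideanSpace ℝ (Fin n))}

lemma gram_eq (X : EuclideanSpace ℝ (Fin n) → EuclideanSpace ℝ (Fin N))
    (y : EuclideanSpace ℝ (Fin n)) : gram X y = opMatrix (gramOp (fderiv ℝ X y)) := by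
  ext i j
  rw [opMatrix_apply, apply_eq_inner_single, inner_gramOp]
  rfl

lemma gram_inv {X : EuclideanSpace ℝ (Fin n) → EuclideanSpace ℝ (Fin N)}
    {y : EuclideanSpace ℝ (Fin n)} (hinj : Function.Injective (fderiv ℝ X y)) :
    (gram X y)⁻¹ = opMatrix (gramOp (fderiv ℝ X y)).inverse := by
  apply Matrix.inv_eq_left_inv
  rw [gram_eq, ← opMatrix_comp, inverse_gramOp_comp hinj, opMatrix_id]

namespace IsPatch

variable (h : IsPatch X ν U) {y : EuclideanSpace ℝ (Fin n)} (hy : y ∈ U)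

include h hy

lemma partialDeriv_gram (i j k : Fin n) :
    partialDeriv i (fun z => gram X z j k) y =
      ⟪fderiv ℝ (fderiv ℝ X) y (EuclideanSpace.single i 1) (EuclideanSpace.single j 1),
        fderiv ℝ X y (EuclideanSpace.single k 1)⟫ +
      ⟪fderiv ℝ (fderiv ℝ X) y (EuclideanSpace.single i 1) (EuclideanSpace.single k 1),
        fderiv ℝ X y (EuclideanSpace.single j 1)⟫ := by
  have hL : ∀ w, HasFDerivAt (fun z => fderiv ℝ X z w) ((fderiv ℝ (fderiv ℝ X) y).flip w) y := by
    intro w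
    simpa using (h.hasFDerivAt_fderiv hy).clm_apply (hasFDerivAt_const w y)
  have h1 := (hL (EuclideanSpace.single j 1)).inner ℝ (hL (EuclideanSpace.single k 1))
  have h2 : HasFDerivAt (fun z => gram X z j k) _ y := h1
  rw [partialDeriv, h2.fderiv]
  simp only [comp_apply, ContinuousLinearMap.prod_apply, fderivInnerCLM_apply, flip_apply]
  rw [add_comm, real_inner_comm _ (fderiv ℝ X y (EuclideanSpace.single j 1))]

/-- By symmetry of the second derivative, the three derivatives of the metric add up to twice
⟨∂ᵢ∂ⱼX, ∂ₗX⟩; the Christoffel symbols are thus the tangential coordinates of ∂ᵢ∂ⱼX. -/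
lemma christoffel_eq (k i j : Fin n) :
    christoffel X y k i j = pinv (fderiv ℝ X y)
      (fderiv ℝ (fderiv ℝ X) y (EuclideanSpace.single i 1) (EuclideanSpace.single j 1)) k := by
  have e1 : ∀ l, partialDeriv i (fun z => gram X z j l) y + partialDeriv j (fun z => gram X z i l) y
      - partialDeriv l (fun z => gram X z i j) y =
      2 * (adjoint (fderiv ℝ X y) (fderiv ℝ (fderiv ℝ X) y (EuclideanSpace.single i 1)
        (EuclideanSpace.single j 1))).ofLp l := by
    intro l
    rw [apply_eq_inner_single (adjoint (fderiv ℝ X y) _), adjoint_inner_right,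
      h.partialDeriv_gram hy, h.partialDeriv_gram hy, h.partialDeriv_gram hy,
      h.sndFDeriv_symm hy (EuclideanSpace.single j 1) (EuclideanSpace.single i 1),
      h.sndFDeriv_symm hy (EuclideanSpace.single l 1) (EuclideanSpace.single i 1),
      h.sndFDeriv_symm hy (EuclideanSpace.single l 1) (EuclideanSpace.single j 1),
      real_inner_comm (fderiv ℝ X y (EuclideanSpace.single l 1))]
    ring
  have e2 := congrFun (opMatrix_mulVec (gramOp (fderiv ℝ X y)).inverse
    (adjoint (fderiv ℝ X y) (fderiv ℝ (fderiv ℝ X) y (EuclideanSpace.single i 1)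
        (EuclideanSpace.single j 1)))) k
  rw [pinv, comp_apply, ← e2, christoffel, gram_inv (h.injective y hy), Matrix.mulVec, dotProduct,
    Finset.mul_sum]
  refine Finset.sum_congr rfl fun l _ => ?_
  rw [e1]
  ring

lemma hasFDerivAt_pinv :
    HasFDerivAt (fun z => pinv (fderiv ℝ X z)) (fderiv ℝ (fun z => pinv (fderiv ℝ X z)) y) y :=
  ((h.contDiffAt_pinv hy).differentiableAt (by simp)).hasFDerivAt

/-- Differentiate the fact that the pseudo-inverse of dX is a left inverse of dX. -/
lemma fderiv_pinv_map (u w : EuclideanSpace ℝ (Fin n)) :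
    fderiv ℝ (fun z => pinv (fderiv ℝ X z)) y u (fderiv ℝ X y w) =
      -pinv (fderiv ℝ X y) (fderiv ℝ (fderiv ℝ X) y u w) := by
  have h1 := hasFDerivAt_eq_zero h.isOpen hy (fun z hz => pinv_comp (h.injective z hz))
    ((h.hasFDerivAt_pinv hy).clm_comp (h.hasFDerivAt_fderiv hy))
  have h2 := DFunLike.congr_fun (DFunLike.congr_fun h1 u) w
  simp only [add_apply, comp_apply, compL_apply, flip_apply, zero_apply] at h2
  exact eq_neg_of_add_eq_zero_right h2

/-- Differentiate `L† L ∘ pinv L = L†`, with L = dX. On a normal vector the term with the derivative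
of the Gram operator drops out, because `pinv L` vanishes there. -/
lemma fderiv_pinv_normal (u : EuclideanSpace ℝ (Fin n)) {V : EuclideanSpace ℝ (Fin N)}
    (hV : ∀ w, ⟪V, fderiv ℝ X y w⟫ = 0) :
    fderiv ℝ (fun z => pinv (fderiv ℝ X z)) y u V =
      (gramOp (fderiv ℝ X y)).inverse (adjoint (fderiv ℝ (fderiv ℝ X) y u) V) := by
  have hadj : HasFDerivAt (fun z => adjoint (fderiv ℝ X z))
      ((adjointCLM _ _) ∘L fderiv ℝ (fderiv ℝ X) y) y :=
    (adjointCLM (EuclideanSpace ℝ (Fin n)) (EuclideanSpace ℝ (Fin N))).hasFDerivAt.comp y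
      (h.hasFDerivAt_fderiv hy)
  have hg : HasFDerivAt (fun z => gramOp (fderiv ℝ X z)) _ y :=
    hadj.clm_comp (h.hasFDerivAt_fderiv hy)
  have h1 := hg.clm_comp (h.hasFDerivAt_pinv hy)
  have h2 : HasFDerivAt (fun z => gramOp (fderiv ℝ X z) ∘L pinv (fderiv ℝ X z))
      ((adjointCLM _ _) ∘L fderiv ℝ (fderiv ℝ X) y) y := by
    refine hadj.congr_of_eventuallyEq (Filter.eventually_of_mem (h.isOpen.mem_nhds hy) ?_)
    intro z hz
    simp only
    rw [pinv, ← comp_assoc, gramOp_comp_inverse (h.injective z hz), id_comp]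
  have h3 := DFunLike.congr_fun (DFunLike.congr_fun (h1.unique h2) u) V
  simp only [add_apply, comp_apply, compL_apply, flip_apply, adjointCLM_apply,
    pinv_apply_eq_zero hV, map_zero, add_zero] at h3
  rw [← h3, inverse_gramOp_apply (h.injective y hy)]

/-- This is the second fundamental form in the radial direction; it produces the constant-curvature
part of the Gauss equation. -/
lemma inner_position_sndFDeriv (u w : EuclideanSpace ℝ (Fin n)) :
    ⟪X y, fderiv ℝ (fderiv ℝ X) y u w⟫ = -⟪fderiv ℝ X y u, fderiv ℝ X y w⟫ := by
  have hL : HasFDerivAt (fun z => fderiv ℝ X z w) ((fderiv ℝ (fderiv ℝ X) y).flip w) y := by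
    simpa using (h.hasFDerivAt_fderiv hy).clm_apply (hasFDerivAt_const w y)
  have h1 := hasFDerivAt_eq_zero h.isOpen hy (fun z hz => h.inner_position_map hz w)
    ((h.hasFDerivAt hy).inner ℝ hL)
  have h2 := DFunLike.congr_fun h1 u
  simp only [comp_apply, ContinuousLinearMap.prod_apply, fderivInnerCLM_apply, zero_apply,
    flip_apply] at h2
  linarith

/-- The covariant second derivative of the pseudo-inverse, from which the curvature is read. -/
lemma fderiv_pinv_sndFDeriv (u v w : EuclideanSpace ℝ (Fin n)) :
    fderiv ℝ (fun z => pinv (fderiv ℝ X z)) y u (fderiv ℝ (fderiv ℝ X) y v w) +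
      pinv (fderiv ℝ X y) (fderiv ℝ (fderiv ℝ X) y u
        (pinv (fderiv ℝ X y) (fderiv ℝ (fderiv ℝ X) y v w))) =
      ⟪fderiv ℝ X y v, fderiv ℝ X y w⟫ • u +
      ⟪fieldShape X ν y (fderiv ℝ X y v), fderiv ℝ X y w⟫ •
        pinv (fderiv ℝ X y) (fieldShape X ν y (fderiv ℝ X y u)) := by
  set L := fderiv ℝ X y with hL
  set B := fderiv ℝ (fderiv ℝ X) y with hB
  -- The tangential part cancels the second summand on the left; the part along `X` gives the
  -- curvature of the sphere, the part along `ν` the product of shape operators.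
  have e1 : B v w = L (pinv L (B v w)) + (⟪X y, B v w⟫ • X y + ⟪ν y, B v w⟫ • ν y) := by
    rw [hL, h.proj_eq hy]; abel
  have eX : (gramOp L).inverse (adjoint (B u) (X y)) = -u := by
    have : adjoint (B u) (X y) = -gramOp L u := by
      apply ext_inner_right ℝ
      intro z
      rw [adjoint_inner_left, h.inner_position_sndFDeriv hy, inner_neg_left,
        real_inner_comm z, inner_gramOp, real_inner_comm]
    rw [this, map_neg, inverse_gramOp_apply (h.injective y hy)]
  have eν : (gramOp L).inverse (adjoint (B u) (ν y)) = pinv L (fieldShape X ν y (L u)) := by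
    have : adjoint (B u) (ν y) = adjoint L (fieldShape X ν y (L u)) := by
      apply ext_inner_right ℝ
      intro z
      rw [adjoint_inner_left, adjoint_inner_left, h.inner_shape_map hy]
    rw [this]; rfl
  conv_lhs => enter [1]; rw [e1]
  rw [map_add, h.fderiv_pinv_map hy, map_add, map_smul, map_smul,
    h.fderiv_pinv_normal hy u (h.inner_position_map hy), h.fderiv_pinv_normal hy u
    (h.inner_tangent y hy), eX, eν, h.inner_position_sndFDeriv hy, h.inner_shape_map hy]
  simp only [smul_neg, neg_smul, neg_neg]
  abel

lemma hasFDerivAt_pinv_sndFDeriv (v w : EuclideanSpace ℝ (Fin n)) :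
    HasFDerivAt (fun z => pinv (fderiv ℝ X z) (fderiv ℝ (fderiv ℝ X) z v w))
      (pinv (fderiv ℝ X y) ∘L ((fderiv ℝ (fderiv ℝ (fderiv ℝ X)) y).flip v).flip w +
        (fderiv ℝ (fun z => pinv (fderiv ℝ X z)) y).flip (fderiv ℝ (fderiv ℝ X) y v w)) y := by
  have h3 : HasFDerivAt (fderiv ℝ (fderiv ℝ X)) (fderiv ℝ (fderiv ℝ (fderiv ℝ X)) y) y :=
    (((h.contDiffAt_fderiv hy).fderiv_right (m := ∞) (by simp)).differentiableAt
      (by simp)).hasFDerivAt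
  have h4 : HasFDerivAt (fun z => fderiv ℝ (fderiv ℝ X) z v w)
      (((fderiv ℝ (fderiv ℝ (fderiv ℝ X)) y).flip v).flip w) y := by
    simpa using (h3.clm_apply (hasFDerivAt_const v y)).clm_apply (hasFDerivAt_const w y)
  exact (h.hasFDerivAt_pinv hy).clm_apply h4

lemma trdFDeriv_symm (u v w : EuclideanSpace ℝ (Fin n)) :
    fderiv ℝ (fderiv ℝ (fderiv ℝ X)) y u v w = fderiv ℝ (fderiv ℝ (fderiv ℝ X)) y v u w := by
  rw [((h.contDiffAt_fderiv hy).isSymmSndFDerivAt (by simp [two_le_infty])).eq u v]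

lemma partialDeriv_christoffel (i l j k : Fin n) :
    partialDeriv i (fun z => christoffel X z l j k) y =
      (pinv (fderiv ℝ X y) (fderiv ℝ (fderiv ℝ (fderiv ℝ X)) y (EuclideanSpace.single i 1)
        (EuclideanSpace.single j 1) (EuclideanSpace.single k 1)) +
      fderiv ℝ (fun z => pinv (fderiv ℝ X z)) y (EuclideanSpace.single i 1)
        (fderiv ℝ (fderiv ℝ X) y (EuclideanSpace.single j 1) (EuclideanSpace.single k 1))) l := by
  have h1 := (EuclideanSpace.proj l : EuclideanSpace ℝ (Fin n) →L[ℝ] ℝ).hasFDerivAt.comp y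
    (h.hasFDerivAt_pinv_sndFDeriv hy (EuclideanSpace.single j 1) (EuclideanSpace.single k 1))
  have h2 := h1.congr_of_eventuallyEq (f₁ := fun z => christoffel X z l j k)
    (Filter.eventually_of_mem (h.isOpen.mem_nhds hy) fun z hz => h.christoffel_eq hz l j k)
  rw [partialDeriv, h2.fderiv]
  simp

lemma sum_christoffel (l i j k : Fin n) :
    ∑ m, christoffel X y l i m * christoffel X y m j k =
      pinv (fderiv ℝ X y) (fderiv ℝ (fderiv ℝ X) y (EuclideanSpace.single i 1)
        (pinv (fderiv ℝ X y) (fderiv ℝ (fderiv ℝ X) y (EuclideanSpace.single j 1)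
          (EuclideanSpace.single k 1)))) l := by
  conv_rhs => rw [← sum_smul_single (pinv (fderiv ℝ X y) (fderiv ℝ (fderiv ℝ X) y
    (EuclideanSpace.single j 1) (EuclideanSpace.single k 1)))]
  simp only [map_sum, map_smul, WithLp.ofLp_sum, WithLp.ofLp_smul, Finset.sum_apply, Pi.smul_apply,
    smul_eq_mul]
  refine Finset.sum_congr rfl fun m _ => ?_
  rw [h.christoffel_eq hy, h.christoffel_eq hy, mul_comm]

/-- The Gauss equation. -/
lemma riemann_eq (l k i j : Fin n) :
    riemann X y l k i j =
      (⟪fderiv ℝ X y (EuclideanSpace.single j 1), fderiv ℝ X y (EuclideanSpace.single k 1)⟫ •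
        EuclideanSpace.single i (1 : ℝ) +
      ⟪fieldShape X ν y (fderiv ℝ X y (EuclideanSpace.single j 1)),
        fderiv ℝ X y (EuclideanSpace.single k 1)⟫ •
        pinv (fderiv ℝ X y) (fieldShape X ν y (fderiv ℝ X y (EuclideanSpace.single i 1)))).ofLp l -
      (⟪fderiv ℝ X y (EuclideanSpace.single i 1), fderiv ℝ X y (EuclideanSpace.single k 1)⟫ •
        EuclideanSpace.single j (1 : ℝ) +
      ⟪fieldShape X ν y (fderiv ℝ X y (EuclideanSpace.single i 1)),
        fderiv ℝ X y (EuclideanSpace.single k 1)⟫ •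
        pinv (fderiv ℝ X y)
          (fieldShape X ν y (fderiv ℝ X y (EuclideanSpace.single j 1)))).ofLp l := by
  -- The third derivatives of `X` cancel by symmetry. What remains is the expression of
  -- `fderiv_pinv_sndFDeriv`, antisymmetrized in `i` and `j`.
  rw [riemann, Finset.sum_sub_distrib, h.sum_christoffel hy, h.sum_christoffel hy,
    h.partialDeriv_christoffel hy, h.partialDeriv_christoffel hy,
    h.trdFDeriv_symm hy (EuclideanSpace.single j 1), ← h.fderiv_pinv_sndFDeriv hy,
    ← h.fderiv_pinv_sndFDeriv hy]
  simp only [WithLp.ofLp_add, Pi.add_apply]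
  ring

/-- The Ricci tensor, as a combination of the fundamental forms. -/
lemma ricci_eq (j k : Fin n) :
    ricci X y j k =
      traceCLM _ (fieldShape X ν y) *
        ⟪fieldShape X ν y (fderiv ℝ X y (EuclideanSpace.single j 1)),
          fderiv ℝ X y (EuclideanSpace.single k 1)⟫
      + ((n : ℝ) - 1) * ⟪fderiv ℝ X y (EuclideanSpace.single j 1),
          fderiv ℝ X y (EuclideanSpace.single k 1)⟫
      - ⟪fieldShape X ν y (fieldShape X ν y (fderiv ℝ X y (EuclideanSpace.single j 1))),
          fderiv ℝ X y (EuclideanSpace.single k 1)⟫ := by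
  set L := fderiv ℝ X y with hL
  set A := fieldShape X ν y with hA
  have hinj := h.injective y hy
  -- The image of A is tangent, so cyclicity turns the ambient trace into the trace of the
  -- coordinate matrix.
  have t1 : traceCLM _ A = ∑ i, (pinv L (A (L (EuclideanSpace.single i 1)))).ofLp i := by
    have e0 : A = L ∘L (pinv L ∘L A) := by ext1 v; simp [hL, hA, h.proj_shape hy]
    rw [e0, traceCLM_comp_comm, ← trace_opMatrix, Matrix.trace]
    refine Finset.sum_congr rfl fun i _ => ?_
    rw [Matrix.diag_apply, opMatrix_apply]
    simp [hL, hA, h.proj_shape hy]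
  have t2 : ∀ v : EuclideanSpace ℝ (Fin n), ∑ i, v.ofLp i *
      ⟪A (L (EuclideanSpace.single i 1)), L (EuclideanSpace.single k 1)⟫ =
      ⟪A (L v), L (EuclideanSpace.single k 1)⟫ := by
    intro v
    conv_rhs => rw [← sum_smul_single v]
    simp [map_sum, sum_inner, inner_smul_left]
  have t3 : ∀ v : EuclideanSpace ℝ (Fin n), ∑ i, v.ofLp i *
      ⟪L (EuclideanSpace.single i 1), L (EuclideanSpace.single k 1)⟫ =
      ⟪L v, L (EuclideanSpace.single k 1)⟫ := by
    intro v
    conv_rhs => rw [← sum_smul_single v]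
    simp [map_sum, sum_inner, inner_smul_left]
  have t4 : ∑ i : Fin n, (EuclideanSpace.single i (1 : ℝ)).ofLp i = n := by simp
  rw [ricci, Matrix.of_apply]
  simp only [h.riemann_eq hy, WithLp.ofLp_add, WithLp.ofLp_smul, Pi.add_apply, Pi.smul_apply,
    smul_eq_mul, ← hL, ← hA]
  rw [Finset.sum_sub_distrib, Finset.sum_add_distrib, Finset.sum_add_distrib, ← Finset.mul_sum,
    ← Finset.mul_sum, t4, ← t1]
  simp only [mul_comm _ ((EuclideanSpace.single j (1 : ℝ)).ofLp _),
    mul_comm _ ((pinv L (A (L (EuclideanSpace.single j 1)))).ofLp _)]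
  rw [t2, t3, hL, hA, h.proj_shape hy]
  ring

/-- The operator whose matrix, contracted with the metric, is the Ricci tensor. -/
lemma ricci_eq_opMatrix :
    ricci X y = opMatrix (adjoint (fderiv ℝ X y) ∘L
      (traceCLM _ (fieldShape X ν y) • fieldShape X ν y + ((n : ℝ) - 1) • ContinuousLinearMap.id ℝ _
        - fieldShape X ν y ∘L fieldShape X ν y) ∘L fderiv ℝ X y) := by
  ext j k
  rw [h.ricci_eq hy, opMatrix_apply, apply_eq_inner_single, comp_apply, adjoint_inner_right]
  simp only [comp_apply, sub_apply, add_apply, smul_apply, id_apply, inner_sub_right,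
    inner_add_right, inner_smul_right]
  rw [h.inner_shape_left hy, h.inner_shape_left hy, h.inner_shape_left hy]

lemma inv_gram_mul_ricci :
    (gram X y)⁻¹ * ricci X y = opMatrix (pinv (fderiv ℝ X y) ∘L
      (traceCLM _ (fieldShape X ν y) • fieldShape X ν y + ((n : ℝ) - 1) • ContinuousLinearMap.id ℝ _
        - fieldShape X ν y ∘L fieldShape X ν y) ∘L fderiv ℝ X y) := by
  rw [gram_inv (h.injective y hy), h.ricci_eq_opMatrix hy, ← opMatrix_comp, pinv, comp_assoc]

lemma trace_inv_gram_mul_ricci :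
    ((gram X y)⁻¹ * ricci X y).trace = traceCLM _ (fieldShape X ν y) ^ 2 + (n : ℝ) * ((n : ℝ) - 1)
      - traceCLM _ (fieldShape X ν y ∘L fieldShape X ν y) := by
  have e3 : fieldShape X ν y ∘L fderiv ℝ X y ∘L pinv (fderiv ℝ X y) = fieldShape X ν y := by
    ext1 v; simp [h.shape_proj hy]
  have ht := h.trace_proj hy
  rw [finrank_euclideanSpace_fin] at ht
  rw [h.inv_gram_mul_ricci hy, trace_opMatrix, traceCLM_comp_comm, comp_assoc]
  simp only [sub_comp, add_comp, smul_comp, id_comp, map_sub, map_add, map_smul, comp_assoc, e3,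
    ht, smul_eq_mul]
  ring

end IsPatch

end Gauss

/-! ### Changes of charts -/

section Charts

open ContinuousLinearMap

variable (n : ℕ) {N : ℕ} {M : Type*} [TopologicalSpace M]
  [ChartedSpace (EuclideanSpace ℝ (Fin n)) M]

/-- The coordinates of a point in the preferred chart around this point. -/
def center (p : M) : EuclideanSpace ℝ (Fin n) := extChartAt (𝓡 n) p p

/-- The coordinate change between the preferred charts around `p` and `q`. -/
def transition (p q : M) (y : EuclideanSpace ℝ (Fin n)) : EuclideanSpace ℝ (Fin n) :=
  extChartAt (𝓡 n) q ((extChartAt (𝓡 n) p).symm y)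

/-- The domain of `transition p q`. -/
def overlap (p q : M) : Set (EuclideanSpace ℝ (Fin n)) :=
  (extChartAt (𝓡 n) p).target ∩ (extChartAt (𝓡 n) p).symm ⁻¹' (extChartAt (𝓡 n) q).source

variable {n}

lemma center_mem_target (p : M) : center n p ∈ (extChartAt (𝓡 n) p).target :=
  mem_extChartAt_target p

lemma symm_center (p : M) : (extChartAt (𝓡 n) p).symm (center n p) = p :=
  extChartAt_to_inv p

lemma isOpen_overlap (p q : M) : IsOpen (overlap n p q) :=
  (continuousOn_extChartAt_symm p).isOpen_inter_preimage (isOpen_extChartAt_target p)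
    (isOpen_extChartAt_source q)

lemma transition_mem {p q : M} {y : EuclideanSpace ℝ (Fin n)} (hy : y ∈ overlap n p q) :
    transition n p q y ∈ overlap n q p := by
  refine ⟨(extChartAt (𝓡 n) q).map_source hy.2, ?_⟩
  simp only [transition, Set.mem_preimage]
  rw [(extChartAt (𝓡 n) q).left_inv hy.2]
  exact (extChartAt (𝓡 n) p).map_target hy.1

lemma symm_transition {p q : M} {y : EuclideanSpace ℝ (Fin n)} (hy : y ∈ overlap n p q) :
    (extChartAt (𝓡 n) q).symm (transition n p q y) = (extChartAt (𝓡 n) p).symm y :=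
  (extChartAt (𝓡 n) q).left_inv hy.2

lemma transition_transition {p q : M} {y : EuclideanSpace ℝ (Fin n)} (hy : y ∈ overlap n p q) :
    transition n q p (transition n p q y) = y := by
  rw [transition, symm_transition hy, (extChartAt (𝓡 n) p).right_inv hy.1]

lemma mem_overlap_center {p : M} {y : EuclideanSpace ℝ (Fin n)}
    (hy : y ∈ (extChartAt (𝓡 n) p).target) :
    y ∈ overlap n p ((extChartAt (𝓡 n) p).symm y) :=
  ⟨hy, mem_extChartAt_source _⟩

lemma transition_center (p : M) (y : EuclideanSpace ℝ (Fin n)) :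
    transition n p ((extChartAt (𝓡 n) p).symm y) y = center n ((extChartAt (𝓡 n) p).symm y) := rfl

variable [IsManifold (𝓡 n) ∞ M]

lemma contDiffOn_transition (p q : M) : ContDiffOn ℝ ∞ (transition n p q) (overlap n p q) := by
  have := contDiffOn_ext_coord_change (I := 𝓡 n) (n := ∞) q p
  rwa [PartialEquiv.trans_source, PartialEquiv.symm_source] at this

lemma hasFDerivAt_transition {p q : M} {y : EuclideanSpace ℝ (Fin n)} (hy : y ∈ overlap n p q) :
    HasFDerivAt (transition n p q) (fderiv ℝ (transition n p q) y) y :=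
  (((contDiffOn_transition p q).contDiffAt ((isOpen_overlap p q).mem_nhds hy)).differentiableAt
    (by simp)).hasFDerivAt

lemma fderiv_transition_comp {p q : M} {y : EuclideanSpace ℝ (Fin n)} (hy : y ∈ overlap n p q) :
    fderiv ℝ (transition n q p) (transition n p q y) ∘L fderiv ℝ (transition n p q) y =
      ContinuousLinearMap.id ℝ _ := by
  have h1 := (hasFDerivAt_transition (transition_mem hy)).comp y (hasFDerivAt_transition hy)
  refine h1.unique ((hasFDerivAt_id y).congr_of_eventuallyEq ?_)
  exact Filter.eventually_of_mem ((isOpen_overlap p q).mem_nhds hy)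
    fun z hz => transition_transition hz

/-- The derivative of a coordinate change, as an isomorphism. -/
def transitionEquiv {p q : M} {y : EuclideanSpace ℝ (Fin n)} (hy : y ∈ overlap n p q) :
    EuclideanSpace ℝ (Fin n) ≃L[ℝ] EuclideanSpace ℝ (Fin n) :=
  ContinuousLinearEquiv.equivOfInverse (fderiv ℝ (transition n p q) y)
    (fderiv ℝ (transition n q p) (transition n p q y))
    (fun u => DFunLike.congr_fun (fderiv_transition_comp hy) u)
    (fun u => by
      have := fderiv_transition_comp (transition_mem hy)
      rw [transition_transition hy] at this
      exact DFunLike.congr_fun this u)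

lemma transitionEquiv_coe {p q : M} {y : EuclideanSpace ℝ (Fin n)} (hy : y ∈ overlap n p q) :
    (transitionEquiv hy : _ →L[ℝ] _) = fderiv ℝ (transition n p q) y := rfl

lemma injective_fderiv_transition {p q : M} {y : EuclideanSpace ℝ (Fin n)}
    (hy : y ∈ overlap n p q) : Function.Injective (fderiv ℝ (transition n p q) y) :=
  (transitionEquiv hy).injective

lemma eqOn_comp_transition {V : Type*} (f : M → V) (p q : M) :
    Set.EqOn (f ∘ (extChartAt (𝓡 n) p).symm)
      ((f ∘ (extChartAt (𝓡 n) q).symm) ∘ transition n p q) (overlap n p q) := by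
  intro y hy
  simp only [Function.comp_apply, symm_transition hy]

/-- A smooth map read in a chart. -/
lemma contDiffOn_comp_symm {V : Type*} [NormedAddCommGroup V] [NormedSpace ℝ V] {f : M → V}
    (hf : ContMDiff (𝓡 n) 𝓘(ℝ, V) ∞ f) (p : M) :
    ContDiffOn ℝ ∞ (f ∘ (extChartAt (𝓡 n) p).symm) (extChartAt (𝓡 n) p).target := by
  rw [← contMDiffOn_iff_contDiffOn]
  exact hf.comp_contMDiffOn (contMDiffOn_extChartAt_symm p)

/-- Smoothness at a point is read in the preferred chart. -/
lemma contMDiffAt_of_comp_symm {V : Type*} [NormedAddCommGroup V] [NormedSpace ℝ V] {f : M → V}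
    {p : M} (hf : ContDiffAt ℝ ∞ (f ∘ (extChartAt (𝓡 n) p).symm) (center n p)) :
    ContMDiffAt (𝓡 n) 𝓘(ℝ, V) ∞ f p := by
  have h1 : ContMDiffAt 𝓘(ℝ, EuclideanSpace ℝ (Fin n)) 𝓘(ℝ, V) ∞
      (f ∘ (extChartAt (𝓡 n) p).symm) (extChartAt (𝓡 n) p p) := hf.contMDiffAt
  have h2 := h1.comp p (contMDiffAt_extChartAt (I := 𝓡 n) (n := ∞) (x := p))
  refine h2.congr_of_eventuallyEq ?_
  filter_upwards [extChartAt_source_mem_nhds (I := 𝓡 n) p] with q hq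
  rw [Function.comp_apply, Function.comp_apply, (extChartAt (𝓡 n) p).left_inv hq]

lemma mfderiv_eq_fderiv {V : Type*} [NormedAddCommGroup V] [NormedSpace ℝ V] {f : M → V}
    (hf : ContMDiff (𝓡 n) 𝓘(ℝ, V) ∞ f) (p : M) :
    mfderiv (𝓡 n) 𝓘(ℝ, V) f p = fderiv ℝ (f ∘ (extChartAt (𝓡 n) p).symm) (center n p) := by
  have h : MDifferentiableAt (𝓡 n) 𝓘(ℝ, V) f p := (hf p).mdifferentiableAt (by simp)
  rw [h.mfderiv, ModelWithCorners.range_eq_univ, fderivWithin_univ]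
  rfl

end Charts

/-! ### Hypersurfaces of the sphere in charts -/

section HypersurfaceCharts

open ContinuousLinearMap

variable {n : ℕ} {M : Type*} [TopologicalSpace M]
  [ChartedSpace (EuclideanSpace ℝ (Fin n)) M] [IsManifold (𝓡 n) ∞ M]

lemma fderiv_param_eq {N : ℕ} {x : M → EuclideanSpace ℝ (Fin N)}
    (hx : ContMDiff (𝓡 n) 𝓘(ℝ, EuclideanSpace ℝ (Fin N)) ∞ x) {p q : M}
    {y : EuclideanSpace ℝ (Fin n)} (hy : y ∈ overlap n p q) :
    fderiv ℝ (param n x p) y =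
      fderiv ℝ (param n x q) (transition n p q y) ∘L fderiv ℝ (transition n p q) y := by
  have h1 : DifferentiableAt ℝ (param n x q) (transition n p q y) :=
    (((contDiffOn_comp_symm hx q).contDiffAt ((isOpen_extChartAt_target q).mem_nhds
      (transition_mem hy).1)).differentiableAt (by simp))
  rw [← fderiv_comp y h1 (hasFDerivAt_transition hy).differentiableAt]
  exact (Filter.eventuallyEq_of_mem ((isOpen_overlap p q).mem_nhds hy)
    (eqOn_comp_transition x p q)).fderiv_eq

variable {x ν : M → EuclideanSpace ℝ (Fin (n + 2))}

lemma IsSphereHypersurface.contDiffOn_param (hx : IsSphereHypersurface n x) (p : M) :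
    ContDiffOn ℝ ∞ (param n x p) (extChartAt (𝓡 n) p).target :=
  contDiffOn_comp_symm hx.contMDiff p

lemma IsSphereHypersurface.injective_center (hx : IsSphereHypersurface n x) (p : M) :
    Function.Injective (fderiv ℝ (param n x p) (center n p)) := by
  have := hx.injective_mfderiv p
  rw [mfderiv_eq_fderiv hx.contMDiff] at this
  exact this

/-- The immersion hypothesis is read directly only at the centre of each preferred chart; the
transition to the chart centred at the other point carries it to the whole target. -/
lemma IsSphereHypersurface.injective_param (hx : IsSphereHypersurface n x) (p : M)
    {y : EuclideanSpace ℝ (Fin n)} (hy : y ∈ (extChartAt (𝓡 n) p).target) :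
    Function.Injective (fderiv ℝ (param n x p) y) := by
  rw [fderiv_param_eq hx.contMDiff (mem_overlap_center hy), transition_center]
  exact (hx.injective_center _).comp (injective_fderiv_transition (mem_overlap_center hy))

lemma IsUnitNormal.inner_center (hx : IsSphereHypersurface n x) (hν : IsUnitNormal n x ν) (p : M)
    (u : EuclideanSpace ℝ (Fin n)) : ⟪ν p, fderiv ℝ (param n x p) (center n p) u⟫ = 0 := by
  have := hν.inner_tangent p u
  rw [mfderiv_eq_fderiv hx.contMDiff] at this
  exact this

lemma IsUnitNormal.inner_param (hx : IsSphereHypersurface n x) (hν : IsUnitNormal n x ν) (p : M)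
    {y : EuclideanSpace ℝ (Fin n)} (hy : y ∈ (extChartAt (𝓡 n) p).target)
    (u : EuclideanSpace ℝ (Fin n)) :
    ⟪ν ((extChartAt (𝓡 n) p).symm y), fderiv ℝ (param n x p) y u⟫ = 0 := by
  rw [fderiv_param_eq hx.contMDiff (mem_overlap_center hy), transition_center]
  exact hν.inner_center hx _ _

lemma exists_isPatch_param (hx : IsSphereHypersurface n x) (hν : IsUnitNormal n x ν) (p : M)
    {y : EuclideanSpace ℝ (Fin n)} (hy : y ∈ (extChartAt (𝓡 n) p).target) :
    ∃ V ξ, V ⊆ (extChartAt (𝓡 n) p).target ∧ y ∈ V ∧ IsPatch (param n x p) ξ V ∧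
      ξ y = ν ((extChartAt (𝓡 n) p).symm y) :=
  exists_isPatch (by simp) (isOpen_extChartAt_target p)
    (hx.contDiffOn_param p) (fun z _ => hx.norm_eq_one _) (fun z hz => hx.injective_param p hz) hy
    (hν.norm_eq_one _) (hν.inner_position _) (hν.inner_param hx p hy)

/-- The shape operator, extended by zero to the normal space, as an operator of `ℝⁿ⁺²`. -/
def ambientShape (n : ℕ) {M : Type*} [TopologicalSpace M]
    [ChartedSpace (EuclideanSpace ℝ (Fin n)) M] (x ν : M → EuclideanSpace ℝ (Fin (n + 2)))
    (p : M) : EuclideanSpace ℝ (Fin (n + 2)) →L[ℝ] EuclideanSpace ℝ (Fin (n + 2)) :=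
  fderiv ℝ (param n x p) (center n p) ∘L matrixOp (shapeOperator n x ν p) ∘L
    pinv (fderiv ℝ (param n x p) (center n p))

/-! ### Coordinate tensors at the centre of a chart. -/

section Center

variable {ξ : EuclideanSpace ℝ (Fin n) → EuclideanSpace ℝ (Fin (n + 2))}
  {V : Set (EuclideanSpace ℝ (Fin n))} {p : M}

lemma secondFundamentalForm_eq (h : IsPatch (param n x p) ξ V) (hp : center n p ∈ V)
    (hξ : ξ (center n p) = ν p) :
    secondFundamentalForm n x ν p = opMatrix (adjoint (fderiv ℝ (param n x p) (center n p)) ∘L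
      fieldShape (param n x p) ξ (center n p) ∘L fderiv ℝ (param n x p) (center n p)) := by
  ext i j
  rw [opMatrix_apply, apply_eq_inner_single, comp_apply, adjoint_inner_right, comp_apply,
    real_inner_comm, h.inner_shape_map hp, hξ, secondFundamentalForm, Matrix.of_apply,
    real_inner_comm]
  have h1 : HasFDerivAt
      (fun y => fderiv ℝ (param n x p) y (EuclideanSpace.single j (1 : ℝ)))
      ((fderiv ℝ (fderiv ℝ (param n x p)) (center n p)).flip (EuclideanSpace.single j 1))
      (center n p) := by
    simpa using (h.hasFDerivAt_fderiv hp).clm_apply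
      (hasFDerivAt_const (EuclideanSpace.single j (1 : ℝ)) (center n p))
  have h2 : partialDeriv i (partialDeriv j (param n x p)) (center n p) =
      fderiv ℝ (fderiv ℝ (param n x p)) (center n p) (EuclideanSpace.single i 1)
        (EuclideanSpace.single j 1) := by
    exact DFunLike.congr_fun h1.fderiv (EuclideanSpace.single i (1 : ℝ))
  rw [← h.sndFDeriv_symm hp, ← h2]
  rfl

lemma shapeOperator_eq (h : IsPatch (param n x p) ξ V) (hp : center n p ∈ V)
    (hξ : ξ (center n p) = ν p) :
    shapeOperator n x ν p = opMatrix (pinv (fderiv ℝ (param n x p) (center n p)) ∘L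
      fieldShape (param n x p) ξ (center n p) ∘L fderiv ℝ (param n x p) (center n p)) := by
  have e : metricAt n x p = gram (param n x p) (center n p) := rfl
  rw [shapeOperator, secondFundamentalForm_eq h hp hξ, e, gram_inv (h.injective _ hp),
    ← opMatrix_comp, pinv, comp_assoc]

lemma ambientShape_eq (h : IsPatch (param n x p) ξ V) (hp : center n p ∈ V)
    (hξ : ξ (center n p) = ν p) :
    ambientShape n x ν p = fieldShape (param n x p) ξ (center n p) := by
  rw [ambientShape, shapeOperator_eq h hp hξ, matrixOp_opMatrix]
  ext1 v
  simp [h.proj_shape hp, h.shape_proj hp]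

end Center

/-- The normal field and the shape operator are, near each point and up to a common sign at each
point, those of a smooth local unit normal field. -/
theorem exists_frame (hx : IsSphereHypersurface n x) (hν : IsUnitNormal n x ν) (p : M) :
    ∃ V ξ, V ⊆ (extChartAt (𝓡 n) p).target ∧ center n p ∈ V ∧ IsPatch (param n x p) ξ V ∧
      ξ (center n p) = ν p ∧
      ∀ y ∈ V, ∃ c : ℝ, (c = 1 ∨ c = -1) ∧ ν ((extChartAt (𝓡 n) p).symm y) = c • ξ y ∧
        ambientShape n x ν ((extChartAt (𝓡 n) p).symm y) = c • fieldShape (param n x p) ξ y := by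
  obtain ⟨V, ξ, hVt, hpV, hpatch, hξ⟩ := exists_isPatch_param hx hν p (center_mem_target p)
  rw [symm_center] at hξ
  refine ⟨V, ξ, hVt, hpV, hpatch, hξ, fun y hy => ?_⟩
  have hyt := hVt hy
  set q := (extChartAt (𝓡 n) p).symm y with hq
  obtain ⟨c, hc, hcν⟩ := unit_normal_unique (hpatch.injective y hy) hpatch.finrank_eq
    (hpatch.norm_eq_one y hy) (hpatch.norm_normal y hy) (hpatch.inner_position y hy)
    (hpatch.inner_position_map hy) (hpatch.inner_tangent y hy) (hν.norm_eq_one q)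
    (hν.inner_position q) (hν.inner_param hx p hyt)
  refine ⟨c, hc, hcν, ?_⟩
  -- The shape operator at `q` is defined in the chart centred at `q`. A patch of that chart, pulled
  -- back by the transition, can be compared with the patch around `p`: at `y` their normals differ
  -- by the sign `c`.
  obtain ⟨W, η, hWt, hqW, hqpatch, hη⟩ := exists_isPatch_param hx hν q (center_mem_target q)
  rw [symm_center] at hη
  rw [ambientShape_eq hqpatch hqW hη]
  have hyo : y ∈ overlap n p q := mem_overlap_center hyt
  have htc : transition n p q y = center n q := rfl
  let O : Set (EuclideanSpace ℝ (Fin n)) := overlap n p q ∩ transition n p q ⁻¹' W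
  have hO : IsOpen O := (contDiffOn_transition p q).continuousOn.isOpen_inter_preimage
    (isOpen_overlap p q) hqpatch.isOpen
  have hyO : y ∈ O := ⟨hyo, by rw [Set.mem_preimage, htc]; exact hqW⟩
  have h1 : IsPatch (param n x q ∘ transition n p q) (η ∘ transition n p q) O :=
    hqpatch.comp hO ((contDiffOn_transition p q).mono Set.inter_subset_left) (fun z hz => hz.2)
      fun z hz => injective_fderiv_transition hz.1
  have h2 : IsPatch (param n x p) (η ∘ transition n p q) O :=
    h1.congr ((eqOn_comp_transition x p q).mono Set.inter_subset_left)
  have h3 : fieldShape (param n x p) (η ∘ transition n p q) y =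
      fieldShape (param n x q) η (center n q) := by
    have e : fderiv ℝ (param n x p) y = fderiv ℝ (param n x q ∘ transition n p q) y :=
      (Filter.eventuallyEq_of_mem ((isOpen_overlap p q).mem_nhds hyo)
        (eqOn_comp_transition x p q)).fderiv_eq
    rw [fieldShape, e, comp_pinv_comp (J := transitionEquiv hyo) (hasFDerivAt_transition hyo)
      (hqpatch.hasFDerivAt hqW).differentiableAt (hqpatch.injective _ hqW)
      (hqpatch.hasFDerivAt_normal hqW).differentiableAt]
    rfl
  rw [← h3]
  refine hpatch.shape_congr h2 hy hyO ?_
  rw [Function.comp_apply, htc, hη, hcν]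

/-- The divergence of a vector field along the submanifold `x`. -/
def divergence (n : ℕ) {N : ℕ} {M : Type*} [TopologicalSpace M]
    [ChartedSpace (EuclideanSpace ℝ (Fin n)) M] (x W : M → EuclideanSpace ℝ (Fin N))
    (p : M) : ℝ :=
  surfaceDiv (param n x p) (param n W p) (center n p)

/-- The definition of `divergence` uses a different chart at every point; parametrization
independence allows one fixed chart, which smoothness and integration require. -/
lemma divergence_symm (hx : IsSphereHypersurface n x) {W : M → EuclideanSpace ℝ (Fin (n + 2))}
    (hW : ContMDiff (𝓡 n) 𝓘(ℝ, EuclideanSpace ℝ (Fin (n + 2))) ∞ W) (p : M)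
    {y : EuclideanSpace ℝ (Fin n)} (hy : y ∈ (extChartAt (𝓡 n) p).target) :
    divergence n x W ((extChartAt (𝓡 n) p).symm y) = surfaceDiv (param n x p) (param n W p) y := by
  set q := (extChartAt (𝓡 n) p).symm y with hq
  have hyo : y ∈ overlap n p q := mem_overlap_center hy
  have htc : transition n p q y = center n q := rfl
  have e : ∀ f : M → EuclideanSpace ℝ (Fin (n + 2)),
      fderiv ℝ (param n f p) y = fderiv ℝ (param n f q ∘ transition n p q) y := fun f =>
    (Filter.eventuallyEq_of_mem ((isOpen_overlap p q).mem_nhds hyo)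
      (eqOn_comp_transition f p q)).fderiv_eq
  have hd : ∀ f : M → EuclideanSpace ℝ (Fin (n + 2)),
      ContMDiff (𝓡 n) 𝓘(ℝ, EuclideanSpace ℝ (Fin (n + 2))) ∞ f →
      DifferentiableAt ℝ (param n f q) (transition n p q y) := fun f hf =>
    ((contDiffOn_comp_symm hf q).contDiffAt ((isOpen_extChartAt_target q).mem_nhds
      (transition_mem hyo).1)).differentiableAt (by simp)
  rw [divergence, surfaceDiv, surfaceDiv, e, e, comp_pinv_comp (J := transitionEquiv hyo)
    (hasFDerivAt_transition hyo) (hd x hx.contMDiff) (hx.injective_center q) (hd W hW)]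
  rfl

/-- Sign-invariant smooth functions of the position, the normal and the shape operator are
smooth, and are represented by the local smooth normal fields. -/
lemma contMDiff_of_even (hx : IsSphereHypersurface n x) (hν : IsUnitNormal n x ν)
    {G : Type*} [NormedAddCommGroup G] [NormedSpace ℝ G]
    {Φ : EuclideanSpace ℝ (Fin (n + 2)) → EuclideanSpace ℝ (Fin (n + 2)) →
      (EuclideanSpace ℝ (Fin (n + 2)) →L[ℝ] EuclideanSpace ℝ (Fin (n + 2))) → G}
    (hΦ : ContDiff ℝ ∞ fun z : EuclideanSpace ℝ (Fin (n + 2)) × EuclideanSpace ℝ (Fin (n + 2)) ×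
      (EuclideanSpace ℝ (Fin (n + 2)) →L[ℝ] EuclideanSpace ℝ (Fin (n + 2))) => Φ z.1 z.2.1 z.2.2)
    (heven : ∀ X N A, Φ X (-N) (-A) = Φ X N A) :
    ContMDiff (𝓡 n) 𝓘(ℝ, G) ∞ fun p => Φ (x p) (ν p) (ambientShape n x ν p) := by
  intro p
  obtain ⟨V, ξ, hVt, hpV, hpatch, hξ, hframe⟩ := exists_frame hx hν p
  apply contMDiffAt_of_comp_symm
  have h1 : ContDiffAt ℝ ∞
      (fun y => Φ (param n x p y) (ξ y) (fieldShape (param n x p) ξ y)) (center n p) :=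
    hΦ.contDiffAt.comp (center n p) ((hpatch.contDiffAt hpV).prodMk
      ((hpatch.contDiffAt_normal hpV).prodMk (hpatch.contDiffAt_shape hpV)))
  refine h1.congr_of_eventuallyEq (Filter.eventually_of_mem (hpatch.isOpen.mem_nhds hpV) ?_)
  intro y hy
  obtain ⟨c, hc, h2, h3⟩ := hframe y hy
  simp only [Function.comp_apply, h2, h3]
  rcases hc with rfl | rfl
  · simp only [one_smul]; rfl
  · simp only [neg_smul, one_smul, heven]; rfl

/-- The divergence of a sign-invariant vector field, computed with a local normal field. -/
lemma divergence_of_even {Φ : EuclideanSpace ℝ (Fin (n + 2)) → EuclideanSpace ℝ (Fin (n + 2)) →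
      (EuclideanSpace ℝ (Fin (n + 2)) →L[ℝ] EuclideanSpace ℝ (Fin (n + 2))) →
      EuclideanSpace ℝ (Fin (n + 2))}
    (heven : ∀ X N A, Φ X (-N) (-A) = Φ X N A) {p : M} {V : Set (EuclideanSpace ℝ (Fin n))}
    {ξ : EuclideanSpace ℝ (Fin n) → EuclideanSpace ℝ (Fin (n + 2))}
    (hpV : center n p ∈ V) (hpatch : IsPatch (param n x p) ξ V)
    (hframe : ∀ y ∈ V, ∃ c : ℝ, (c = 1 ∨ c = -1) ∧
      ν ((extChartAt (𝓡 n) p).symm y) = c • ξ y ∧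
        ambientShape n x ν ((extChartAt (𝓡 n) p).symm y) = c • fieldShape (param n x p) ξ y) :
    divergence n x (fun q => Φ (x q) (ν q) (ambientShape n x ν q)) p =
      surfaceDiv (param n x p)
        (fun y => Φ (param n x p y) (ξ y) (fieldShape (param n x p) ξ y)) (center n p) := by
  rw [divergence, surfaceDiv, surfaceDiv]
  congr 2
  apply Filter.EventuallyEq.fderiv_eq
  refine Filter.eventually_of_mem (hpatch.isOpen.mem_nhds hpV) ?_
  intro y hy
  obtain ⟨c, hc, h2, h3⟩ := hframe y hy
  simp only [param, h2, h3]
  rcases hc with rfl | rfl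
  · simp only [one_smul]
  · simp only [neg_smul, one_smul, heven]

end HypersurfaceCharts

/-! ### The Riemannian volume measure -/

section Determinants

open ContinuousLinearMap

variable {n N : ℕ}

lemma opMatrix_adjoint (T : EuclideanSpace ℝ (Fin n) →L[ℝ] EuclideanSpace ℝ (Fin n)) :
    opMatrix (adjoint T) = (opMatrix T)ᵀ := by
  ext i j
  rw [Matrix.transpose_apply, opMatrix_apply, opMatrix_apply, apply_eq_inner_single,
    adjoint_inner_right, real_inner_comm, ← apply_eq_inner_single]

lemma det_opMatrix (T : EuclideanSpace ℝ (Fin n) →L[ℝ] EuclideanSpace ℝ (Fin n)) :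
    (opMatrix T).det = T.det :=
  LinearMap.det_toMatrix _ _

lemma det_gram_comp (L : EuclideanSpace ℝ (Fin n) →L[ℝ] EuclideanSpace ℝ (Fin N))
    (J : EuclideanSpace ℝ (Fin n) →L[ℝ] EuclideanSpace ℝ (Fin n)) :
    (opMatrix (gramOp (L ∘L J))).det = J.det ^ 2 * (opMatrix (gramOp L)).det := by
  have : gramOp (L ∘L J) = adjoint J ∘L gramOp L ∘L J := by
    simp only [gramOp, adjoint_comp, comp_assoc]
  rw [this, opMatrix_comp, opMatrix_comp, Matrix.det_mul, Matrix.det_mul, opMatrix_adjoint,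
    Matrix.det_transpose, det_opMatrix J]
  ring

lemma contDiff_det_opMatrix : ContDiff ℝ ∞
    fun T : EuclideanSpace ℝ (Fin n) →L[ℝ] EuclideanSpace ℝ (Fin n) => (opMatrix T).det := by
  simp only [Matrix.det_apply]
  refine ContDiff.sum fun σ _ => ContDiff.const_smul _ (contDiff_prod fun i _ => ?_)
  simp only [opMatrix_apply]
  exact (contDiff_euclidean.mp (contDiff_id.clm_apply contDiff_const)) _

end Determinants

/-! ### Chart densities, their compatibility, and finiteness of the volume. -/

section Volume

variable {n N : ℕ} {M : Type*} [TopologicalSpace M]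
  [ChartedSpace (EuclideanSpace ℝ (Fin n)) M] [IsManifold (𝓡 n) ∞ M]
  {x : M → EuclideanSpace ℝ (Fin N)}

lemma contDiffOn_det_gram (hx : ContMDiff (𝓡 n) 𝓘(ℝ, EuclideanSpace ℝ (Fin N)) ∞ x) (p : M) :
    ContDiffOn ℝ ∞ (fun y => (gram (param n x p) y).det) (extChartAt (𝓡 n) p).target := by
  have h1 : ContDiffOn ℝ ∞ (fderiv ℝ (param n x p)) (extChartAt (𝓡 n) p).target :=
    (contDiffOn_comp_symm hx p).fderiv_of_isOpen (isOpen_extChartAt_target p) (by simp)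
  have h2 : ContDiffOn ℝ ∞ (fun y => gramOp (fderiv ℝ (param n x p) y))
      (extChartAt (𝓡 n) p).target :=
    ((adjointCLM (EuclideanSpace ℝ (Fin n)) (EuclideanSpace ℝ (Fin N))).contDiff.comp_contDiffOn
      h1).clm_comp h1
  simp only [gram_eq]
  exact contDiff_det_opMatrix.comp_contDiffOn h2

lemma continuousOn_sqrt_det_gram (hx : ContMDiff (𝓡 n) 𝓘(ℝ, EuclideanSpace ℝ (Fin N)) ∞ x)
    (p : M) : ContinuousOn (fun y => √(gram (param n x p) y).det) (extChartAt (𝓡 n) p).target :=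
  Real.continuous_sqrt.comp_continuousOn (contDiffOn_det_gram hx p).continuousOn

lemma sqrt_det_gram_transition (hx : ContMDiff (𝓡 n) 𝓘(ℝ, EuclideanSpace ℝ (Fin N)) ∞ x)
    {p q : M} {y : EuclideanSpace ℝ (Fin n)} (hy : y ∈ overlap n p q) :
    √(gram (param n x p) y).det = |(fderiv ℝ (transition n p q) y).det| *
      √(gram (param n x q) (transition n p q y)).det := by
  rw [gram_eq, gram_eq, fderiv_param_eq hx hy, det_gram_comp, Real.sqrt_mul (sq_nonneg _),
    Real.sqrt_sq_eq_abs]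

variable [MeasurableSpace M] [BorelSpace M]

lemma measurableSet_target (p : M) : MeasurableSet (extChartAt (𝓡 n) p).target :=
  (isOpen_extChartAt_target p).measurableSet

lemma measurableSet_source (p : M) : MeasurableSet (extChartAt (𝓡 n) p).source :=
  (isOpen_extChartAt_source p).measurableSet

lemma measurableSet_target_inter (p : M) {s : Set M} (hs : MeasurableSet s) :
    MeasurableSet ((extChartAt (𝓡 n) p).target ∩ (extChartAt (𝓡 n) p).symm ⁻¹' s) := by
  have h1 : Measurable ((extChartAt (𝓡 n) p).target.domRestrict (extChartAt (𝓡 n) p).symm) :=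
    (continuousOn_iff_continuous_domRestrict.mp (continuousOn_extChartAt_symm p)).measurable
  have h2 := (MeasurableEmbedding.subtype_coe (measurableSet_target (n := n) p)).measurableSet_image.mpr
    (h1 hs)
  convert h2 using 1
  ext y
  simp [Set.domRestrict, and_comm]

lemma aemeasurable_symm (p : M) (μ : Measure (EuclideanSpace ℝ (Fin n))) :
    AEMeasurable (extChartAt (𝓡 n) p).symm (μ.restrict (extChartAt (𝓡 n) p).target) :=
  (continuousOn_extChartAt_symm p).aemeasurable (measurableSet_target p)

lemma chartVolume_apply (p : M) {s : Set M} (hs : MeasurableSet s) :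
    chartVolume n x p s = ∫⁻ y in (extChartAt (𝓡 n) p).target ∩ (extChartAt (𝓡 n) p).symm ⁻¹' s,
      ENNReal.ofReal (√(gram (param n x p) y).det) := by
  rw [chartVolume, Measure.map_apply_of_aemeasurable (aemeasurable_symm p _) hs,
    Measure.restrict_apply' (measurableSet_target p), Set.inter_comm,
    withDensity_apply _ (measurableSet_target_inter p hs)]

lemma chartVolume_inter_source (p : M) {s : Set M} (hs : MeasurableSet s) :
    chartVolume n x p (s ∩ (extChartAt (𝓡 n) p).source) = chartVolume n x p s := by
  rw [chartVolume_apply p hs, chartVolume_apply p (hs.inter (measurableSet_source p))]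
  congr 2
  ext y
  constructor
  · rintro ⟨h1, h2, -⟩; exact ⟨h1, h2⟩
  · rintro ⟨h1, h2⟩; exact ⟨h1, h2, (extChartAt (𝓡 n) p).map_target h1⟩

/-- Change of variables along the transition map: its Jacobian is exactly the ratio of the two
densities. -/
lemma chartVolume_eq (hx : ContMDiff (𝓡 n) 𝓘(ℝ, EuclideanSpace ℝ (Fin N)) ∞ x) (p q : M)
    {s : Set M} (hs : MeasurableSet s) (hsp : s ⊆ (extChartAt (𝓡 n) p).source)
    (hsq : s ⊆ (extChartAt (𝓡 n) q).source) : chartVolume n x p s = chartVolume n x q s := by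
  rw [chartVolume_apply p hs, chartVolume_apply q hs]
  have hsub : (extChartAt (𝓡 n) p).target ∩ (extChartAt (𝓡 n) p).symm ⁻¹' s ⊆ overlap n p q :=
    fun y hy => ⟨hy.1, hsq hy.2⟩
  have himage : (extChartAt (𝓡 n) q).target ∩ (extChartAt (𝓡 n) q).symm ⁻¹' s =
      transition n p q '' ((extChartAt (𝓡 n) p).target ∩ (extChartAt (𝓡 n) p).symm ⁻¹' s) := by
    ext z
    constructor
    · rintro ⟨hz1, hz2⟩
      have hz : z ∈ overlap n q p := ⟨hz1, hsp hz2⟩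
      refine ⟨transition n q p z, ⟨(transition_mem hz).1, ?_⟩, transition_transition hz⟩
      rw [Set.mem_preimage, symm_transition hz]
      exact hz2
    · rintro ⟨y, hy, rfl⟩
      refine ⟨(transition_mem (hsub hy)).1, ?_⟩
      rw [Set.mem_preimage, symm_transition (hsub hy)]
      exact hy.2
  rw [himage, lintegral_image_eq_lintegral_abs_det_fderiv_mul volume
    (measurableSet_target_inter p hs)
    (fun y hy => (hasFDerivAt_transition (hsub hy)).hasFDerivWithinAt)]
  · refine setLIntegral_congr_fun (measurableSet_target_inter p hs) fun y hy => ?_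
    rw [sqrt_det_gram_transition hx (hsub hy), ENNReal.ofReal_mul (abs_nonneg _)]
  · intro y hy z hz hyz
    rw [← transition_transition (hsub hy), hyz, transition_transition (hsub hz)]

variable [CompactSpace M]

/-- A supremum of measures is not a setwise supremum, so the upper bound needs a competitor: chart
volumes glued along a measurable partition, with the chart at `p` as first piece. It dominates every
chart volume and on `s` it is at most the volume of the chart at `p`. -/
lemma volumeMeasure_apply (hx : ContMDiff (𝓡 n) 𝓘(ℝ, EuclideanSpace ℝ (Fin N)) ∞ x) (p : M)
    {s : Set M} (hs : MeasurableSet s) (hsp : s ⊆ (extChartAt (𝓡 n) p).source) :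
    volumeMeasure n x s = chartVolume n x p s := by
  apply le_antisymm
  · obtain ⟨t, ht⟩ := isCompact_univ.elim_finite_subcover
      (fun q : M => (extChartAt (𝓡 n) q).source) (fun q => isOpen_extChartAt_source q)
      (fun q _ => Set.mem_iUnion.mpr ⟨q, mem_extChartAt_source q⟩)
    obtain ⟨f, hf⟩ := (t.countable_toSet.insert p).exists_eq_range ⟨p, Set.mem_insert _ _⟩
    -- Listing `p` first makes the whole source of its chart the zeroth piece of the disjointed
    -- cover.
    let g : ℕ → M := fun i => Nat.casesOn i p f
    let B : ℕ → Set M := fun i => (extChartAt (𝓡 n) (g i)).source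
    have hB : ⋃ i, B i = Set.univ := by
      refine Set.eq_univ_of_forall fun z => ?_
      obtain ⟨q, hq⟩ := Set.mem_iUnion.mp (ht (Set.mem_univ z))
      obtain ⟨hqt, hzq⟩ := Set.mem_iUnion.mp hq
      have : q ∈ Set.range f := by rw [← hf]; exact Set.mem_insert_of_mem _ hqt
      obtain ⟨i, rfl⟩ := this
      exact Set.mem_iUnion.mpr ⟨i + 1, hzq⟩
    let A := disjointed B
    have hAm : ∀ i, MeasurableSet (A i) := MeasurableSet.disjointed fun i => measurableSet_source _
    have hAU : ⋃ i, A i = Set.univ := by rw [← hB]; exact iUnion_disjointed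
    have hAd : Pairwise (Function.onFun Disjoint A) := disjoint_disjointed B
    have hA0 : A 0 = (extChartAt (𝓡 n) p).source := disjointed_zero B
    let κ : Measure M := Measure.sum fun i => (chartVolume n x (g i)).restrict (A i)
    have hκ : volumeMeasure n x ≤ κ := by
      refine iSup_le fun q => Measure.le_iff.mpr fun s hs => ?_
      have h1 : s = ⋃ i, s ∩ A i := by rw [← Set.inter_iUnion, hAU, Set.inter_univ]
      conv_lhs => rw [h1]
      rw [measure_iUnion (fun i j hij => (hAd hij).mono Set.inter_subset_right
        Set.inter_subset_right) fun i => hs.inter (hAm i), Measure.sum_apply _ hs]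
      refine ENNReal.tsum_le_tsum fun i => ?_
      rw [Measure.restrict_apply hs, ← chartVolume_inter_source q (hs.inter (hAm i)),
        chartVolume_eq hx q (g i) ((hs.inter (hAm i)).inter (measurableSet_source q))
          Set.inter_subset_right
          ((Set.inter_subset_left.trans Set.inter_subset_right).trans (disjointed_subset B i))]
      exact measure_mono Set.inter_subset_left
    refine (hκ s).trans ?_
    rw [Measure.sum_apply _ hs, tsum_eq_single 0]
    · exact Measure.restrict_apply_le _ _
    · intro i hi
      have hd : s ∩ A i = ∅ := by
        rw [← Set.disjoint_iff_inter_eq_empty]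
        exact (hAd hi.symm).mono_left (by rw [hA0]; exact hsp)
      rw [Measure.restrict_apply hs, hd, measure_empty]
  · exact (le_iSup (chartVolume n x) p) s

lemma volumeMeasure_restrict_source
    (hx : ContMDiff (𝓡 n) 𝓘(ℝ, EuclideanSpace ℝ (Fin N)) ∞ x) (p : M) :
    (volumeMeasure n x).restrict (extChartAt (𝓡 n) p).source = chartVolume n x p := by
  ext s hs
  rw [Measure.restrict_apply hs, volumeMeasure_apply hx p (hs.inter (measurableSet_source p))
    Set.inter_subset_right, chartVolume_inter_source p hs]

lemma isFiniteMeasure_volumeMeasure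
    (hx : ContMDiff (𝓡 n) 𝓘(ℝ, EuclideanSpace ℝ (Fin N)) ∞ x) :
    IsFiniteMeasure (volumeMeasure n x) := by
  have : IsLocallyFiniteMeasure (volumeMeasure n x) := by
    refine ⟨fun p => ?_⟩
    -- On a compact ball inside the target the continuous density is integrable, so `p` has a
    -- neighbourhood of finite volume.
    obtain ⟨r, hr, hball⟩ := Metric.nhds_basis_closedBall.mem_iff.mp
      ((isOpen_extChartAt_target p).mem_nhds (center_mem_target (n := n) p))
    let s : Set M := (extChartAt (𝓡 n) p).source ∩
      extChartAt (𝓡 n) p ⁻¹' Metric.ball (center n p) r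
    have hso : IsOpen s := (continuousOn_extChartAt p).isOpen_inter_preimage
      (isOpen_extChartAt_source p) Metric.isOpen_ball
    refine ⟨s, hso.mem_nhds ⟨mem_extChartAt_source p, Metric.mem_ball_self hr⟩, ?_⟩
    rw [volumeMeasure_apply hx p hso.measurableSet Set.inter_subset_left,
      chartVolume_apply p hso.measurableSet]
    have hint : IntegrableOn (fun y => √(gram (param n x p) y).det)
        (Metric.closedBall (center n p) r) :=
      ((continuousOn_sqrt_det_gram hx p).mono hball).integrableOn_compact
        (isCompact_closedBall _ _)
    refine lt_of_le_of_lt (lintegral_mono_set ?_) hint.lintegral_lt_top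
    rintro y ⟨hy1, hy2⟩
    have := hy2.2
    rw [Set.mem_preimage, (extChartAt (𝓡 n) p).right_inv hy1] at this
    exact Metric.ball_subset_closedBall this
  infer_instance

/-- Integrals of functions supported in the domain of a chart. -/
lemma integral_volumeMeasure_of_support
    (hx : ContMDiff (𝓡 n) 𝓘(ℝ, EuclideanSpace ℝ (Fin N)) ∞ x) (p : M) {f : M → ℝ}
    (hf : Continuous f) (hsupp : ∀ q ∉ (extChartAt (𝓡 n) p).source, f q = 0) :
    ∫ q, f q ∂(volumeMeasure n x) = ∫ y in (extChartAt (𝓡 n) p).target,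
      √(gram (param n x p) y).det * f ((extChartAt (𝓡 n) p).symm y) := by
  rw [← setIntegral_eq_integral_of_forall_compl_eq_zero hsupp, volumeMeasure_restrict_source hx,
    chartVolume, integral_map (aemeasurable_symm p _) hf.stronglyMeasurable.aestronglyMeasurable,
    restrict_withDensity (measurableSet_target p),
    integral_withDensity_eq_integral_toReal_smul₀]
  · refine integral_congr_ae (Filter.Eventually.of_forall fun y => ?_)
    simp [ENNReal.toReal_ofReal (Real.sqrt_nonneg _)]
  · exact ((continuousOn_sqrt_det_gram hx p).aemeasurable (measurableSet_target p)).ennreal_ofReal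
  · exact Filter.Eventually.of_forall fun y => ENNReal.ofReal_lt_top

end Volume

/-! ### The divergence theorem -/

section DetDerivative

open ContinuousLinearMap

variable {n : ℕ}

/-- Read off the linear coefficient of the polynomial det(1 + tT) along the line through the
identity. -/
lemma trace_fderiv_det_id (T : EuclideanSpace ℝ (Fin n) →L[ℝ] EuclideanSpace ℝ (Fin n)) :
    fderiv ℝ (fun T : EuclideanSpace ℝ (Fin n) →L[ℝ] EuclideanSpace ℝ (Fin n) =>
      (opMatrix T).det) (ContinuousLinearMap.id ℝ _) T = traceCLM _ T := by
  have h1 : HasFDerivAt (fun T : EuclideanSpace ℝ (Fin n) →L[ℝ] EuclideanSpace ℝ (Fin n) =>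
      (opMatrix T).det) _ (ContinuousLinearMap.id ℝ _) :=
    (contDiff_det_opMatrix.differentiable (by simp) _).hasFDerivAt
  have h2 : HasDerivAt (fun t : ℝ =>
      ContinuousLinearMap.id ℝ (EuclideanSpace ℝ (Fin n)) + t • T) T 0 := by
    simpa using ((hasDerivAt_id (0 : ℝ)).smul_const T).const_add
      (ContinuousLinearMap.id ℝ (EuclideanSpace ℝ (Fin n)))
  have h3 := HasFDerivAt.comp_hasDerivAt_of_eq (0 : ℝ) h1 h2 (by ext u; simp)
  set P := (1 + (Polynomial.X : Polynomial ℝ) • (opMatrix T).map ⇑Polynomial.C).det.divX.divX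
  have h4 : ∀ t : ℝ, (opMatrix (ContinuousLinearMap.id ℝ (EuclideanSpace ℝ (Fin n)) + t • T)).det =
      1 + (opMatrix T).trace * t + P.eval t * t ^ 2 := by
    intro t
    have : opMatrix (ContinuousLinearMap.id ℝ (EuclideanSpace ℝ (Fin n)) + t • T) =
        1 + t • opMatrix T := by
      rw [← opMatrix_id]
      ext i j
      simp [opMatrix_apply]
    rw [this, Matrix.det_one_add_smul]
  have h5 : HasDerivAt (fun t : ℝ => 1 + (opMatrix T).trace * t + P.eval t * t ^ 2)
      ((opMatrix T).trace) 0 := by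
    have := (((hasDerivAt_id (0 : ℝ)).const_mul (opMatrix T).trace).const_add 1).add
      ((P.hasDerivAt (0 : ℝ)).mul (hasDerivAt_pow 2 (0 : ℝ)))
    refine HasDerivAt.congr_deriv (f := fun t : ℝ => 1 + (opMatrix T).trace * t + P.eval t * t ^ 2)
      this ?_
    simp
  rw [← trace_opMatrix]
  refine h3.unique (h5.congr_of_eventuallyEq (Filter.Eventually.of_forall fun t => ?_))
  exact h4 t

/-- Jacobi's formula. -/
lemma hasFDerivAt_det {G : Type*} [NormedAddCommGroup G] [NormedSpace ℝ G]
    {T : G → EuclideanSpace ℝ (Fin n) →L[ℝ] EuclideanSpace ℝ (Fin n)}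
    {T' : G →L[ℝ] EuclideanSpace ℝ (Fin n) →L[ℝ] EuclideanSpace ℝ (Fin n)} {y : G}
    (hT : HasFDerivAt T T' y) (hinv : (T y).IsInvertible) :
    HasFDerivAt (fun z => (opMatrix (T z)).det)
      ((opMatrix (T y)).det • (traceCLM _ ∘L (compL ℝ _ _ _ (T y).inverse) ∘L T')) y := by
  -- Multiplicativity, det T(z) = det T(y) · det(T(y)⁻¹T(z)), reduces the derivative to that at the
  -- identity.
  have h1 : HasFDerivAt (fun z => (T y).inverse ∘L T z) (compL ℝ _ _ _ (T y).inverse ∘L T') y :=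
    (compL ℝ (EuclideanSpace ℝ (Fin n)) (EuclideanSpace ℝ (Fin n)) (EuclideanSpace ℝ (Fin n))
      (T y).inverse).hasFDerivAt.comp y hT
  have h2 : HasFDerivAt (fun T : EuclideanSpace ℝ (Fin n) →L[ℝ] EuclideanSpace ℝ (Fin n) =>
      (opMatrix T).det) _ ((T y).inverse ∘L T y) :=
    (contDiff_det_opMatrix.differentiable (by simp) _).hasFDerivAt
  have h3 := (h2.comp y h1).const_mul (opMatrix (T y)).det
  rw [hinv.inverse_comp_self] at h3
  refine (h3.congr_of_eventuallyEq (Filter.Eventually.of_forall fun z => ?_)).congr_fderiv ?_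
  · simp only [Function.comp_apply]
    rw [← Matrix.det_mul, ← opMatrix_comp, ← comp_assoc,
      hinv.self_comp_inverse, id_comp]
  · ext1 u
    simp only [smul_apply, comp_apply]
    rw [trace_fderiv_det_id]

end DetDerivative

/-! ### Divergence in coordinates. -/

section FlatDivergence

open ContinuousLinearMap

variable {n N : ℕ}

/-- Each diagonal partial derivative is integrated by parts against the constant function 1; compact
support gives integrability. -/
lemma integral_trace_fderiv {Z : EuclideanSpace ℝ (Fin n) → EuclideanSpace ℝ (Fin n)}
    (hZ : ContDiff ℝ ∞ Z) (hc : HasCompactSupport Z) :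
    ∫ y, traceCLM _ (fderiv ℝ Z y) = 0 := by
  have hcomp : ∀ i, ContDiff ℝ ∞ fun y => Z y i := fun i => contDiff_euclidean.mp hZ i
  have hcc : ∀ i, HasCompactSupport fun y => Z y i := fun i =>
    hc.comp_left (g := fun v : EuclideanSpace ℝ (Fin n) => v i) rfl
  have hcd : ∀ i, Continuous fun y => fderiv ℝ (fun z => Z z i) y (EuclideanSpace.single i 1) :=
    fun i => ((hcomp i).continuous_fderiv (by simp)).clm_apply continuous_const
  have hcdc : ∀ i, HasCompactSupport
      fun y => fderiv ℝ (fun z => Z z i) y (EuclideanSpace.single i 1) := fun i =>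
    ((hcc i).fderiv (𝕜 := ℝ)).comp_left
      (g := fun l : EuclideanSpace ℝ (Fin n) →L[ℝ] ℝ => l (EuclideanSpace.single i 1)) rfl
  have hint : ∀ i, Integrable fun y => fderiv ℝ (fun z => Z z i) y (EuclideanSpace.single i 1) :=
    fun i => (hcd i).integrable_of_hasCompactSupport (hcdc i)
  have htr : ∀ y, traceCLM _ (fderiv ℝ Z y) =
      ∑ i, fderiv ℝ (fun z => Z z i) y (EuclideanSpace.single i 1) := by
    intro y
    rw [← trace_opMatrix, Matrix.trace]
    refine Finset.sum_congr rfl fun i _ => ?_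
    have hd := (hZ.differentiable (by simp) y).hasFDerivAt
    have := (EuclideanSpace.proj i : EuclideanSpace ℝ (Fin n) →L[ℝ] ℝ).hasFDerivAt.comp y hd
    have h2 : HasFDerivAt (fun z => Z z i) _ y := this
    rw [h2.fderiv, Matrix.diag_apply, opMatrix_apply]
    rfl
  simp only [htr]
  rw [integral_finsetSum _ fun i _ => hint i]
  refine Finset.sum_eq_zero fun i _ => ?_
  have h := integral_mul_fderiv_eq_neg_fderiv_mul_of_integrable
    (μ := (volume : Measure (EuclideanSpace ℝ (Fin n)))) (f := fun _ => (1 : ℝ))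
    (g := fun z => Z z i) (v := EuclideanSpace.single i 1) (by simp)
    (by simpa using hint i)
    (by simpa using (hcomp i).continuous.integrable_of_hasCompactSupport (hcc i))
    (fun y _ => differentiableAt_const _) (fun y _ => (hcomp i).differentiable (by simp) y)
  simpa using h

variable {X W : EuclideanSpace ℝ (Fin n) → EuclideanSpace ℝ (Fin N)}
  {U : Set (EuclideanSpace ℝ (Fin n))}

/-- The coordinates of a tangent vector field, multiplied by the volume density. -/
def densityField (X W : EuclideanSpace ℝ (Fin n) → EuclideanSpace ℝ (Fin N))
    (y : EuclideanSpace ℝ (Fin n)) : EuclideanSpace ℝ (Fin n) :=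
  √(gram X y).det • pinv (fderiv ℝ X y) (W y)

lemma posSemidef_gram (X : EuclideanSpace ℝ (Fin n) → EuclideanSpace ℝ (Fin N))
    (y : EuclideanSpace ℝ (Fin n)) : (gram X y).PosSemidef := by
  have : (gram X y).IsHermitian := by
    ext i j
    simp [gram, real_inner_comm]
  refine Matrix.PosSemidef.of_dotProduct_mulVec_nonneg this fun v => ?_
  have h2 := opMatrix_mulVec (gramOp (fderiv ℝ X y)) (WithLp.toLp 2 v)
  rw [gram_eq]
  have h3 : star v ⬝ᵥ opMatrix (gramOp (fderiv ℝ X y)) *ᵥ v =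
      ⟪WithLp.toLp 2 v, gramOp (fderiv ℝ X y) (WithLp.toLp 2 v)⟫ := by
    simp only at h2
    rw [h2, real_inner_comm, EuclideanSpace.inner_eq_star_dotProduct, dotProduct_comm]
    simp [dotProduct_comm]
  rw [h3, inner_gramOp]
  exact real_inner_self_nonneg

lemma det_gram_pos {y : EuclideanSpace ℝ (Fin n)} (hinj : Function.Injective (fderiv ℝ X y)) :
    0 < (gram X y).det := by
  refine lt_of_le_of_ne (posSemidef_gram X y).det_nonneg (Ne.symm ?_)
  intro h0
  have : (gram X y)⁻¹ * gram X y = 1 := by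
    rw [gram_inv hinj, gram_eq, ← opMatrix_comp, inverse_gramOp_comp hinj, opMatrix_id]
  have := congrArg Matrix.det this
  rw [Matrix.det_mul, h0, mul_zero, Matrix.det_one] at this
  exact zero_ne_one this

lemma contDiffOn_densityField (hU : IsOpen U) (hX : ContDiffOn ℝ ∞ X U)
    (hinj : ∀ y ∈ U, Function.Injective (fderiv ℝ X y)) (hW : ContDiffOn ℝ ∞ W U) :
    ContDiffOn ℝ ∞ (densityField X W) U := by
  intro y hy
  have hUy := hU.mem_nhds hy
  have hL : ContDiffAt ℝ ∞ (fderiv ℝ X) y := (hX.contDiffAt hUy).fderiv_right (by simp)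
  have hP : ContDiffAt ℝ ∞ (fun z => pinv (fderiv ℝ X z)) y :=
    (contDiffAt_pinv (hinj y hy)).comp y hL
  have hG : ContDiffAt ℝ ∞ (fun z => (gram X z).det) y := by
    simp only [gram_eq]
    exact contDiff_det_opMatrix.contDiffAt.comp y (((adjointCLM (EuclideanSpace ℝ (Fin n))
      (EuclideanSpace ℝ (Fin N))).contDiff.contDiffAt.comp y hL).clm_comp hL)
  exact ((hG.sqrt (det_gram_pos (hinj y hy)).ne').smul
    (hP.clm_apply (hW.contDiffAt hUy))).contDiffWithinAt

/-- The classical formula √g div W = ∂ᵢ(√g Vⁱ), for W = dX(V). Jacobi's formula differentiates the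
density, and the result matches the second-derivative term in dW by symmetry of d²X. -/
lemma trace_fderiv_densityField (hU : IsOpen U) (hX : ContDiffOn ℝ ∞ X U)
    (hinj : ∀ y ∈ U, Function.Injective (fderiv ℝ X y)) (hW : ContDiffOn ℝ ∞ W U)
    (htan : ∀ y ∈ U, fderiv ℝ X y (pinv (fderiv ℝ X y) (W y)) = W y)
    {y : EuclideanSpace ℝ (Fin n)} (hy : y ∈ U) :
    traceCLM _ (fderiv ℝ (densityField X W) y) = √(gram X y).det * surfaceDiv X W y := by
  have hUy := hU.mem_nhds hy
  have hLc : ContDiffAt ℝ ∞ (fderiv ℝ X) y := (hX.contDiffAt hUy).fderiv_right (by simp)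
  have hPc : ContDiffAt ℝ ∞ (fun z => pinv (fderiv ℝ X z)) y :=
    (contDiffAt_pinv (hinj y hy)).comp y hLc
  set B := fderiv ℝ (fderiv ℝ X) y with hBdef
  have hL : HasFDerivAt (fderiv ℝ X) B y := (hLc.differentiableAt (by simp)).hasFDerivAt
  have hsymm : ∀ u w, B u w = B w u := fun u w =>
    ((hX.contDiffAt hUy).isSymmSndFDerivAt (by simp [two_le_infty])).eq u w
  set L := fderiv ℝ X y with hLdef
  have hLinj : Function.Injective L := hinj y hy
  have hΓ : HasFDerivAt (fun z => gramOp (fderiv ℝ X z)) _ y :=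
    ((adjointCLM (EuclideanSpace ℝ (Fin n)) (EuclideanSpace ℝ (Fin N))).hasFDerivAt.comp y
      hL).clm_comp hL
  have hdet := hasFDerivAt_det hΓ (gramOp_isInvertible hLinj)
  have hpos : 0 < (opMatrix (gramOp L)).det := by
    have := det_gram_pos hLinj
    rwa [gram_eq] at this
  have hsqrt := hdet.sqrt hpos.ne'
  set V : EuclideanSpace ℝ (Fin n) → EuclideanSpace ℝ (Fin n) :=
    fun z => pinv (fderiv ℝ X z) (W z) with hVdef
  have hV : HasFDerivAt V (fderiv ℝ V y) y :=
    ((hPc.clm_apply (hW.contDiffAt hUy)).differentiableAt (by simp)).hasFDerivAt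
  -- The two halves of the derivative of L†L are adjoint to each other and have equal traces. The
  -- factor 2 is compensated by the derivative of the square root.
  have htrΓ : ∀ u : EuclideanSpace ℝ (Fin n), traceCLM _ ((gramOp L).inverse ∘L (adjoint L ∘L B u + adjoint (B u) ∘L L)) =
      2 * traceCLM _ (pinv L ∘L B u) := by
    intro u
    have e : traceCLM _ ((gramOp L).inverse ∘L (adjoint (B u) ∘L L)) =
        traceCLM _ (pinv L ∘L B u) := by
      rw [← traceCLM_adjoint, adjoint_comp, adjoint_comp, adjoint_adjoint,
        inverse_gramOp_adjoint hLinj, traceCLM_comp_comm, pinv, comp_assoc]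
    rw [comp_add, map_add, e, ← comp_assoc (gramOp L).inverse (adjoint L) (B u)]
    change traceCLM (EuclideanSpace ℝ (Fin n)) (pinv L ∘L B u) + _ = _
    ring
  have hW' : HasFDerivAt W (L ∘L fderiv ℝ V y + B.flip (V y)) y := by
    refine (hL.clm_apply hV).congr_of_eventuallyEq ?_
    exact Filter.eventually_of_mem hUy fun z hz => (htan z hz).symm
  have hZ := hsqrt.fun_smul hV
  have hZ' : densityField X W = fun z => √(opMatrix (gramOp (fderiv ℝ X z))).det • V z := by
    funext z
    rw [densityField, gram_eq]
  rw [hZ', hZ.fderiv, surfaceDiv_of_hasFDerivAt hW', traceCLM_comp_comm, ← hLdef,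
    comp_add (pinv L), ← comp_assoc (pinv L) L, pinv_comp hLinj, id_comp, map_add, map_add, map_smul, traceCLM_smulRight, gram_eq]
  have e2 : pinv L ∘L B.flip (V y) = pinv L ∘L B (V y) := by
    ext1 u
    simp [hsymm u]
  rw [e2]
  have e3 := htrΓ (V y)
  simp only [smul_apply, comp_apply, compL_apply, add_apply, flip_apply, adjointCLM_apply,
    Function.comp_apply, smul_eq_mul, ← hLdef] at e3 ⊢
  rw [e3]
  have hs := Real.mul_self_sqrt hpos.le
  have hs0 : √(opMatrix (gramOp L)).det ≠ 0 := (Real.sqrt_pos.mpr hpos).ne'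
  field_simp
  rw [sq, hs]
  ring

end FlatDivergence

/-! ### From one chart to the closed manifold. -/

section GlobalDivergence

open ContinuousLinearMap

variable {n : ℕ} {M : Type*} [TopologicalSpace M]
  [ChartedSpace (EuclideanSpace ℝ (Fin n)) M] [IsManifold (𝓡 n) ∞ M]
  {x W : M → EuclideanSpace ℝ (Fin (n + 2))}

lemma contMDiff_divergence (hx : IsSphereHypersurface n x)
    (hW : ContMDiff (𝓡 n) 𝓘(ℝ, EuclideanSpace ℝ (Fin (n + 2))) ∞ W) :
    ContMDiff (𝓡 n) 𝓘(ℝ, ℝ) ∞ (divergence n x W) := by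
  intro p
  apply contMDiffAt_of_comp_symm
  have hp := (isOpen_extChartAt_target p).mem_nhds (center_mem_target (n := n) p)
  have h1 : ContDiffAt ℝ ∞ (fderiv ℝ (param n x p)) (center n p) :=
    ((hx.contDiffOn_param p).contDiffAt hp).fderiv_right (by simp)
  have h2 : ContDiffAt ℝ ∞ (fderiv ℝ (param n W p)) (center n p) :=
    ((contDiffOn_comp_symm hW p).contDiffAt hp).fderiv_right (by simp)
  have h3 : ContDiffAt ℝ ∞ (surfaceDiv (param n x p) (param n W p)) (center n p) :=
    (traceCLM (EuclideanSpace ℝ (Fin (n + 2)))).contDiff.contDiffAt.comp (center n p)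
      (h2.clm_comp ((contDiffAt_pinv (hx.injective_center p)).comp (center n p) h1))
  exact h3.congr_of_eventuallyEq (Filter.eventually_of_mem hp fun y hy => divergence_symm hx hW p hy)

lemma divergence_eq_zero_of_notMem_tsupport {p : M} (hp : p ∉ tsupport W) :
    divergence n x W p = 0 := by
  have h0 : W =ᶠ[nhds p] 0 := notMem_tsupport_iff_eventuallyEq.mp hp
  have h1 : Filter.Tendsto (extChartAt (𝓡 n) p).symm (nhds (center n p)) (nhds p) := by
    have := continuousAt_extChartAt_symm (I := 𝓡 n) p
    rw [ContinuousAt, extChartAt_to_inv] at this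
    exact this
  have h2 : param n W p =ᶠ[nhds (center n p)] fun _ => 0 := h1.eventually h0
  rw [divergence, surfaceDiv, h2.fderiv_eq]
  simp

lemma divergence_sum {ι : Type*} (t : Finset ι) {Ws : ι → M → EuclideanSpace ℝ (Fin (n + 2))}
    (hW : ∀ i ∈ t, ContMDiff (𝓡 n) 𝓘(ℝ, EuclideanSpace ℝ (Fin (n + 2))) ∞ (Ws i)) (p : M) :
    divergence n x (fun q => ∑ i ∈ t, Ws i q) p = ∑ i ∈ t, divergence n x (Ws i) p := by
  have h1 : HasFDerivAt (param n (fun q => ∑ i ∈ t, Ws i q) p)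
      (∑ i ∈ t, fderiv ℝ (param n (Ws i) p) (center n p)) (center n p) := by
    refine HasFDerivAt.fun_sum fun i hi => ?_
    exact (((contDiffOn_comp_symm (hW i hi) p).contDiffAt ((isOpen_extChartAt_target p).mem_nhds
      (center_mem_target p))).differentiableAt (by simp)).hasFDerivAt
  rw [divergence, surfaceDiv_of_hasFDerivAt h1, finsetSum_comp, map_sum]
  rfl

/-- The vector field `W` along `x` is tangent to the submanifold. -/
def IsTangentField (n : ℕ) {N : ℕ} {M : Type*} [TopologicalSpace M]
    [ChartedSpace (EuclideanSpace ℝ (Fin n)) M] (x W : M → EuclideanSpace ℝ (Fin N)) : Prop :=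
  ∀ p, W p ∈ Set.range (fderiv ℝ (param n x p) (center n p))

lemma IsTangentField.proj_eq (hx : IsSphereHypersurface n x) (htan : IsTangentField n x W) (p : M)
    {y : EuclideanSpace ℝ (Fin n)} (hy : y ∈ (extChartAt (𝓡 n) p).target) :
    fderiv ℝ (param n x p) y (pinv (fderiv ℝ (param n x p) y) (param n W p y)) =
      param n W p y := by
  have hyo := mem_overlap_center hy
  obtain ⟨u, hu⟩ := htan ((extChartAt (𝓡 n) p).symm y)
  have e := fderiv_param_eq hx.contMDiff hyo
  have h1 : param n W p y =
      fderiv ℝ (param n x p) y ((transitionEquiv hyo).symm u) := by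
    rw [e, comp_apply, ← transitionEquiv_coe hyo, ContinuousLinearEquiv.coe_coe,
      ContinuousLinearEquiv.apply_symm_apply, transition_center, hu]
    rfl
  rw [h1, pinv_apply (hx.injective_param p hy)]

variable [MeasurableSpace M] [BorelSpace M] [CompactSpace M]

/-- In a chart containing the support, the integrand is the flat divergence of the density field;
its extension by zero is smooth because the support is compact inside the target. -/
lemma integral_divergence_of_tsupport [T2Space M] (hx : IsSphereHypersurface n x)
    (hW : ContMDiff (𝓡 n) 𝓘(ℝ, EuclideanSpace ℝ (Fin (n + 2))) ∞ W) (htan : IsTangentField n x W)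
    (p : M) (hsupp : tsupport W ⊆ (extChartAt (𝓡 n) p).source) :
    ∫ q, divergence n x W q ∂(volumeMeasure n x) = 0 := by
  rw [integral_volumeMeasure_of_support hx.contMDiff p (contMDiff_divergence hx hW).continuous
    fun q hq => divergence_eq_zero_of_notMem_tsupport fun h => hq (hsupp h)]
  have htgt := isOpen_extChartAt_target (I := 𝓡 n) p
  set T := (extChartAt (𝓡 n) p).target with hT
  let K : Set (EuclideanSpace ℝ (Fin n)) := extChartAt (𝓡 n) p '' tsupport W
  have hK : IsCompact K := (isClosed_tsupport W).isCompact.image_of_continuousOn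
    ((continuousOn_extChartAt p).mono hsupp)
  have hKT : K ⊆ T := by
    rintro _ ⟨q, hq, rfl⟩
    exact (extChartAt (𝓡 n) p).map_source (hsupp hq)
  let Z := T.indicator (densityField (param n x p) (param n W p))
  have hZK : ∀ y ∉ K, Z y = 0 := by
    intro y hy
    by_cases hyT : y ∈ T
    · have : param n W p y = 0 := by
        refine image_eq_zero_of_notMem_tsupport (f := W) fun h => hy ⟨_, h, ?_⟩
        exact (extChartAt (𝓡 n) p).right_inv hyT
      simp [Z, densityField, this]
    · exact Set.indicator_of_notMem hyT _
  have hZT : ∀ y ∈ T, Z =ᶠ[nhds y] densityField (param n x p) (param n W p) := fun y hy =>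
    Filter.eventually_of_mem (htgt.mem_nhds hy) fun z hz => Set.indicator_of_mem hz _
  have hZ0 : ∀ y ∉ K, Z =ᶠ[nhds y] fun _ => 0 := fun y hy =>
    Filter.eventually_of_mem (hK.isClosed.isOpen_compl.mem_nhds hy) fun z hz => hZK z hz
  have hinj := fun y (hy : y ∈ T) => hx.injective_param p hy
  have hWc : ContDiffOn ℝ ∞ (param n W p) T := contDiffOn_comp_symm hW p
  have hZc : ContDiff ℝ ∞ Z := by
    rw [contDiff_iff_contDiffAt]
    intro y
    by_cases hy : y ∈ T
    · exact ((contDiffOn_densityField htgt (hx.contDiffOn_param p) hinj hWc).contDiffAt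
        (htgt.mem_nhds hy)).congr_of_eventuallyEq (hZT y hy)
    · exact contDiffAt_const.congr_of_eventuallyEq (hZ0 y fun h => hy (hKT h))
  have hZs : HasCompactSupport Z := HasCompactSupport.intro hK hZK
  rw [← integral_trace_fderiv hZc hZs, ← setIntegral_eq_integral_of_forall_compl_eq_zero (s := T)
    (f := fun y => traceCLM (EuclideanSpace ℝ (Fin n)) (fderiv ℝ Z y))]
  · refine setIntegral_congr_fun (measurableSet_target p) fun y hy => ?_
    rw [divergence_symm hx hW p hy, (hZT y hy).fderiv_eq,
      trace_fderiv_densityField htgt (hx.contDiffOn_param p) hinj hWc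
        (fun z hz => htan.proj_eq hx p hz) hy]
  · intro y hy
    rw [(hZ0 y fun h => hy (hKT h)).fderiv_eq]
    simp

/-- The divergence theorem on a closed hypersurface of the sphere. -/
theorem integral_divergence_eq_zero [T2Space M] (hx : IsSphereHypersurface n x)
    (hW : ContMDiff (𝓡 n) 𝓘(ℝ, EuclideanSpace ℝ (Fin (n + 2))) ∞ W)
    (htan : IsTangentField n x W) :
    ∫ q, divergence n x W q ∂(volumeMeasure n x) = 0 := by
  have := isFiniteMeasure_volumeMeasure (x := x) hx.contMDiff
  -- Multiplication by the partition functions keeps `W` tangent and localizes it in charts; by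
  -- compactness only finitely many of them are not identically zero.
  obtain ⟨f, hf⟩ := SmoothPartitionOfUnity.exists_isSubordinate_chartAt_source (𝓡 n) M
  have hfin : {i | (Function.support (f i)).Nonempty}.Finite :=
    f.locallyFinite.finite_nonempty_of_compact
  let t := hfin.toFinset
  let Ws : M → M → EuclideanSpace ℝ (Fin (n + 2)) := fun i q => f i q • W q
  have hWs : ∀ i, ContMDiff (𝓡 n) 𝓘(ℝ, EuclideanSpace ℝ (Fin (n + 2))) ∞ (Ws i) := fun i =>
    (f i).contMDiff.smul hW
  have hsum : W = fun q => ∑ i ∈ t, Ws i q := by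
    funext q
    have h1 : ∑ i ∈ t, f i q = 1 := by
      rw [← f.sum_eq_one (Set.mem_univ q)]
      refine (finsum_eq_sum_of_support_subset _ fun i hi => ?_).symm
      rw [Set.Finite.coe_toFinset]
      exact ⟨q, hi⟩
    simp only [Ws]
    rw [← Finset.sum_smul, h1, one_smul]
  have hdiv : divergence n x W = fun q => ∑ i ∈ t, divergence n x (Ws i) q := by
    funext q
    conv_lhs => rw [hsum]
    exact divergence_sum t (fun i _ => hWs i) q
  rw [hdiv, integral_finsetSum]
  · refine Finset.sum_eq_zero fun i _ => integral_divergence_of_tsupport hx (hWs i) ?_ i ?_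
    · intro p
      obtain ⟨u, hu⟩ := htan p
      exact ⟨f i p • u, by rw [map_smul, hu]⟩
    · rw [extChartAt_source]
      exact (tsupport_smul_subset_left _ _).trans (hf i)
  · intro i _
    exact (contMDiff_divergence hx (hWs i)).continuous.integrable_of_hasCompactSupport
      (HasCompactSupport.of_compactSpace _)

end GlobalDivergence

/-! ### Newton's identity for the shape operator -/

section Newton

variable {n : ℕ}

/-- In Newton's identity for the third power sum, both mixed terms e₁p₂ and e₂p₁ contain the
vanishing sum. -/
lemma sum_cube_eq_esymm {ι : Type*} [Fintype ι] (l : ι → ℝ) (h : ∑ i, l i = 0) :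
    ∑ i, l i ^ 3 = 3 * (Multiset.map l Finset.univ.val).esymm 3 := by
  have h1 := congrArg (MvPolynomial.aeval l)
    (MvPolynomial.psum_eq_mul_esymm_sub_sum ι ℝ 3 (by norm_num))
  have hf : {a ∈ Finset.HasAntidiagonal.antidiagonal 3 | a.1 ∈ Set.Ioo 0 3} =
      ({(1, 2), (2, 1)} : Finset (ℕ × ℕ)) := by
    ext ⟨a, b⟩
    simp only [Finset.mem_filter, Finset.HasAntidiagonal.mem_antidiagonal, Set.mem_Ioo, Finset.mem_insert,
      Finset.mem_singleton, Prod.mk.injEq]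
    omega
  rw [hf, Finset.sum_pair (by simp)] at h1
  have hp : ∀ k, MvPolynomial.aeval l (MvPolynomial.psum ι ℝ k) = ∑ i, l i ^ k := fun k => by
    simp [MvPolynomial.psum]
  have he : MvPolynomial.aeval l (MvPolynomial.esymm ι ℝ 1) = ∑ i, l i := by
    simp [MvPolynomial.esymm_one]
  have hp1 : ∑ i, l i ^ 1 = 0 := by simpa using h
  simp only [map_sub, map_add, map_mul, hp, he, hp1, h,
    MvPolynomial.aeval_esymm_eq_multiset_esymm] at h1
  rw [h1]
  simp
  norm_num

lemma trace_pow_eq_sum_eigenvalues {K : Matrix (Fin n) (Fin n) ℝ} (hK : K.IsHermitian)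
    (k : ℕ) : (K ^ k).trace = ∑ i, hK.eigenvalues i ^ k := by
  have h1 : K ^ k = Unitary.conjStarAlgAut ℝ (Matrix (Fin n) (Fin n) ℝ) hK.eigenvectorUnitary
      (Matrix.diagonal (RCLike.ofReal ∘ hK.eigenvalues) ^ k) := by
    rw [map_pow, ← hK.spectral_theorem]
  rw [h1, Unitary.conjStarAlgAut_apply, Matrix.trace_mul_cycle, Unitary.coe_star_mul_self,
    one_mul, Matrix.diagonal_pow, Matrix.trace_diagonal]
  simp

open scoped MatrixOrder in
/-- Newton's identity `Tr (A³) = 3 e₃` for the trace-free operator `A = G⁻¹ h`. -/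
lemma trace_cube_eq_esymm {G h : Matrix (Fin n) (Fin n) ℝ} (hG : G.PosSemidef) (hdet : G.det ≠ 0)
    (hh : h.IsHermitian) (ht : (G⁻¹ * h).trace = 0) :
    ((G⁻¹ * h) ^ 3).trace = 3 * (G⁻¹ * h).charpoly.roots.esymm 3 := by
  -- The matrix G⁻¹h need not be symmetric, but the factorization G = BᴴB makes it similar to the
  -- symmetric matrix `K`. So its characteristic polynomial splits over ℝ, and its roots are the
  -- eigenvalues of `K`.
  obtain ⟨B, hB⟩ : ∃ B : Matrix (Fin n) (Fin n) ℝ, G = Bᴴ * B :=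
    CStarAlgebra.nonneg_iff_eq_star_mul_self.mp (Matrix.nonneg_iff_posSemidef.mpr hG)
  have hBdet : IsUnit B.det := by
    rw [isUnit_iff_ne_zero]
    intro h0
    rw [hB, Matrix.det_mul, h0, mul_zero] at hdet
    exact hdet rfl
  let K := (B⁻¹)ᴴ * h * B⁻¹
  have hK : K.IsHermitian := Matrix.isHermitian_conjTranspose_mul_mul _ hh
  have hA : G⁻¹ * h = B⁻¹ * (K * B) := by
    rw [hB, Matrix.mul_inv_rev, ← Matrix.conjTranspose_nonsing_inv]
    simp only [K, Matrix.mul_assoc, Matrix.nonsing_inv_mul B hBdet, Matrix.mul_one]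
  have hKB : K * B * B⁻¹ = K := by
    rw [Matrix.mul_assoc, Matrix.mul_nonsing_inv B hBdet, Matrix.mul_one]
  have hchar : (G⁻¹ * h).charpoly = K.charpoly := by
    rw [hA, Matrix.charpoly_mul_comm, hKB]
  have htr1 : K.trace = 0 := by
    rw [← ht, hA, Matrix.trace_mul_comm B⁻¹ (K * B), hKB]
  have hcube : (G⁻¹ * h) ^ 3 = B⁻¹ * (K ^ 3 * B) := by
    have hBB : B * B⁻¹ = 1 := Matrix.mul_nonsing_inv B hBdet
    have e : ∀ C : Matrix (Fin n) (Fin n) ℝ, B * (B⁻¹ * C) = C := fun C => by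
      rw [← Matrix.mul_assoc, hBB, Matrix.one_mul]
    rw [hA]
    simp only [pow_succ, pow_zero, one_mul, Matrix.mul_assoc, e]
  have htr3 : ((G⁻¹ * h) ^ 3).trace = (K ^ 3).trace := by
    rw [hcube, Matrix.trace_mul_comm, Matrix.mul_assoc, Matrix.mul_nonsing_inv B hBdet,
      Matrix.mul_one]
  have h1 := trace_pow_eq_sum_eigenvalues hK 1
  rw [pow_one, htr1] at h1
  rw [htr3, hchar, hK.roots_charpoly_eq_eigenvalues, trace_pow_eq_sum_eigenvalues hK,
    sum_cube_eq_esymm _ (by simpa using h1.symm)]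
  rfl

end Newton

/-! ### Pointwise formulas -/

section Pointwise

open ContinuousLinearMap

variable {n : ℕ} {M : Type*} [TopologicalSpace M]
  [ChartedSpace (EuclideanSpace ℝ (Fin n)) M] [IsManifold (𝓡 n) ∞ M]
  {x ν : M → EuclideanSpace ℝ (Fin (n + 2))}

lemma exists_isPatch_center (hx : IsSphereHypersurface n x) (hν : IsUnitNormal n x ν) (p : M) :
    ∃ V ξ, center n p ∈ V ∧ IsPatch (param n x p) ξ V ∧ ξ (center n p) = ν p ∧
      ambientShape n x ν p = fieldShape (param n x p) ξ (center n p) := by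
  obtain ⟨V, ξ, -, hpV, hpatch, hξ, -⟩ := exists_frame hx hν p
  exact ⟨V, ξ, hpV, hpatch, hξ, ambientShape_eq hpatch hpV hξ⟩

lemma param_center (x : M → EuclideanSpace ℝ (Fin (n + 2))) (p : M) :
    param n x p (center n p) = x p := by
  rw [param, symm_center]

/-- The coordinate matrix is that of `pinv L ∘ A ∘ L`, whose powers telescope because A takes
tangent values; cyclicity removes the two outer factors. -/
lemma trace_shapeOperator (hx : IsSphereHypersurface n x) (hν : IsUnitNormal n x ν) (p : M) :
    (shapeOperator n x ν p).trace = traceCLM _ (ambientShape n x ν p) ∧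
    (shapeOperator n x ν p ^ 2).trace =
      traceCLM _ (ambientShape n x ν p ∘L ambientShape n x ν p) ∧
    (shapeOperator n x ν p ^ 3).trace = traceCLM _ (ambientShape n x ν p ∘L
      ambientShape n x ν p ∘L ambientShape n x ν p) := by
  obtain ⟨V, ξ, hpV, h, hξ, hA⟩ := exists_isPatch_center hx hν p
  have e0 : ∀ B : Matrix (Fin n) (Fin n) ℝ, B ^ 3 = B * B * B := fun B => by
    rw [pow_succ, pow_two]
  rw [hA, shapeOperator_eq h hpV hξ, e0, pow_two, ← opMatrix_comp, ← opMatrix_comp]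
  simp only [trace_opMatrix]
  set L := fderiv ℝ (param n x p) (center n p)
  set A := fieldShape (param n x p) ξ (center n p)
  have e : A ∘L L ∘L pinv L = A := by ext1 v; simp [L, A, h.shape_proj hpV]
  have e2 : (pinv L ∘L A ∘L L) ∘L (pinv L ∘L A ∘L L) = pinv L ∘L (A ∘L A) ∘L L := by
    ext1 v; simp [L, A, h.proj_shape hpV]
  have e3 : (pinv L ∘L (A ∘L A) ∘L L) ∘L (pinv L ∘L A ∘L L) = pinv L ∘L (A ∘L A ∘L A) ∘L L := by
    ext1 v; simp [L, A, h.proj_shape hpV]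
  rw [e2, e3]
  refine ⟨?_, ?_, ?_⟩ <;> rw [traceCLM_comp_comm] <;> simp only [comp_assoc, e]

lemma isHermitian_secondFundamentalForm (hx : IsSphereHypersurface n x)
    (hν : IsUnitNormal n x ν) (p : M) : (secondFundamentalForm n x ν p).IsHermitian := by
  obtain ⟨V, ξ, hpV, h, hξ, hA⟩ := exists_isPatch_center hx hν p
  have hsa : adjoint (fieldShape (param n x p) ξ (center n p)) =
      fieldShape (param n x p) ξ (center n p) := by
    ext1 v
    apply ext_inner_right ℝ
    intro w
    rw [adjoint_inner_left, h.inner_shape_left hpV]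
  rw [Matrix.IsHermitian, Matrix.conjTranspose_eq_transpose_of_trivial,
    secondFundamentalForm_eq h hpV hξ, ← opMatrix_adjoint, adjoint_comp, adjoint_comp,
    adjoint_adjoint, hsa, comp_assoc]

lemma traceShapeCube_eq (hn : 3 ≤ n) (hx : IsSphereHypersurface n x) (hν : IsUnitNormal n x ν)
    {p : M} (hmin : meanCurvature n x ν p = 0) :
    traceShapeCube n x ν p = 3 * (n.choose 3 : ℝ) * thirdMeanCurvature n x ν p := by
  have hn0 : (n : ℝ) ≠ 0 := by positivity
  have hc : (n.choose 3 : ℝ) ≠ 0 := by exact_mod_cast (Nat.choose_pos hn).ne'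
  have ht : (shapeOperator n x ν p).trace = 0 := by
    rw [meanCurvature, div_eq_zero_iff] at hmin
    exact hmin.resolve_right hn0
  have hG : (metricAt n x p).det ≠ 0 :=
    (det_gram_pos (X := param n x p) (hx.injective_center p)).ne'
  have := trace_cube_eq_esymm (posSemidef_gram (param n x p) (center n p)) hG
    (isHermitian_secondFundamentalForm hx hν p) ht
  rw [thirdMeanCurvature, traceShapeCube, mul_assoc, mul_div_cancel₀ _ hc]
  exact this

lemma scalarCurvature_eq (hx : IsSphereHypersurface n x) (hν : IsUnitNormal n x ν) (p : M) :
    scalarCurvature n x p = traceCLM _ (ambientShape n x ν p) ^ 2 + (n : ℝ) * ((n : ℝ) - 1)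
      - traceCLM _ (ambientShape n x ν p ∘L ambientShape n x ν p) := by
  obtain ⟨V, ξ, hpV, h, hξ, hA⟩ := exists_isPatch_center hx hν p
  rw [hA, ← h.trace_inv_gram_mul_ricci hpV]
  rfl

lemma tangentComponent_eq (hx : IsSphereHypersurface n x) (a : EuclideanSpace ℝ (Fin (n + 2)))
    (p : M) : tangentComponent n x a p =
      (pinv (fderiv ℝ (param n x p) (center n p)) a).ofLp := by
  have e : metricAt n x p = gram (param n x p) (center n p) := rfl
  have e2 : (fun j => ⟪a, partialDeriv j (param n x p) (extChartAt (𝓡 n) p p)⟫) =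
      (adjoint (fderiv ℝ (param n x p) (center n p)) a).ofLp := by
    funext j
    rw [apply_eq_inner_single, adjoint_inner_right, real_inner_comm]
    rfl
  rw [tangentComponent, e, gram_inv (hx.injective_center p), e2, opMatrix_mulVec]
  rfl

lemma dotProduct_opMatrix_mulVec (T : EuclideanSpace ℝ (Fin n) →L[ℝ] EuclideanSpace ℝ (Fin n))
    (u : EuclideanSpace ℝ (Fin n)) : u.ofLp ⬝ᵥ (opMatrix T *ᵥ u.ofLp) = ⟪u, T u⟫ := by
  rw [opMatrix_mulVec, real_inner_comm, EuclideanSpace.inner_eq_star_dotProduct]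
  simp

/-- In the Gauss equation the term (n-1)g cancels against the same constant in R/n; only terms
quadratic in A survive. -/
lemma einsteinDefect_eq (hn : n ≠ 0) (hx : IsSphereHypersurface n x) (hν : IsUnitNormal n x ν)
    (a : EuclideanSpace ℝ (Fin (n + 2))) (p : M) :
    einsteinDefect n x a p =
      traceCLM _ (ambientShape n x ν p) * ⟪ambientShape n x ν p a, a⟫
      - ⟪ambientShape n x ν p a, ambientShape n x ν p a⟫
      - (traceCLM _ (ambientShape n x ν p) ^ 2
          - traceCLM _ (ambientShape n x ν p ∘L ambientShape n x ν p)) / n *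
        (⟪a, a⟫ - ⟪a, x p⟫ ^ 2 - ⟪a, ν p⟫ ^ 2) := by
  have hn0 : (n : ℝ) ≠ 0 := Nat.cast_ne_zero.mpr hn
  have hR := scalarCurvature_eq hx hν p
  obtain ⟨V, ξ, hpV, h, hξ, hA⟩ := exists_isPatch_center hx hν p
  have e1 : ricciAt n x p = ricci (param n x p) (center n p) := rfl
  have e2 : metricAt n x p = gram (param n x p) (center n p) := rfl
  have hxp := param_center x p
  rw [einsteinDefect, tangentComponent_eq hx, e1, e2, h.ricci_eq_opMatrix hpV, gram_eq,
    Matrix.sub_mulVec, Matrix.smul_mulVec, dotProduct_sub, dotProduct_smul,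
    dotProduct_opMatrix_mulVec, dotProduct_opMatrix_mulVec, inner_gramOp, comp_apply,
    adjoint_inner_right, hR, hA]
  simp only [comp_apply, sub_apply, add_apply, smul_apply, id_apply, h.shape_proj hpV,
    inner_sub_right, inner_add_right, inner_smul_right]
  rw [real_inner_comm (fieldShape _ _ _ (fieldShape _ _ _ a)), ← h.inner_shape_eq hpV,
    real_inner_comm (fieldShape _ _ _ a), ← h.inner_shape_eq hpV,
    inner_map_pinv (h.injective _ hpV), h.inner_shape_left hpV (fieldShape _ _ _ a),
    h.proj_eq hpV, hξ, hxp, inner_sub_left, inner_sub_left, inner_smul_left, inner_smul_left]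
  simp only [conj_trivial, smul_eq_mul, real_inner_comm]
  field_simp
  ring

lemma isTangentField_of_proj {W : M → EuclideanSpace ℝ (Fin (n + 2))}
    (hW : ∀ p, fderiv ℝ (param n x p) (center n p)
      (pinv (fderiv ℝ (param n x p) (center n p)) (W p)) = W p) : IsTangentField n x W :=
  fun p => ⟨_, hW p⟩

end Pointwise

/-! ### Integral formulas -/

section Integrals

open ContinuousLinearMap

variable {n : ℕ}

/-- The type of a position, a normal vector and a shape operator. -/
abbrev Jet (n : ℕ) : Type :=
  EuclideanSpace ℝ (Fin (n + 2)) × EuclideanSpace ℝ (Fin (n + 2)) ×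
    (EuclideanSpace ℝ (Fin (n + 2)) →L[ℝ] EuclideanSpace ℝ (Fin (n + 2)))

lemma contDiff_jet_position : ContDiff ℝ ∞ fun z : Jet n => z.1 := contDiff_fst

lemma contDiff_jet_normal : ContDiff ℝ ∞ fun z : Jet n => z.2.1 := contDiff_fst.comp contDiff_snd

lemma contDiff_jet_shape : ContDiff ℝ ∞ fun z : Jet n => z.2.2 := contDiff_snd.comp contDiff_snd

lemma contDiff_jet_height (a : EuclideanSpace ℝ (Fin (n + 2))) :
    ContDiff ℝ ∞ fun z : Jet n => ⟪a, z.1⟫ := contDiff_const.inner ℝ contDiff_jet_position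

lemma contDiff_jet_height_normal (a : EuclideanSpace ℝ (Fin (n + 2))) :
    ContDiff ℝ ∞ fun z : Jet n => ⟪a, z.2.1⟫ := contDiff_const.inner ℝ contDiff_jet_normal

lemma contDiff_jet_trace :
    ContDiff ℝ ∞ fun z : Jet n => traceCLM (EuclideanSpace ℝ (Fin (n + 2))) z.2.2 :=
  (traceCLM _).contDiff.comp contDiff_jet_shape

lemma contDiff_jet_trace_sq :
    ContDiff ℝ ∞ fun z : Jet n => traceCLM (EuclideanSpace ℝ (Fin (n + 2))) (z.2.2 ∘L z.2.2) :=
  (traceCLM _).contDiff.comp (contDiff_jet_shape.clm_comp contDiff_jet_shape)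

lemma contDiff_jet_trace_cube : ContDiff ℝ ∞ fun z : Jet n =>
    traceCLM (EuclideanSpace ℝ (Fin (n + 2))) (z.2.2 ∘L z.2.2 ∘L z.2.2) :=
  (traceCLM _).contDiff.comp
    (contDiff_jet_shape.clm_comp (contDiff_jet_shape.clm_comp contDiff_jet_shape))

lemma contDiff_jet_shape_apply (a : EuclideanSpace ℝ (Fin (n + 2))) :
    ContDiff ℝ ∞ fun z : Jet n => z.2.2 a := contDiff_jet_shape.clm_apply contDiff_const

lemma contDiff_jet_tangent (a : EuclideanSpace ℝ (Fin (n + 2))) :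
    ContDiff ℝ ∞ fun z : Jet n => a - ⟪a, z.1⟫ • z.1 - ⟪a, z.2.1⟫ • z.2.1 :=
  (contDiff_const.sub ((contDiff_jet_height a).smul contDiff_jet_position)).sub
    ((contDiff_jet_height_normal a).smul contDiff_jet_normal)

variable {M : Type*} [TopologicalSpace M]
  [ChartedSpace (EuclideanSpace ℝ (Fin n)) M] [IsManifold (𝓡 n) ∞ M] [CompactSpace M]
  [MeasurableSpace M] [BorelSpace M] {x ν : M → EuclideanSpace ℝ (Fin (n + 2))}

/-- Evenness makes the function continuous although `ν` may not be, and `M` is compact with finite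
volume. -/
lemma integrable_of_even (hx : IsSphereHypersurface n x) (hν : IsUnitNormal n x ν)
    {f : Jet n → ℝ} (hf : ContDiff ℝ ∞ f) (heven : ∀ X N A, f (X, -N, -A) = f (X, N, A)) :
    Integrable (fun p => f (x p, ν p, ambientShape n x ν p)) (volumeMeasure n x) := by
  have := isFiniteMeasure_volumeMeasure (x := x) hx.contMDiff
  exact (contMDiff_of_even hx hν (Φ := fun X N A => f (X, N, A)) hf
    heven).continuous.integrable_of_hasCompactSupport (HasCompactSupport.of_compactSpace _)

/-- The divergence theorem for an even tangent field, reduced to a pointwise formula on patches. The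
relation with `ambientShape` is passed to `hg` so that global conditions on its traces are available
on the patch. -/
lemma integral_divergence_of_even [T2Space M] (hx : IsSphereHypersurface n x)
    (hν : IsUnitNormal n x ν) {Φ : Jet n → EuclideanSpace ℝ (Fin (n + 2))} (hΦ : ContDiff ℝ ∞ Φ)
    (heven : ∀ X N A, Φ (X, -N, -A) = Φ (X, N, A))
    (htan : ∀ {X ξ : EuclideanSpace ℝ (Fin n) → EuclideanSpace ℝ (Fin (n + 2))}
      {U : Set (EuclideanSpace ℝ (Fin n))}, IsPatch X ξ U → ∀ y ∈ U,
      fderiv ℝ X y (pinv (fderiv ℝ X y) (Φ (X y, ξ y, fieldShape X ξ y))) =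
        Φ (X y, ξ y, fieldShape X ξ y))
    {g : Jet n → ℝ}
    (hg : ∀ p V ξ, center n p ∈ V → V ⊆ (extChartAt (𝓡 n) p).target →
      (h : IsPatch (param n x p) ξ V) →
      (∀ y ∈ V, ∃ c : ℝ, (c = 1 ∨ c = -1) ∧ ambientShape n x ν ((extChartAt (𝓡 n) p).symm y) =
        c • fieldShape (param n x p) ξ y) →
      surfaceDiv (param n x p)
        (fun z => Φ (param n x p z, ξ z, fieldShape (param n x p) ξ z)) (center n p) =
      g (param n x p (center n p), ξ (center n p), fieldShape (param n x p) ξ (center n p))) :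
    ∫ p, g (x p, ν p, ambientShape n x ν p) ∂(volumeMeasure n x) = 0 := by
  have hdiv := integral_divergence_eq_zero hx
    (contMDiff_of_even hx hν (Φ := fun X N A => Φ (X, N, A)) hΦ heven) <|
    isTangentField_of_proj fun p => by
      obtain ⟨V, ξ, hpV, h, hξ, hA⟩ := exists_isPatch_center hx hν p
      have := htan h _ hpV
      rw [param_center, hξ, ← hA] at this
      exact this
  rw [← hdiv]
  congr 1
  funext p
  obtain ⟨V, ξ, hVt, hpV, hpatch, hξ, hframe⟩ := exists_frame hx hν p
  rw [divergence_of_even (Φ := fun X N A => Φ (X, N, A)) heven hpV hpatch hframe,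
    hg p V ξ hpV hVt hpatch fun y hy => ?_, param_center, hξ, ambientShape_eq hpatch hpV hξ]
  obtain ⟨c, hc, -, h2⟩ := hframe y hy
  exact ⟨c, hc, h2⟩

lemma IsPatch.proj_tangent {X ξ : EuclideanSpace ℝ (Fin n) → EuclideanSpace ℝ (Fin (n + 2))}
    {U : Set (EuclideanSpace ℝ (Fin n))} (h : IsPatch X ξ U) {y : EuclideanSpace ℝ (Fin n)}
    (hy : y ∈ U) (a : EuclideanSpace ℝ (Fin (n + 2))) :
    fderiv ℝ X y (pinv (fderiv ℝ X y) (a - ⟪a, X y⟫ • X y - ⟪a, ξ y⟫ • ξ y)) =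
      a - ⟪a, X y⟫ • X y - ⟪a, ξ y⟫ • ξ y := by
  simp only [map_smul, map_sub, h.pinv_position hy, h.pinv_normal hy, smul_zero, sub_zero,
    h.proj_eq hy]
  simp only [real_inner_comm]

variable [T2Space M]

lemma integral_height_tangent (hx : IsSphereHypersurface n x) (hν : IsUnitNormal n x ν)
    (a : EuclideanSpace ℝ (Fin (n + 2))) :
    ∫ p, (⟪a, a⟫ - ⟪a, x p⟫ ^ 2 - ⟪a, ν p⟫ ^ 2 - n * ⟪a, x p⟫ ^ 2
        + traceCLM _ (ambientShape n x ν p) * ⟪a, x p⟫ * ⟪a, ν p⟫) ∂(volumeMeasure n x) = 0 :=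
  integral_divergence_of_even hx hν
    (Φ := fun z => ⟪a, z.1⟫ • (a - ⟪a, z.1⟫ • z.1 - ⟪a, z.2.1⟫ • z.2.1))
    (g := fun z => ⟪a, a⟫ - ⟪a, z.1⟫ ^ 2 - ⟪a, z.2.1⟫ ^ 2 - n * ⟪a, z.1⟫ ^ 2
        + traceCLM _ z.2.2 * ⟪a, z.1⟫ * ⟪a, z.2.1⟫)
    ((contDiff_jet_height a).smul (contDiff_jet_tangent a)) (fun X N A => by simp)
    (fun h y hy => by simp only [map_smul, h.proj_tangent hy])
    (fun p V ξ hpV _ h _ => by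
      rw [h.surfaceDiv_height_tangent hpV, finrank_euclideanSpace_fin])

/-- The field is ψ times the first Newton transformation Tr(A) - A applied to aᵀ; both factors are
odd in (ν, A), so their product is even. -/
lemma integral_newton (hx : IsSphereHypersurface n x) (hν : IsUnitNormal n x ν)
    (a : EuclideanSpace ℝ (Fin (n + 2))) :
    ∫ p, (-(traceCLM _ (ambientShape n x ν p) * ⟪ambientShape n x ν p a, a⟫)
      + ⟪ambientShape n x ν p a, ambientShape n x ν p a⟫
      - ((n : ℝ) - 1) * (traceCLM _ (ambientShape n x ν p) * ⟪a, x p⟫ * ⟪a, ν p⟫)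
      + (traceCLM _ (ambientShape n x ν p) ^ 2
          - traceCLM _ (ambientShape n x ν p ∘L ambientShape n x ν p)) * ⟪a, ν p⟫ ^ 2)
      ∂(volumeMeasure n x) = 0 :=
  integral_divergence_of_even hx hν
    (Φ := fun z => ⟪a, z.2.1⟫ • (traceCLM (EuclideanSpace ℝ (Fin (n + 2))) z.2.2 •
      (a - ⟪a, z.1⟫ • z.1 - ⟪a, z.2.1⟫ • z.2.1) - z.2.2 a))
    (g := fun z => -(traceCLM _ z.2.2 * ⟪z.2.2 a, a⟫) + ⟪z.2.2 a, z.2.2 a⟫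
      - ((n : ℝ) - 1) * (traceCLM _ z.2.2 * ⟪a, z.1⟫ * ⟪a, z.2.1⟫)
      + (traceCLM _ z.2.2 ^ 2 - traceCLM _ (z.2.2 ∘L z.2.2)) * ⟪a, z.2.1⟫ ^ 2)
    ((contDiff_jet_height_normal a).smul ((contDiff_jet_trace.smul (contDiff_jet_tangent a)).sub
      (contDiff_jet_shape_apply a)))
    (fun X N A => by
      simp only [inner_neg_right, map_neg, neg_smul, smul_neg, neg_neg, neg_apply]
      rw [← smul_neg]
      congr 1
      abel)
    (fun h y hy => by
      simp only
      rw [map_smul, map_smul, map_sub, map_sub, map_smul (pinv _), map_smul (fderiv ℝ _ y),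
        h.proj_tangent hy, h.proj_shape hy])
    (fun p V ξ hpV _ h _ => by
      rw [h.surfaceDiv_newton hpV, finrank_euclideanSpace_fin])

lemma integral_shape_sq (hx : IsSphereHypersurface n x) (hν : IsUnitNormal n x ν) {S : ℝ}
    (hT : ∀ p, traceCLM _ (ambientShape n x ν p) = 0)
    (hS : ∀ p, traceCLM _ (ambientShape n x ν p ∘L ambientShape n x ν p) = S)
    (a : EuclideanSpace ℝ (Fin (n + 2))) :
    ∫ p, (⟪ambientShape n x ν p a, ambientShape n x ν p a⟫ - S * ⟪a, x p⟫ ^ 2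
      + ⟪a, x p⟫ * ⟪a, ν p⟫ * traceCLM _ (ambientShape n x ν p ∘L
        ambientShape n x ν p ∘L ambientShape n x ν p)) ∂(volumeMeasure n x) = 0 :=
  integral_divergence_of_even hx hν
    (Φ := fun z => ⟪a, z.1⟫ • z.2.2 (z.2.2 a))
    (g := fun z => ⟪z.2.2 a, z.2.2 a⟫ - S * ⟪a, z.1⟫ ^ 2
      + ⟪a, z.1⟫ * ⟪a, z.2.1⟫ * traceCLM _ (z.2.2 ∘L z.2.2 ∘L z.2.2))
    ((contDiff_jet_height a).smul (contDiff_jet_shape.clm_apply (contDiff_jet_shape_apply a)))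
    (fun X N A => by simp)
    (fun h y hy => by simp only [map_smul, h.proj_shape hy])
    (fun p V ξ hpV _ h hframe => by
      -- Passing to the local normal multiplies Tr A by ±1 and Tr A² by 1, so the values 0 and `S`
      -- persist on the whole patch.
      rw [h.surfaceDiv_sq hpV (T := 0) (S := S) ?_ ?_]
      · intro z hz
        obtain ⟨c, hc, h1⟩ := hframe z hz
        have h2 := hT ((extChartAt (𝓡 n) p).symm z)
        rw [h1, map_smul, smul_eq_mul] at h2
        rcases hc with rfl | rfl <;> linarith
      · intro z hz
        obtain ⟨c, hc, h1⟩ := hframe z hz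
        have h2 := hS ((extChartAt (𝓡 n) p).symm z)
        rw [h1, smul_comp, comp_smul, map_smul, map_smul, smul_eq_mul, smul_eq_mul] at h2
        rcases hc with rfl | rfl <;> linarith)

end Integrals

/-! ### Integrals of the Einstein defect -/

section IntegralEinstein

open ContinuousLinearMap

variable {n : ℕ} {M : Type*} [TopologicalSpace M]
  [ChartedSpace (EuclideanSpace ℝ (Fin n)) M] [IsManifold (𝓡 n) ∞ M] [CompactSpace M]
  {x ν : M → EuclideanSpace ℝ (Fin (n + 2))}

lemma sqNormShape_eq (hx : IsSphereHypersurface n x) (hν : IsUnitNormal n x ν) (p : M) :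
    sqNormShape n x ν p = traceCLM _ (ambientShape n x ν p ∘L ambientShape n x ν p) :=
  (trace_shapeOperator hx hν p).2.1

lemma nat_mul_meanCurvature (hn : n ≠ 0) (hx : IsSphereHypersurface n x)
    (hν : IsUnitNormal n x ν) (p : M) :
    n * meanCurvature n x ν p = traceCLM _ (ambientShape n x ν p) := by
  rw [meanCurvature, mul_div_cancel₀ _ (Nat.cast_ne_zero.mpr hn)]
  exact (trace_shapeOperator hx hν p).1

lemma normalizedScalarCurvature_sub_one (hn : n ≠ 0) (hn1 : (n : ℝ) - 1 ≠ 0)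
    (hx : IsSphereHypersurface n x) (hν : IsUnitNormal n x ν) (p : M) :
    normalizedScalarCurvature n x p - 1 =
      ((n : ℝ) ^ 2 * meanCurvature n x ν p ^ 2 - sqNormShape n x ν p) /
        ((n : ℝ) * ((n : ℝ) - 1)) := by
  have hn0 : (n : ℝ) ≠ 0 := Nat.cast_ne_zero.mpr hn
  rw [normalizedScalarCurvature, scalarCurvature_eq hx hν, ← mul_pow,
    nat_mul_meanCurvature hn hx hν, sqNormShape_eq hx hν]
  field_simp
  ring

variable [MeasurableSpace M] [BorelSpace M]

lemma integrable_height_sq (hx : IsSphereHypersurface n x) (hν : IsUnitNormal n x ν)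
    (a : EuclideanSpace ℝ (Fin (n + 2))) :
    Integrable (fun p => height x a p ^ 2) (volumeMeasure n x) := by
  simp only [height, real_inner_comm a]
  exact integrable_of_even hx hν (f := fun z : Jet n => ⟪a, z.1⟫ ^ 2)
    ((contDiff_jet_height a).pow 2) (fun X N A => rfl)

lemma integrable_height_normal_sq (hx : IsSphereHypersurface n x) (hν : IsUnitNormal n x ν)
    (a : EuclideanSpace ℝ (Fin (n + 2))) :
    Integrable (fun p => height ν a p ^ 2) (volumeMeasure n x) := by
  simp only [height, real_inner_comm a]
  exact integrable_of_even hx hν (f := fun z : Jet n => ⟪a, z.2.1⟫ ^ 2)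
    ((contDiff_jet_height_normal a).pow 2) (fun X N A => by simp)

lemma integrable_one_sub_heights (hx : IsSphereHypersurface n x) (hν : IsUnitNormal n x ν)
    (a : EuclideanSpace ℝ (Fin (n + 2))) (b c : ℝ) :
    Integrable (fun p => 1 - b * height x a p ^ 2 - c * height ν a p ^ 2)
      (volumeMeasure n x) := by
  have := isFiniteMeasure_volumeMeasure (x := x) hx.contMDiff
  exact ((integrable_const 1).sub ((integrable_height_sq hx hν a).const_mul b)).sub
    ((integrable_height_normal_sq hx hν a).const_mul c)

lemma integral_one_sub_heights (hx : IsSphereHypersurface n x) (hν : IsUnitNormal n x ν)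
    (a : EuclideanSpace ℝ (Fin (n + 2))) (b c : ℝ) :
    ∫ p, (1 - b * height x a p ^ 2 - c * height ν a p ^ 2) ∂(volumeMeasure n x) =
      (volumeMeasure n x).real Set.univ - b * (∫ p, height x a p ^ 2 ∂(volumeMeasure n x))
        - c * ∫ p, height ν a p ^ 2 ∂(volumeMeasure n x) := by
  have := isFiniteMeasure_volumeMeasure (x := x) hx.contMDiff
  have h1 := (integrable_height_sq hx hν a).const_mul b
  have h2 := (integrable_height_normal_sq hx hν a).const_mul c
  have h3 : Integrable (fun p => 1 - b * height x a p ^ 2) (volumeMeasure n x) :=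
    (integrable_const 1).sub h1
  rw [integral_sub h3 h2, integral_sub (integrable_const 1) h1,
    integral_const_mul, integral_const_mul, integral_const, smul_eq_mul, mul_one]

lemma integrable_inner_shape_shape (hx : IsSphereHypersurface n x) (hν : IsUnitNormal n x ν)
    (a : EuclideanSpace ℝ (Fin (n + 2))) :
    Integrable (fun p => ⟪ambientShape n x ν p a, ambientShape n x ν p a⟫)
      (volumeMeasure n x) :=
  integrable_of_even hx hν (f := fun z : Jet n => ⟪z.2.2 a, z.2.2 a⟫)
    ((contDiff_jet_shape_apply a).inner ℝ (contDiff_jet_shape_apply a)) (fun X N A => by simp)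

lemma integrable_height_tangent (hx : IsSphereHypersurface n x) (hν : IsUnitNormal n x ν)
    (a : EuclideanSpace ℝ (Fin (n + 2))) :
    Integrable (fun p => ⟪a, a⟫ - ⟪a, x p⟫ ^ 2 - ⟪a, ν p⟫ ^ 2 - n * ⟪a, x p⟫ ^ 2
        + traceCLM _ (ambientShape n x ν p) * ⟪a, x p⟫ * ⟪a, ν p⟫) (volumeMeasure n x) :=
  integrable_of_even hx hν
    (f := fun z : Jet n => ⟪a, a⟫ - ⟪a, z.1⟫ ^ 2 - ⟪a, z.2.1⟫ ^ 2 - n * ⟪a, z.1⟫ ^ 2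
        + traceCLM _ z.2.2 * ⟪a, z.1⟫ * ⟪a, z.2.1⟫)
    ((((contDiff_const.sub ((contDiff_jet_height a).pow 2)).sub
      ((contDiff_jet_height_normal a).pow 2)).sub
        (contDiff_const.mul ((contDiff_jet_height a).pow 2))).add
      ((contDiff_jet_trace.mul (contDiff_jet_height a)).mul (contDiff_jet_height_normal a)))
    (fun X N A => by simp)

lemma integrable_newton (hx : IsSphereHypersurface n x) (hν : IsUnitNormal n x ν)
    (a : EuclideanSpace ℝ (Fin (n + 2))) :
    Integrable (fun p => -(traceCLM _ (ambientShape n x ν p) * ⟪ambientShape n x ν p a, a⟫)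
      + ⟪ambientShape n x ν p a, ambientShape n x ν p a⟫
      - ((n : ℝ) - 1) * (traceCLM _ (ambientShape n x ν p) * ⟪a, x p⟫ * ⟪a, ν p⟫)
      + (traceCLM _ (ambientShape n x ν p) ^ 2
          - traceCLM _ (ambientShape n x ν p ∘L ambientShape n x ν p)) * ⟪a, ν p⟫ ^ 2)
      (volumeMeasure n x) :=
  integrable_of_even hx hν
    (f := fun z : Jet n => -(traceCLM _ z.2.2 * ⟪z.2.2 a, a⟫) + ⟪z.2.2 a, z.2.2 a⟫
      - ((n : ℝ) - 1) * (traceCLM _ z.2.2 * ⟪a, z.1⟫ * ⟪a, z.2.1⟫)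
      + (traceCLM _ z.2.2 ^ 2 - traceCLM _ (z.2.2 ∘L z.2.2)) * ⟪a, z.2.1⟫ ^ 2)
    (((((contDiff_jet_trace.mul ((contDiff_jet_shape_apply a).inner ℝ contDiff_const)).neg.add
      ((contDiff_jet_shape_apply a).inner ℝ (contDiff_jet_shape_apply a))).sub
      (contDiff_const.mul ((contDiff_jet_trace.mul (contDiff_jet_height a)).mul
        (contDiff_jet_height_normal a)))).add
      (((contDiff_jet_trace.pow 2).sub contDiff_jet_trace_sq).mul
        ((contDiff_jet_height_normal a).pow 2))))
    (fun X N A => by simp)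

lemma integrable_curvature_mul (hx : IsSphereHypersurface n x) (hν : IsUnitNormal n x ν)
    (a : EuclideanSpace ℝ (Fin (n + 2))) (c : ℝ) :
    Integrable (fun p => (traceCLM _ (ambientShape n x ν p) ^ 2
          - traceCLM _ (ambientShape n x ν p ∘L ambientShape n x ν p)) *
        (1 - ⟪a, x p⟫ ^ 2 - c * ⟪a, ν p⟫ ^ 2))
      (volumeMeasure n x) :=
  integrable_of_even hx hν
    (f := fun z : Jet n => (traceCLM _ z.2.2 ^ 2 - traceCLM _ (z.2.2 ∘L z.2.2)) *
      (1 - ⟪a, z.1⟫ ^ 2 - c * ⟪a, z.2.1⟫ ^ 2))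
    (((contDiff_jet_trace.pow 2).sub contDiff_jet_trace_sq).mul
      ((contDiff_const.sub ((contDiff_jet_height a).pow 2)).sub
        (contDiff_const.mul ((contDiff_jet_height_normal a).pow 2))))
    (fun X N A => by simp)

lemma integrable_heights_mul_traceShapeCube (hx : IsSphereHypersurface n x)
    (hν : IsUnitNormal n x ν) (a : EuclideanSpace ℝ (Fin (n + 2))) :
    Integrable (fun p => height x a p * height ν a p * traceShapeCube n x ν p)
      (volumeMeasure n x) := by
  simp only [height, real_inner_comm a, traceShapeCube, (trace_shapeOperator hx hν _).2.2]
  exact integrable_of_even hx hν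
    (f := fun z : Jet n => ⟪a, z.1⟫ * ⟪a, z.2.1⟫ * traceCLM _ (z.2.2 ∘L z.2.2 ∘L z.2.2))
    (((contDiff_jet_height a).mul (contDiff_jet_height_normal a)).mul contDiff_jet_trace_cube)
    (fun X N A => by simp)

variable [T2Space M]

/-- The identity `key` writes the difference of the integrands as minus the Newton divergence minus
n-1 times the divergence of φ aᵀ; both have integral zero. -/
lemma integral_einsteinDefect (hn : n ≠ 0) (hn1 : (n : ℝ) - 1 ≠ 0)
    (hx : IsSphereHypersurface n x) (hν : IsUnitNormal n x ν)
    {a : EuclideanSpace ℝ (Fin (n + 2))} (ha : ‖a‖ = 1) :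
    ∫ p, einsteinDefect n x a p ∂(volumeMeasure n x) = ((n : ℝ) - 1) *
      (∫ p, (1 - ((n : ℝ) + 1) * height x a p ^ 2 - height ν a p ^ 2) ∂(volumeMeasure n x) -
        ∫ p, (normalizedScalarCurvature n x p - 1) *
          (1 - height x a p ^ 2 - ((n : ℝ) + 1) * height ν a p ^ 2) ∂(volumeMeasure n x)) := by
  have hn0 : (n : ℝ) ≠ 0 := Nat.cast_ne_zero.mpr hn
  have haa : ⟪a, a⟫ = 1 := by rw [real_inner_self_eq_norm_sq, ha, one_pow]
  have hρ : ∀ p, normalizedScalarCurvature n x p - 1 =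
      ((n : ℝ) * ((n : ℝ) - 1))⁻¹ * (traceCLM _ (ambientShape n x ν p) ^ 2
        - traceCLM _ (ambientShape n x ν p ∘L ambientShape n x ν p)) := fun p => by
    rw [normalizedScalarCurvature_sub_one hn hn1 hx hν, ← mul_pow,
      nat_mul_meanCurvature hn hx hν, sqNormShape_eq hx hν, div_eq_inv_mul]
  have i1 : Integrable (fun p => 1 - ((n : ℝ) + 1) * height x a p ^ 2 - height ν a p ^ 2)
      (volumeMeasure n x) := by
    simpa only [one_mul] using integrable_one_sub_heights hx hν a ((n : ℝ) + 1) 1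
  have i2 := (integrable_curvature_mul hx hν a ((n : ℝ) + 1)).const_mul
    ((n : ℝ) * ((n : ℝ) - 1))⁻¹
  have i3 : Integrable (fun p => (normalizedScalarCurvature n x p - 1) *
      (1 - height x a p ^ 2 - ((n : ℝ) + 1) * height ν a p ^ 2)) (volumeMeasure n x) :=
    i2.congr (.of_forall fun p => by simp only [hρ, height, real_inner_comm a, mul_assoc])
  have i4 := integrable_newton hx hν a
  have i5 := (integrable_height_tangent hx hν a).const_mul ((n : ℝ) - 1)
  have key : ∀ p, einsteinDefect n x a p - ((n : ℝ) - 1) *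
      ((1 - ((n : ℝ) + 1) * height x a p ^ 2 - height ν a p ^ 2) -
        (normalizedScalarCurvature n x p - 1) *
          (1 - height x a p ^ 2 - ((n : ℝ) + 1) * height ν a p ^ 2)) =
      -(-(traceCLM _ (ambientShape n x ν p) * ⟪ambientShape n x ν p a, a⟫)
      + ⟪ambientShape n x ν p a, ambientShape n x ν p a⟫
      - ((n : ℝ) - 1) * (traceCLM _ (ambientShape n x ν p) * ⟪a, x p⟫ * ⟪a, ν p⟫)
      + (traceCLM _ (ambientShape n x ν p) ^ 2
          - traceCLM _ (ambientShape n x ν p ∘L ambientShape n x ν p)) * ⟪a, ν p⟫ ^ 2)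
      - ((n : ℝ) - 1) * (⟪a, a⟫ - ⟪a, x p⟫ ^ 2 - ⟪a, ν p⟫ ^ 2 - n * ⟪a, x p⟫ ^ 2
        + traceCLM _ (ambientShape n x ν p) * ⟪a, x p⟫ * ⟪a, ν p⟫) := fun p => by
    rw [einsteinDefect_eq hn hx hν, hρ, haa]
    simp only [height, real_inner_comm a]
    field_simp
    ring
  have i6 : Integrable (fun p => (1 - ((n : ℝ) + 1) * height x a p ^ 2 - height ν a p ^ 2) -
      (normalizedScalarCurvature n x p - 1) *
        (1 - height x a p ^ 2 - ((n : ℝ) + 1) * height ν a p ^ 2)) (volumeMeasure n x) :=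
    i1.sub i3
  rw [← integral_sub i1 i3, ← integral_const_mul, ← sub_eq_zero]
  -- Solve `key` for the defect: all other terms are already known to be integrable.
  have i8 : Integrable (einsteinDefect n x a) (volumeMeasure n x) :=
    ((i6.const_mul ((n : ℝ) - 1)).add (i4.neg.sub i5)).congr
      (.of_forall fun p => (sub_eq_iff_eq_add'.mp (key p)).symm)
  rw [← integral_sub i8 (i6.const_mul _)]
  simp only [key]
  rw [integral_sub i4.fun_neg i5, integral_neg, integral_const_mul, integral_newton hx hν a,
    integral_height_tangent hx hν a, mul_zero, neg_zero, sub_zero]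

lemma trace_eq_zero_of_isMinimal (hn : n ≠ 0) (hx : IsSphereHypersurface n x)
    (hν : IsUnitNormal n x ν) (hmin : IsMinimal n x ν) (p : M) :
    traceCLM _ (ambientShape n x ν p) = 0 := by
  rw [← nat_mul_meanCurvature hn hx hν, hmin p, mul_zero]

lemma integral_heights_of_isMinimal (hn : n ≠ 0) (hx : IsSphereHypersurface n x)
    (hν : IsUnitNormal n x ν) (hmin : IsMinimal n x ν) {a : EuclideanSpace ℝ (Fin (n + 2))}
    (ha : ‖a‖ = 1) :
    ∫ p, (1 - ((n : ℝ) + 1) * height x a p ^ 2 - height ν a p ^ 2) ∂(volumeMeasure n x) = 0 := by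
  have haa : ⟪a, a⟫ = 1 := by rw [real_inner_self_eq_norm_sq, ha, one_pow]
  rw [← integral_height_tangent hx hν a]
  congr 1
  funext p
  rw [trace_eq_zero_of_isMinimal hn hx hν hmin, haa, height, height, real_inner_comm a (x p),
    real_inner_comm a (ν p)]
  ring

lemma integral_einsteinDefect_of_isMinimal (hn : n ≠ 0) (hn1 : (n : ℝ) - 1 ≠ 0)
    (hx : IsSphereHypersurface n x) (hν : IsUnitNormal n x ν) (hmin : IsMinimal n x ν)
    {a : EuclideanSpace ℝ (Fin (n + 2))} (ha : ‖a‖ = 1) :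
    ∫ p, einsteinDefect n x a p ∂(volumeMeasure n x) = (n : ℝ)⁻¹ *
      ∫ p, sqNormShape n x ν p *
        (1 - height x a p ^ 2 - ((n : ℝ) + 1) * height ν a p ^ 2) ∂(volumeMeasure n x) := by
  have hn0 : (n : ℝ) ≠ 0 := Nat.cast_ne_zero.mpr hn
  rw [integral_einsteinDefect hn hn1 hx hν ha, integral_heights_of_isMinimal hn hx hν hmin ha,
    zero_sub, ← integral_neg, ← integral_const_mul, ← integral_const_mul]
  congr 1
  funext p
  rw [normalizedScalarCurvature_sub_one hn hn1 hx hν, hmin p]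
  field_simp
  ring

lemma integral_height_normal_sq_of_isMinimal (hn : n ≠ 0) (hx : IsSphereHypersurface n x)
    (hν : IsUnitNormal n x ν) (hmin : IsMinimal n x ν) {a : EuclideanSpace ℝ (Fin (n + 2))}
    (ha : ‖a‖ = 1) :
    ∫ p, height ν a p ^ 2 ∂(volumeMeasure n x) = (volumeMeasure n x).real Set.univ
      - ((n : ℝ) + 1) * ∫ p, height x a p ^ 2 ∂(volumeMeasure n x) := by
  have h1 := integral_heights_of_isMinimal hn hx hν hmin ha
  have h2 := integral_one_sub_heights hx hν a ((n : ℝ) + 1) 1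
  simp only [one_mul] at h2
  linarith

/-! ### Minimal hypersurfaces with constant S. -/

section ConstantSqNorm

variable {S : ℝ}

lemma integral_einsteinDefect_of_sqNormShape_const (hn : n ≠ 0) (hn1 : (n : ℝ) - 1 ≠ 0)
    (hx : IsSphereHypersurface n x) (hν : IsUnitNormal n x ν) (hmin : IsMinimal n x ν)
    (hS : ∀ p, sqNormShape n x ν p = S) {a : EuclideanSpace ℝ (Fin (n + 2))} (ha : ‖a‖ = 1) :
    ∫ p, einsteinDefect n x a p ∂(volumeMeasure n x) =
      S * (((n : ℝ) + 2) * (∫ p, height x a p ^ 2 ∂(volumeMeasure n x))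
        - (volumeMeasure n x).real Set.univ) := by
  have hn0 : (n : ℝ) ≠ 0 := Nat.cast_ne_zero.mpr hn
  have h2 := integral_one_sub_heights hx hν a 1 ((n : ℝ) + 1)
  simp only [one_mul] at h2
  rw [integral_einsteinDefect_of_isMinimal hn hn1 hx hν hmin ha]
  simp only [hS]
  rw [integral_const_mul, h2, integral_height_normal_sq_of_isMinimal hn hx hν hmin ha]
  field_simp
  ring

/-- The divergences of ψAa and of φA²a give two expressions for ∫|Aa|²; their comparison eliminates
it. -/
lemma integral_heights_mul_traceShapeCube (hn : n ≠ 0) (hx : IsSphereHypersurface n x)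
    (hν : IsUnitNormal n x ν) (hmin : IsMinimal n x ν) (hS : ∀ p, sqNormShape n x ν p = S)
    (a : EuclideanSpace ℝ (Fin (n + 2))) :
    ∫ p, height x a p * height ν a p * traceShapeCube n x ν p ∂(volumeMeasure n x) =
      S * ((∫ p, height x a p ^ 2 ∂(volumeMeasure n x))
        - ∫ p, height ν a p ^ 2 ∂(volumeMeasure n x)) := by
  have hT := trace_eq_zero_of_isMinimal hn hx hν hmin
  have hS' : ∀ p, traceCLM _ (ambientShape n x ν p ∘L ambientShape n x ν p) = S := fun p => by
    rw [← sqNormShape_eq hx hν, hS]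
  have i1 := (integrable_height_sq hx hν a).const_mul S
  have i2 := (integrable_height_normal_sq hx hν a).const_mul S
  have i3 := integrable_inner_shape_shape hx hν a
  have h1 : ∫ p, (⟪ambientShape n x ν p a, ambientShape n x ν p a⟫ - S * height ν a p ^ 2)
      ∂(volumeMeasure n x) = 0 := by
    rw [← integral_newton hx hν a]
    congr 1
    funext p
    rw [hT, hS', height, real_inner_comm a (ν p)]
    ring
  have h2 : ∫ p, (⟪ambientShape n x ν p a, ambientShape n x ν p a⟫ - S * height x a p ^ 2
      + height x a p * height ν a p * traceShapeCube n x ν p) ∂(volumeMeasure n x) = 0 := by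
    rw [← integral_shape_sq hx hν hT hS' a]
    congr 1
    funext p
    rw [traceShapeCube, (trace_shapeOperator hx hν p).2.2, height, height,
      real_inner_comm a (x p), real_inner_comm a (ν p)]
  rw [integral_sub i3 i2, integral_const_mul] at h1
  have i4 : Integrable (fun p => ⟪ambientShape n x ν p a, ambientShape n x ν p a⟫
      - S * height x a p ^ 2) (volumeMeasure n x) := i3.sub i1
  rw [integral_add i4 (integrable_heights_mul_traceShapeCube hx hν a),
    integral_sub i3 i1, integral_const_mul] at h2
  linarith

end ConstantSqNorm

end IntegralEinstein

end SubmanifoldGeometry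

end

/-! ### The criterion and its consequences. -/

theorem theorem2p2 (n : ℕ) (hn : 3 ≤ n) (M : Type*) [TopologicalSpace M]
    [ChartedSpace (EuclideanSpace ℝ (Fin n)) M] [IsManifold (𝓡 n) ∞ M]
    [CompactSpace M] [T2Space M] [MeasurableSpace M] [BorelSpace M]
    (x ν : M → EuclideanSpace ℝ (Fin (n + 2)))
    (hx : IsSphereHypersurface n x) (hν : IsUnitNormal n x ν) :
    (∀ p, normalizedScalarCurvature n x p - 1 =
        ((n : ℝ) ^ 2 * meanCurvature n x ν p ^ 2 - sqNormShape n x ν p) /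
          ((n : ℝ) * ((n : ℝ) - 1))) ∧
    (IsIntegralEinstein n x ↔ ∀ a : EuclideanSpace ℝ (Fin (n + 2)), ‖a‖ = 1 →
        ∫ p, (1 - ((n : ℝ) + 1) * height x a p ^ 2 - height ν a p ^ 2) ∂(volumeMeasure n x) =
        ∫ p, (normalizedScalarCurvature n x p - 1) *
          (1 - height x a p ^ 2 - ((n : ℝ) + 1) * height ν a p ^ 2) ∂(volumeMeasure n x)) ∧
    (IsMinimal n x ν →
      (IsIntegralEinstein n x ↔ ∀ a : EuclideanSpace ℝ (Fin (n + 2)), ‖a‖ = 1 →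
        ∫ p, sqNormShape n x ν p *
          (1 - height x a p ^ 2 - ((n : ℝ) + 1) * height ν a p ^ 2) ∂(volumeMeasure n x) = 0)) ∧
    (IsMinimal n x ν → ∀ p,
      traceShapeCube n x ν p = 3 * (n.choose 3 : ℝ) * thirdMeanCurvature n x ν p) ∧
    (IsMinimal n x ν → ∀ S : ℝ, 0 < S → (∀ p, sqNormShape n x ν p = S) →
      (∀ a : EuclideanSpace ℝ (Fin (n + 2)), ‖a‖ = 1 →
        ∫ p, einsteinDefect n x a p ∂(volumeMeasure n x) =
          S * (((n : ℝ) + 2) * (∫ p, height x a p ^ 2 ∂(volumeMeasure n x))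
            - (volumeMeasure n x).real Set.univ)) ∧
      (IsIntegralEinstein n x ↔ ∀ a : EuclideanSpace ℝ (Fin (n + 2)), ‖a‖ = 1 →
        ∫ p, height x a p ^ 2 ∂(volumeMeasure n x) =
          1 / ((n : ℝ) + 2) * (volumeMeasure n x).real Set.univ) ∧
      (IsIntegralEinstein n x ↔ ∀ a : EuclideanSpace ℝ (Fin (n + 2)), ‖a‖ = 1 →
        ∫ p, height ν a p ^ 2 ∂(volumeMeasure n x) =
          1 / ((n : ℝ) + 2) * (volumeMeasure n x).real Set.univ) ∧
      (IsIntegralEinstein n x ↔ ∀ a : EuclideanSpace ℝ (Fin (n + 2)), ‖a‖ = 1 →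
        ∫ p, height x a p ^ 2 ∂(volumeMeasure n x) =
          ∫ p, height ν a p ^ 2 ∂(volumeMeasure n x)) ∧
      (IsIntegralEinstein n x ↔ ∀ a : EuclideanSpace ℝ (Fin (n + 2)), ‖a‖ = 1 →
        ∫ p, height x a p * height ν a p * traceShapeCube n x ν p ∂(volumeMeasure n x) = 0)) := by
  have hn0 : n ≠ 0 := by omega
  have hnpos : (0 : ℝ) < n := by exact_mod_cast Nat.pos_of_ne_zero hn0
  have hn1 : (n : ℝ) - 1 ≠ 0 := by
    have : (3 : ℝ) ≤ n := by exact_mod_cast hn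
    linarith
  have hn2 : (n : ℝ) + 2 ≠ 0 := by positivity
  have hn3 : (n : ℝ) + 1 ≠ 0 := by positivity
  refine ⟨normalizedScalarCurvature_sub_one hn0 hn1 hx hν, ?_, fun hmin => ?_,
    fun hmin p => traceShapeCube_eq hn hx hν (hmin p), fun hmin S hS hconst => ?_⟩
  · refine forall₂_congr fun a ha => ?_
    rw [integral_einsteinDefect hn0 hn1 hx hν ha, mul_eq_zero, or_iff_right hn1, sub_eq_zero]
  · refine forall₂_congr fun a ha => ?_
    rw [integral_einsteinDefect_of_isMinimal hn0 hn1 hx hν hmin ha, mul_eq_zero,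
      or_iff_right (inv_ne_zero hnpos.ne')]
  · have hdef {a : EuclideanSpace ℝ (Fin (n + 2))} (ha : ‖a‖ = 1) :=
      integral_einsteinDefect_of_sqNormShape_const hn0 hn1 hx hν hmin hconst ha
    have hnormal {a : EuclideanSpace ℝ (Fin (n + 2))} (ha : ‖a‖ = 1) :=
      integral_height_normal_sq_of_isMinimal hn0 hx hν hmin ha
    have hzero : ∀ a : EuclideanSpace ℝ (Fin (n + 2)), ‖a‖ = 1 →
        (∫ p, einsteinDefect n x a p ∂(volumeMeasure n x) = 0 ↔
          ((n : ℝ) + 2) * ∫ p, height x a p ^ 2 ∂(volumeMeasure n x) =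
            (volumeMeasure n x).real Set.univ) := fun a ha => by
      rw [hdef ha, mul_eq_zero, or_iff_right hS.ne', sub_eq_zero]
    refine ⟨fun a ha => hdef ha, forall₂_congr fun a ha => ?_, forall₂_congr fun a ha => ?_,
      forall₂_congr fun a ha => ?_, forall₂_congr fun a ha => ?_⟩
    · rw [hzero a ha, one_div, eq_inv_mul_iff_mul_eq₀ hn2]
    · rw [hzero a ha, hnormal ha, one_div, eq_inv_mul_iff_mul_eq₀ hn2]
      -- After ∫ψ² is replaced by Vol - (n+1)∫φ², condition (ii) is condition (i) multiplied by
      -- -(n+1).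
      refine ⟨fun h => by linear_combination (-(n : ℝ) - 1) * h, fun h => ?_⟩
      apply mul_left_cancel₀ hn3
      linear_combination -h
    · rw [hzero a ha, hnormal ha]
      constructor <;> intro h <;> linarith
    · rw [hzero a ha, integral_heights_mul_traceShapeCube hn0 hx hν hmin hconst, mul_eq_zero,
        or_iff_right hS.ne', hnormal ha]
      constructor <;> intro h <;> linarith
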